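/- **Theorem.** Let $G$ be a finite simple undirected graph and let $\varepsilon\in(0,1]$ be such that $1/\varepsilon$ is a power of $2$. Consider the algorithm below, where in every pass over the edges each arc of $G$ is read exactly once, in an arbitrary order that may differ from pass to pass. For every choice of these orders the algorithm can be carried out to its end, and, however its remaining free choices are made, its output is a matching $M$ of $G$ with $|N|\le(1+\varepsilon)\,|M|$ for every matching $N$ of $G$; that is, $M$ is a $(1+\varepsilon)$-approximate maximum matching. **Conventions.** Each edge $\{u,v\}$ gives the two arcs $(u,v)$ and $(v,u)$. With respect to the current matching $M$, an edge or arc is *matched* if the edge is in $M$, and a vertex is *free* if it is in no matched edge. An *augmenting path* is a simple path with two distinct free endpoints whose edges are alternately unmatched and matched. Put $\ell_{\max}=3/\varepsilon$. **The algorithm.** Let $M$ be the maximal matching found greedily in one pass. For $h=\frac12,\frac14,\frac18,\dots,\frac{\varepsilon^2}{64}$, perform $\frac{144}{h\varepsilon}$ times: run a *phase*, which returns a set $\mathcal P$ of augmenting paths, and replace $M$ by $M\oplus\bigcup_{P\in\mathcal P}E(P)$. Return $M$. **Data of a phase.** A blossom is a vertex set $B$ together with an edge set $E_B$; the trivial blossom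 of $v$ is $\{v\}$ with no edges. Each matched arc $a$ has a label $\ell(a)$, initially $\ell_{\max}+1$. Each free vertex $\alpha$ has a structure $S_\alpha=(G_\alpha,\Omega_\alpha,w_\alpha)$: vertices and arcs forming $G_\alpha$, a set $\Omega_\alpha$ of blossoms, and a working vertex $w_\alpha$ (possibly $\emptyset$). Initially $G_\alpha$ is the single vertex $\alpha$, $\Omega_\alpha$ consists of its trivial blossom, and $w_\alpha=\{\alpha\}$. Let $\Omega$ consist of all $\Omega_\alpha$ and all trivial blossoms, and let $\Omega(v)$ be the largest blossom in $\Omega$ containing $v$. Contracting these largest blossoms turns $G_\alpha$ into a tree $T_\alpha$ rooted at $\Omega(\alpha)$, whose arcs point from parent to child; the vertices of $T_\alpha$ at even depth are *outer*, those at odd depth *inner*. Initially $\mathcal P=\emptyset$ and no vertex is removed. **A phase** consists of $\frac{72}{h\varepsilon}$ *pass-bundles*. At the start of each, $S_\alpha$ is marked on hold if and only if $G_\alpha$ has at least $\frac6h+1$ vertices, and every structure is marked not modified. Every structure involved in one of the operations Augment, Contract, Overtake below is marked modified. The pass-bundle then performs three procedures. 1. *Extend.* Read each arc $(u,v)$ in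 one pass. Skip it if $u$ or $v$ is removed, if $\Omega(u)=\Omega(v)$, if $\Omega(u)$ is not the working vertex of a structure, if $(u,v)$ is matched, or if the structure $S_\alpha$ containing $u$ is on hold or modified. Otherwise, if $\Omega(v)$ is an outer vertex of $T_\alpha$, perform Contract on $(u,v)$; if it is an outer vertex of another tree, perform Augment on $(u,v)$. Otherwise let $a=(v,t)$ be the matched arc with tail $v$, and let $d$ be $0$ if $\Omega(u)$ contains a free vertex and otherwise the label of the matched arc that enters $\Omega(u)$ from outside; if $d+1<\ell(a)$, perform Overtake on $(u,v)$ and $a$, which includes setting $\ell(a)=d+1$. 2. *Contract and augment.* While there are a structure $S_\alpha$ and an arc $(u,v)$ of $G$ joining two vertices of $G_\alpha$ such that $\Omega(u)=w_\alpha$ and $\Omega(v)\ne\Omega(u)$ is outer, perform Contract on such an arc. Then read each arc $(u,v)$ in one pass, and perform Augment on it whenever $\Omega(u)$ and $\Omega(v)$ are outer vertices of two different trees. 3. *Backtrack.* For each structure that is neither on hold nor modified and has $w_\alpha\neq\emptyset$: if $w_\alpha$ is the root of $T_\alpha$, put $w_\alpha=\emptyset$; otherwise replace $w_\alpha$ by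 the parent of its parent. **Augment** $(u,v)$, for $u$ in $S_\alpha$ and $v$ in $S_\beta$: the tree path from $\Omega(\alpha)$ to $\Omega(u)$, the arc $(u,v)$, and the tree path from $\Omega(v)$ to $\Omega(\beta)$ form a path in the contracted graph. Add to $\mathcal P$ an augmenting path of $G$ from $\alpha$ to $\beta$ obtained from it by replacing each blossom $B$ on it by a path in $E_B$. Remove all vertices of $G_\alpha$ and $G_\beta$ for the rest of the phase, and discard both structures. **Contract** $(u,v)$, within $S_\alpha$: let $B$ be the union of the blossoms on the unique cycle of $T_\alpha+(\Omega(u),\Omega(v))$, and let $E_B$ consist of their edge sets, the edges of $G_\alpha$ giving the cycle's tree edges, and $\{u,v\}$. Add $(u,v)$ to $G_\alpha$, add $B$ to $\Omega_\alpha$, put $w_\alpha=B$, and set the labels of all matched arcs with both ends in $B$ to $0$. **Overtake** of $a=(v,t)$ by $S_\alpha$ through $(u,v)$: (i) If $a$ is in no structure, add the vertices $v,t$, the arcs $(u,v),(v,t)$ and the trivial blossoms of $v,t$ to $S_\alpha$, and put $w_\alpha=\{t\}$. (ii) If $a$ is in $S_\alpha$, replace in $G_\alpha$ the unmatched arc $(p,v)$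 that joins $\Omega(v)$ to its parent by $(u,v)$, and put $w_\alpha=\Omega(t)$. (iii) If $a$ is in another structure $S_\beta$, delete from $G_\beta$ the unmatched arc $(p,v)$ that joins $\Omega(v)$ to its parent, add $(u,v)$ to $G_\alpha$, and move the vertices, arcs and blossoms of the subtree of $T_\beta$ below and including $\Omega(v)$ from $S_\beta$ to $S_\alpha$. If $w_\beta$ was in the subtree of $\Omega(t)$, put $w_\alpha$ equal to the old $w_\beta$ and $w_\beta=\Omega(p)$; otherwise put $w_\alpha=\Omega(t)$. -/

import Mathlib

/-!
A scaled multi-phase algorithm for approximate maximum matching in a finite simple graph `G`.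

Throughout, `M : Set (Sym2 V)` is the current matching. The parameters `ε` and `h` enter through
their inverses `E = 1 / ε` and `H = 1 / h`, which are natural numbers (powers of two), so that
every derived parameter is an exact natural number.  A procedure that leaves a choice open (which
lifted augmenting path, which arc is contracted next) is a relation between states.
-/

namespace ScaledMatching

/-! ### Basic objects -/

/-- A blossom, identified with its vertex set `B` and its edge set `E_B`. -/
structure Blossom (V : Type*) where
  verts : Set V
  edges : Set (Sym2 V)

/-- The trivial blossom `{v}`, with no edges. -/
def Blossom.triv {V : Type*} (v : V) : Blossom V := ⟨{v}, ∅⟩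

/-- A structure `S_α = (G_α, Ω_α, w'_α)`: the vertices and the arcs of `G_α`, the set `Ω_α` of
blossoms, and the working vertex `w'_α`, which is a vertex of `G_α / Ω_α`, that is, the vertex set
of a root blossom (`none` stands for `∅`). -/
structure Struc (V : Type*) where
  verts : Set V
  arcs : Set (V × V)
  blossoms : Set (Blossom V)
  work : Option (Set V)

/-- The value of `S_α` when `α` has no structure: `α` is not free, or `S_α` was removed. -/
def Struc.empty (V : Type*) : Struc V := ⟨∅, ∅, ∅, none⟩

/-- What is stored during a phase. `paths` is the set `𝒫` of augmenting paths found so far, each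
recorded by its set of edges; `onHold` and `modified` are the sets of the `α` such that `S_α` is
so marked. -/
structure State (V : Type*) where
  struc : V → Struc V
  label : V × V → ℕ
  removed : Set V
  onHold : Set V
  modified : Set V
  paths : Set (Set (Sym2 V))

/-- A vertex is free if no matched edge is incident to it. -/
def Free {V : Type*} (M : Set (Sym2 V)) (v : V) : Prop := ∀ e ∈ M, v ∉ e

/-! ### The contracted graph and the trees `T'_α` -/

namespace State

variable {V : Type*}

/-- The set `Ω`: all blossoms of all structures, and all trivial blossoms. -/
def Omega (st : State V) : Set (Blossom V) :=
  {B | (∃ α, B ∈ (st.struc α).blossoms) ∨ ∃ v, B = Blossom.triv v}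

/-- (The vertex set of) the root blossom `Ω(v)`. As `Ω` is laminar, the blossoms that contain `v`
form a chain, so that the largest of them is their union. -/
def root (st : State V) (v : V) : Set V :=
  {x | ∃ B ∈ st.Omega, v ∈ B.verts ∧ x ∈ B.verts}

/-- `X` is the parent of `Y` in `T'_α = G_α / Ω_α`: arcs of `G_α` that join different root
blossoms point from parent to child. -/
def Parent (st : State V) (α : V) (X Y : Set V) : Prop :=
  X ≠ Y ∧ ∃ x y, (x, y) ∈ (st.struc α).arcs ∧ st.root x = X ∧ st.root y = Y

/-- `X` is an ancestor of `Y` in `T'_α` (every vertex is an ancestor of itself). -/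
def Ancestor (st : State V) (α : V) : Set V → Set V → Prop :=
  Relation.ReflTransGen (st.Parent α)

/-- `X` is an outer vertex of `T'_α`: it is reached from the root `Ω(α)` by an even number of
parent-to-child steps. -/
def Outer (st : State V) (α : V) (X : Set V) : Prop :=
  α ∈ (st.struc α).verts ∧
    Relation.ReflTransGen (fun A C => ∃ B, st.Parent α A B ∧ st.Parent α B C) (st.root α) X

/-- The vertices of the unique cycle of `T'_α + {U, W}`, for two vertices `U`, `W` of the tree
`T'_α`: the tree path from `U` to `W` consists of the ancestors of `U` or `W` that are not proper
ancestors of a common ancestor of `U` and `W`. -/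
def cycleNodes (st : State V) (α : V) (U W : Set V) : Set (Set V) :=
  {X | (st.Ancestor α X U ∨ st.Ancestor α X W) ∧
    ∀ Z, st.Ancestor α Z U → st.Ancestor α Z W → st.Ancestor α X Z → Z = X}

/-- The edges of `G` available when the root blossoms in `N` are expanded: the edge sets of the
blossoms in `N`, and the edges of `G_α` that join two different members of `N`. -/
def expand (st : State V) (α : V) (N : Set (Set V)) : Set (Sym2 V) :=
  {e | (∃ B ∈ st.Omega, B.verts ∈ N ∧ e ∈ B.edges) ∨
    ∃ x y, (x, y) ∈ (st.struc α).arcs ∧ e = s(x, y) ∧ st.root x ≠ st.root y ∧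
      st.root x ∈ N ∧ st.root y ∈ N}

/-- `d = distance(u)`: it is `0` if `Ω(u)` is a free vertex of the contracted graph, and
otherwise the label of the matched arc of the contracted graph whose head is `Ω(u)`. -/
def Distance (M : Set (Sym2 V)) (st : State V) (u : V) (d : ℕ) : Prop :=
  ((∃ γ ∈ st.root u, Free M γ) ∧ d = 0) ∨
  ((¬ ∃ γ ∈ st.root u, Free M γ) ∧
    ∃ x y, s(x, y) ∈ M ∧ st.root x ≠ st.root u ∧ st.root y = st.root u ∧ d = st.label (x, y))

end State

/-! ### The basic operations on structures -/

section Operations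

variable {V : Type*}

open Classical in
/-- Replace the structure `S_α` by `S`. -/
noncomputable def State.setStruc (st : State V) (α : V) (S : Struc V) : State V :=
  { st with struc := fun γ => if γ = α then S else st.struc γ }

/-- The blossom that `T'_α + (Ω(u), Ω(v))` contains. -/
def newBlossom (st : State V) (α u v : V) : Blossom V where
  verts := ⋃₀ st.cycleNodes α (st.root u) (st.root v)
  edges := insert s(u, v) (st.expand α (st.cycleNodes α (st.root u) (st.root v)))

open Classical in
/-- `Contract(g)` for `g = (u, v)`, whose endpoints lie in the structure `S_α`. -/
noncomputable def contract (M : Set (Sym2 V)) (st : State V) (α u v : V) : State V :=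
  let B := newBlossom st α u v
  let S := st.struc α
  { st.setStruc α ⟨S.verts, insert (u, v) S.arcs, insert B S.blossoms, some B.verts⟩ with
    label := fun a => if s(a.1, a.2) ∈ M ∧ a.1 ∈ B.verts ∧ a.2 ∈ B.verts then 0 else st.label a
    modified := insert α st.modified }

/-- A path of `G` whose edges are alternately matched and unmatched and whose endpoints are
free. -/
def IsAugmentingPath {G : SimpleGraph V} (M : Set (Sym2 V)) {α β : V} (p : G.Walk α β) : Prop :=
  p.IsPath ∧ α ≠ β ∧ Free M α ∧ Free M β ∧ p.edges.IsChain (fun e f => e ∈ M ↔ f ∉ M)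

/-- `p` is obtained from the augmenting path `P'` of the contracted graph, which runs from the root
of `T'_α` to `Ω(u)`, along `(u, v)`, and from `Ω(v)` to the root of `T'_β`, by replacing each
blossom on `P'` by an alternating path inside that blossom. -/
def IsLiftedPath {G : SimpleGraph V} (M : Set (Sym2 V)) (st : State V) (u v : V) {α β : V}
    (p : G.Walk α β) : Prop :=
  IsAugmentingPath M p ∧
    ∀ e ∈ p.edges, e = s(u, v) ∨ e ∈ st.expand α {X | st.Ancestor α X (st.root u)} ∨
      e ∈ st.expand β {X | st.Ancestor β X (st.root v)}

/-- `Augment(g, 𝒫)`: record the path with edge set `P`, and remove `S_α` and `S_β`. -/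
noncomputable def augment (st : State V) (α β : V) (P : Set (Sym2 V)) : State V :=
  { (st.setStruc α (Struc.empty V)).setStruc β (Struc.empty V) with
    removed := st.removed ∪ (st.struc α).verts ∪ (st.struc β).verts
    modified := st.modified ∪ {α, β}
    paths := insert P st.paths }

open Classical in
/-- Set the label of the arc `a` to `k`. -/
noncomputable def State.setLabel (st : State V) (a : V × V) (k : ℕ) : State V :=
  { st with label := fun b => if b = a then k else st.label b }

/-- `Overtake(g, a, k)`, Case 1: `g = (u, v)`, `a = (v, t)`, and `a` is in no structure. -/
noncomputable def overtakeNew (st : State V) (α u v t : V) (k : ℕ) : State V :=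
  let S := st.struc α
  { (st.setStruc α
      ⟨S.verts ∪ {v, t}, S.arcs ∪ {(u, v), (v, t)},
        S.blossoms ∪ {Blossom.triv v, Blossom.triv t}, some (st.root t)⟩).setLabel (v, t) k with
    modified := insert α st.modified }

/-- `Overtake(g, a, k)`, Case 2.1: `a` is in the same structure `S_α`, and `(p, v)` is the arc to
`v` from its parent. -/
noncomputable def overtakeSame (st : State V) (α u v t p : V) (k : ℕ) : State V :=
  let S := st.struc α
  { (st.setStruc α
      ⟨S.verts, (S.arcs \ {(p, v)}) ∪ {(u, v)}, S.blossoms, some (st.root t)⟩).setLabel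
        (v, t) k with
    modified := insert α st.modified }

open Classical in
/-- `Overtake(g, a, k)`, Case 2.2: `a` is in another structure `S_β`, and `(p, v)` is the arc to
`v` from its parent. -/
noncomputable def overtakeOther (st : State V) (α β u v t p : V) (k : ℕ) : State V :=
  let S := st.struc α
  let R := st.struc β
  -- the vertices of the subtree of `Ω(v)`
  let X : Set V := {x | x ∈ R.verts ∧ st.Ancestor β (st.root v) (st.root x)}
  let A : Set (V × V) := {a | a ∈ R.arcs ∧ a.1 ∈ X ∧ a.2 ∈ X}
  let Q : Set (Blossom V) := {B | B ∈ R.blossoms ∧ B.verts ⊆ X}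
  -- the working vertex of `S_β` is in the subtree of `Ω(t)`
  let c : Prop := ∃ W, R.work = some W ∧ st.Ancestor β (st.root t) W
  { ((st.setStruc α
      ⟨S.verts ∪ X, S.arcs ∪ {(u, v)} ∪ A, S.blossoms ∪ Q,
        if c then R.work else some (st.root t)⟩).setStruc β
      ⟨R.verts \ X, (R.arcs \ {(p, v)}) \ A, R.blossoms \ Q,
        if c then some (st.root p) else R.work⟩).setLabel (v, t) k with
    modified := st.modified ∪ {α, β} }

/-- `Overtake(g, a, k)` with `g = (u, v)` and `a = (v, t)`, performed by `S_α`, turns the state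
`st` into `st'`. -/
inductive Overtake (M : Set (Sym2 V)) (st : State V) (α u v t : V) (k : ℕ) : State V → Prop
  | new (h : ∀ β, (v, t) ∉ (st.struc β).arcs) :
      Overtake M st α u v t k (overtakeNew st α u v t k)
  | same (p : V) (h : (v, t) ∈ (st.struc α).arcs)
      (hp : (p, v) ∈ (st.struc α).arcs ∧ s(p, v) ∉ M) :
      Overtake M st α u v t k (overtakeSame st α u v t p k)
  | other (β p : V) (hβ : β ≠ α) (h : (v, t) ∈ (st.struc β).arcs)
      (hp : (p, v) ∈ (st.struc β).arcs ∧ s(p, v) ∉ M) :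
      Overtake M st α u v t k (overtakeOther st α β u v t p k)

end Operations

/-! ### One pass-bundle -/

section PassBundle

variable {V : Type*}

/-- Perform `step · a ·` for the members `a` of a list, in order. -/
def Iterate {σ A : Type*} (step : σ → A → σ → Prop) : List A → σ → σ → Prop
  | [], s, s' => s' = s
  | a :: l, s, s' => ∃ m, step s a m ∧ Iterate step l m s'

/-- The arc `(u, v)` passes the initial tests of `Extend-Active-Path`, and `S_α` is the structure
that it may extend. -/
def Considered (M : Set (Sym2 V)) (st : State V) (u v α : V) : Prop :=
  u ∉ st.removed ∧ v ∉ st.removed ∧ st.root u ≠ st.root v ∧ s(u, v) ∉ M ∧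
    u ∈ (st.struc α).verts ∧ (st.struc α).work = some (st.root u) ∧
    α ∉ st.modified ∧ α ∉ st.onHold

/-- What `Extend-Active-Path` does when it reads an arc. -/
inductive ExtendStep (G : SimpleGraph V) (M : Set (Sym2 V)) (st : State V) :
    V × V → State V → Prop
  | skip (u v : V) (h : ∀ α, ¬ Considered M st u v α) : ExtendStep G M st (u, v) st
  | contract (u v α : V) (h : Considered M st u v α) (hv : v ∈ (st.struc α).verts)
      (ho : st.Outer α (st.root v)) :
      ExtendStep G M st (u, v) (contract M st α u v)
  | augment (u v α β : V) (h : Considered M st u v α) (hβ : β ≠ α)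
      (hv : v ∈ (st.struc β).verts) (ho : st.Outer β (st.root v))
      (p : G.Walk α β) (hp : IsLiftedPath M st u v p) :
      ExtendStep G M st (u, v) (augment st α β {e | e ∈ p.edges})
  | overtake (u v α t : V) (d : ℕ) (st' : State V) (h : Considered M st u v α)
      (ho : ∀ β, ¬ st.Outer β (st.root v)) (ht : s(v, t) ∈ M)
      (hd : st.Distance M u d) (hl : d + 1 < st.label (v, t))
      (hst : Overtake M st α u v t (d + 1) st') :
      ExtendStep G M st (u, v) st'
  | ignore (u v α t : V) (d : ℕ) (h : Considered M st u v α)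
      (ho : ∀ β, ¬ st.Outer β (st.root v)) (ht : s(v, t) ∈ M)
      (hd : st.Distance M u d) (hl : ¬ d + 1 < st.label (v, t)) :
      ExtendStep G M st (u, v) st

/-- One contraction in the first step of `Contract-and-Augment`. -/
def ContractStep (G : SimpleGraph V) (M : Set (Sym2 V)) (st st' : State V) : Prop :=
  ∃ α u v, G.Adj u v ∧ u ∈ (st.struc α).verts ∧ v ∈ (st.struc α).verts ∧
    (st.struc α).work = some (st.root u) ∧ st.root v ≠ st.root u ∧ st.Outer α (st.root v) ∧
    st' = contract M st α u v

/-- The first step of `Contract-and-Augment`: contract as long as possible. -/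
def ContractAll (G : SimpleGraph V) (M : Set (Sym2 V)) (st st' : State V) : Prop :=
  Relation.ReflTransGen (ContractStep G M) st st' ∧ ∀ st'', ¬ ContractStep G M st' st''

/-- `u` and `v` are in outer vertices of the different structures `S_α` and `S_β`. -/
def Joins (st : State V) (u v α β : V) : Prop :=
  α ≠ β ∧ u ∈ (st.struc α).verts ∧ st.Outer α (st.root u) ∧
    v ∈ (st.struc β).verts ∧ st.Outer β (st.root v)

/-- What the second step of `Contract-and-Augment` does when it reads an arc. -/
inductive AugmentStep (G : SimpleGraph V) (M : Set (Sym2 V)) (st : State V) :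
    V × V → State V → Prop
  | skip (u v : V) (h : ∀ α β, ¬ Joins st u v α β) : AugmentStep G M st (u, v) st
  | augment (u v α β : V) (h : Joins st u v α β)
      (p : G.Walk α β) (hp : IsLiftedPath M st u v p) :
      AugmentStep G M st (u, v) (augment st α β {e | e ∈ p.edges})

/-- `w` is the working vertex of `S_α` after `Backtrack-Stuck-Structures`. A structure that is
neither on hold nor modified moves its working vertex to the parent of its parent, and becomes
inactive if its working vertex is the root; inactive structures stay inactive. -/
def BacktracksTo (st : State V) (α : V) (w : Option (Set V)) : Prop :=
  ((α ∈ st.onHold ∨ α ∈ st.modified ∨ (st.struc α).work = none) ∧ w = (st.struc α).work) ∨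
  (α ∉ st.onHold ∧ α ∉ st.modified ∧ ∃ W, (st.struc α).work = some W ∧
    ((W = st.root α ∧ w = none) ∨
      (W ≠ st.root α ∧ ∃ Y Z, st.Parent α Y W ∧ st.Parent α Z Y ∧ w = some Z)))

/-- `Backtrack-Stuck-Structures`. -/
def Backtrack (st st' : State V) : Prop :=
  ∃ w : V → Option (Set V), (∀ α, BacktracksTo st α (w α)) ∧
    st' = { st with struc := fun α => { st.struc α with work := w α } }

/-- Mark the structures at the beginning of a pass-bundle: on hold if there are at least
`limit_h = 6 / h + 1` vertices, and not modified. -/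
def mark (H : ℕ) (st : State V) : State V :=
  { st with
    onHold := {α | 6 * H + 1 ≤ (st.struc α).verts.ncard}
    modified := ∅ }

/-- One pass-bundle, in which `l₁` and `l₂` are the orders in which the arcs are read in
`Extend-Active-Path` and in the second step of `Contract-and-Augment`. -/
def PassBundle (G : SimpleGraph V) (M : Set (Sym2 V)) (H : ℕ) (l₁ l₂ : List (V × V))
    (st st' : State V) : Prop :=
  ∃ s₁ s₂ s₃, Iterate (ExtendStep G M) l₁ (mark H st) s₁ ∧ ContractAll G M s₁ s₂ ∧
    Iterate (AugmentStep G M) l₂ s₂ s₃ ∧ Backtrack s₃ st'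

end PassBundle

/-! ### Phases, scales, and the whole algorithm -/

section Algorithm

variable {V : Type*}

open Classical in
/-- The state at the beginning of a phase; `ℓ_max = 3 / ε`. -/
noncomputable def init (M : Set (Sym2 V)) (E : ℕ) : State V where
  struc := fun α => if Free M α then ⟨{α}, ∅, {Blossom.triv α}, some {α}⟩ else Struc.empty V
  label := fun _ => 3 * E + 1
  removed := ∅
  onHold := ∅
  modified := ∅
  paths := ∅

/-- One phase of the scale `h`, with `τ_max(h) = 72 / (h ε)` pass-bundles, followed by the
augmentation of `M` along the paths found. -/
def Phase (G : SimpleGraph V) (E H : ℕ) (l₁ l₂ : ℕ → List (V × V)) (M M' : Set (Sym2 V)) : Prop :=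
  ∃ st, Iterate (fun s τ s' => PassBundle G M H (l₁ τ) (l₂ τ) s s')
      (List.range (72 * H * E)) (init M E) st ∧
    M' = symmDiff M (⋃₀ st.paths)

open Classical in
/-- The greedy maximal matching for the order `l` of the arcs. -/
noncomputable def greedy (l : List (V × V)) : Set (Sym2 V) :=
  l.foldl (fun M a => if Free M a.1 ∧ Free M a.2 then insert s(a.1, a.2) M else M) ∅

/-- The orders in which the arcs are read in the passes over the stream whose order matters: the
initial greedy pass and, for each scale, phase and pass-bundle, the pass of `Extend-Active-Path`
and that of the second step of `Contract-and-Augment`. -/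
structure Streams (V : Type*) where
  initial : List (V × V)
  extend : ℕ → ℕ → ℕ → List (V × V)
  augment : ℕ → ℕ → ℕ → List (V × V)

/-- The list `l` contains each arc of `G` exactly once. -/
def IsStream (G : SimpleGraph V) (l : List (V × V)) : Prop :=
  l.Nodup ∧ ∀ u v, (u, v) ∈ l ↔ G.Adj u v

/-- In every pass each arc of `G` is read exactly once. -/
def Streams.Valid (G : SimpleGraph V) (σ : Streams V) : Prop :=
  IsStream G σ.initial ∧ (∀ H t τ, IsStream G (σ.extend H t τ)) ∧
    ∀ H t τ, IsStream G (σ.augment H t τ)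

/-- The inverse scales `1 / h = 2, 4, 8, …, 64 / ε ^ 2`. -/
def scales (E : ℕ) : List ℕ := (List.range (Nat.log 2 (64 * E ^ 2))).map (fun j => 2 ^ (j + 1))

/-- `M` is a possible output of the algorithm on the graph `G` with parameter `ε = 1 / E`, when the
arcs are read in the orders `σ`; the scale `h` has `144 / (h ε)` phases. -/
def Outputs (G : SimpleGraph V) (E : ℕ) (σ : Streams V) (M : Set (Sym2 V)) : Prop :=
  Iterate (fun M₁ H M₂ =>
      Iterate (fun N₁ t N₂ => Phase G E H (σ.extend H t) (σ.augment H t) N₁ N₂)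
        (List.range (144 * H * E)) M₁ M₂)
    (scales E) (greedy σ.initial) M

end Algorithm

end ScaledMatching

set_option linter.unusedSectionVars false

namespace ScaledMatching

variable {V : Type*}

/-! ### Matchings as sets of edges -/

/-! Sizes are measured by covered vertices, twice the number of edges, and a phase is judged by how
far `covered M` falls behind `covered N` for an arbitrary matching `N`. From every vertex covered by
`N` only, follow `N` and `M` alternately (`traj`). These walks are pairwise disjoint. Suppose that
at the end of a phase a walk meets no removed vertex and no outer vertex of an active path. Adjacent
outer vertices then lie in a common blossom (`Separated`), and every arc leaving an inactive outer
vertex has been read in vain (`Explored`). By `exists_traj` the even vertices of the walk are outer,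
with distance at most the number of double steps, so the walk stops at a vertex that `N` misses or
has more than `3 * E` double steps. Walks of the first kind cost nothing, those of the second are
few because they are long and disjoint, and the others are charged to active paths and removed
vertices (`covered_ncard_le`).

Active paths are few by amortization. In a pass-bundle an active structure is on hold, is modified,
or backtracks. Structures on hold are large and disjoint, hence few (`heavy_ncard_le`).
Modifications by overtaking or contraction lower the label sum `phi`, and structures that are
augmented become inactive. Backtracking deactivates a structure or takes an outer vertex off an
active path (`back_count`). So `active + ActN + 3 * phi` is a potential (`Good.bundle`), and over
all pass-bundles of a phase it forces `2 * H * active ≤ covered M` (`phase_spec`). An active path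
has at most `3 * E + 1` outer nodes, because distances increase strictly along it (`act_ncard_le`).

Removed vertices are charged to augmentations. Only small structures overtake, and each overtaking
lowers a label, so a subtree whose root has distance `D` has at most `6 * H * (l - D) + 2` vertices
(`overtake_sized`). A single augmentation therefore removes `O(H * E)` vertices. If the gap to `N`
is large at the end of a phase, that phase found many augmenting paths. Hence each scale halves the
part of the error proportional to `h / ε` (`scale_spec`), down to a harmless fraction of `ε` at the
last scale (`outputs_spec`).

That the algorithm never gets stuck is proved along with its invariants. A state is described by
vertices instead of contracted nodes (`AState`, linked by `Rep`): each vertex has the base of its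
root blossom, and each inner vertex the tail of its tree arc. Labels increase down the trees, which
gives acyclicity without a separate argument (`Child.rank_lt`). Every vertex of an outer blossom is
reached from its base by an even alternating path within the blossom's edges, which makes every
augmentation liftable (`exists_liftedPath`). -/

/-- A set of edges of `G` no two of which share a vertex. -/
structure IsMatchingSet (G : SimpleGraph V) (M : Set (Sym2 V)) : Prop where
  subset : M ⊆ G.edgeSet
  unique : ∀ u v w, s(u, v) ∈ M → s(u, w) ∈ M → v = w

open Classical in
/-- The partner of `v` in `M`, or `v` itself if `v` is free. -/
noncomputable def mate (M : Set (Sym2 V)) (v : V) : V :=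
  if h : ∃ w, s(v, w) ∈ M then h.choose else v

theorem not_free_iff {M : Set (Sym2 V)} {v : V} : ¬ Free M v ↔ ∃ w, s(v, w) ∈ M := by
  unfold Free
  push Not
  constructor
  · rintro ⟨e, he, hv⟩
    obtain ⟨w, rfl⟩ := Sym2.mem_iff_exists.1 hv
    exact ⟨w, he⟩
  · rintro ⟨w, hw⟩
    exact ⟨_, hw, Sym2.mem_mk_left _ _⟩

theorem free_iff {M : Set (Sym2 V)} {v : V} : Free M v ↔ ∀ w, s(v, w) ∉ M := by
  rw [← not_iff_not, not_free_iff]; push Not; rfl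

theorem not_free_left {M : Set (Sym2 V)} {v w : V} (h : s(v, w) ∈ M) : ¬ Free M v :=
  not_free_iff.2 ⟨w, h⟩

theorem not_free_right {M : Set (Sym2 V)} {v w : V} (h : s(v, w) ∈ M) : ¬ Free M w :=
  not_free_left (Sym2.eq_swap ▸ h)

theorem mate_mem {M : Set (Sym2 V)} {v : V} (h : ¬ Free M v) : s(v, mate M v) ∈ M := by
  have h' := not_free_iff.1 h
  unfold mate
  rw [dif_pos h']
  exact h'.choose_spec

theorem mate_of_free {M : Set (Sym2 V)} {v : V} (h : Free M v) : mate M v = v := by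
  unfold mate
  rw [dif_neg]
  rintro ⟨w, hw⟩
  exact free_iff.1 h w hw

theorem free_mate_iff {M : Set (Sym2 V)} {v : V} : Free M (mate M v) ↔ Free M v := by
  constructor
  · intro h
    by_contra h'
    exact not_free_right (mate_mem h') h
  · intro h; rwa [mate_of_free h]

namespace IsMatchingSet

variable {G : SimpleGraph V} {M : Set (Sym2 V)} (hM : IsMatchingSet G M)
include hM

theorem mate_eq {v w : V} (h : s(v, w) ∈ M) : mate M v = w :=
  hM.unique v _ _ (mate_mem (not_free_left h)) h

theorem mate_eq' {v w : V} (h : s(v, w) ∈ M) : mate M w = v :=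
  hM.mate_eq (Sym2.eq_swap ▸ h)

theorem mate_mate (v : V) : mate M (mate M v) = v := by
  by_cases h : Free M v
  · rw [mate_of_free h, mate_of_free h]
  · exact hM.mate_eq' (mate_mem h)

theorem adj {v w : V} (h : s(v, w) ∈ M) : G.Adj v w := hM.subset h

theorem mate_ne {v : V} (h : ¬ Free M v) : mate M v ≠ v :=
  (hM.adj (mate_mem h)).ne'

theorem mate_inj {v w : V} (h : mate M v = mate M w) : v = w := by
  rw [← hM.mate_mate v, h, hM.mate_mate]

end IsMatchingSet

/-- The vertices covered by `M`. -/
def covered (M : Set (Sym2 V)) : Set V := {v | ¬ Free M v}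

theorem free_insert {M : Set (Sym2 V)} {a b v : V} :
    Free (insert s(a, b) M) v ↔ v ≠ a ∧ v ≠ b ∧ Free M v := by
  simp [Free, and_assoc]

theorem IsMatchingSet.insert_edge {G : SimpleGraph V} {M : Set (Sym2 V)} (hM : IsMatchingSet G M)
    {a b : V} (hab : G.Adj a b) (ha : Free M a) (hb : Free M b) :
    IsMatchingSet G (insert s(a, b) M) where
  subset := by
    intro e he
    rcases he with rfl | he
    · exact hab
    · exact hM.subset he
  unique := by
    have ha' := free_iff.1 ha
    have hb' := free_iff.1 hb
    intro u v w h1 h2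
    simp only [Set.mem_insert_iff, Sym2.eq_iff] at h1 h2
    rcases h1 with (⟨h1, h1'⟩ | ⟨h1, h1'⟩) | h1 <;> rcases h2 with (⟨h2, h2'⟩ | ⟨h2, h2'⟩) | h2
    · rw [h1', h2']
    · exact absurd (h1.symm.trans h2) hab.ne
    · exact absurd h2 (h1 ▸ ha' _)
    · exact absurd (h2.symm.trans h1) hab.ne
    · rw [h1', h2']
    · exact absurd h2 (h1 ▸ hb' _)
    · exact absurd h1 (h2 ▸ ha' _)
    · exact absurd h1 (h2 ▸ hb' _)
    · exact hM.unique u v w h1 h2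

theorem IsMatchingSet.mono {G : SimpleGraph V} {M N : Set (Sym2 V)} (hM : IsMatchingSet G M)
    (h : N ⊆ M) : IsMatchingSet G N :=
  ⟨h.trans hM.subset, fun u v w h1 h2 => hM.unique u v w (h h1) (h h2)⟩

/-! ### Alternating walks -/

/-- The edges of a walk are alternately unmatched and matched; the first one is matched iff
`c = true`. -/
def AltWalk {G : SimpleGraph V} (M : Set (Sym2 V)) :
    Bool → ∀ {u v : V}, G.Walk u v → Prop
  | _, _, _, .nil => True
  | c, u, _, .cons (v := x) _ p => (s(u, x) ∈ M ↔ c = true) ∧ AltWalk M (!c) p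

section AltWalk

variable {G : SimpleGraph V} {M : Set (Sym2 V)}

theorem altWalk_append {c : Bool} {u v w : V} (p : G.Walk u v) (q : G.Walk v w)
    (hp : AltWalk M c p) (hq : AltWalk M (c ^^ decide (p.length % 2 = 1)) q) :
    AltWalk M c (p.append q) := by
  induction p generalizing c with
  | nil => simpa using hq
  | cons h p ih =>
    refine ⟨hp.1, ih q hp.2 ?_⟩
    rw [SimpleGraph.Walk.length_cons] at hq
    convert hq using 1
    rcases Nat.mod_two_eq_zero_or_one p.length with h0 | h0 <;> cases c <;>
      simp [h0, Nat.add_mod]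

theorem altWalk_reverse {c : Bool} {u v : V} (p : G.Walk u v) (hp : AltWalk M c p) :
    AltWalk M (c ^^ decide (p.length % 2 = 0)) p.reverse := by
  induction p generalizing c with
  | nil => trivial
  | cons h p ih =>
    rw [SimpleGraph.Walk.reverse_cons]
    refine altWalk_append _ _ ?_ ⟨?_, trivial⟩
    · convert ih hp.2 using 1
      rw [SimpleGraph.Walk.length_cons]
      rcases Nat.mod_two_eq_zero_or_one p.length with h0 | h0 <;> cases c <;>
        simp [h0, Nat.add_mod]
    · rw [Sym2.eq_swap, hp.1, SimpleGraph.Walk.length_reverse, SimpleGraph.Walk.length_cons]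
      rcases Nat.mod_two_eq_zero_or_one p.length with h0 | h0 <;> cases c <;>
        simp [h0, Nat.add_mod]

theorem AltWalk.isChain {c : Bool} {u v : V} (p : G.Walk u v) (hp : AltWalk M c p) :
    p.edges.IsChain (fun e f => e ∈ M ↔ f ∉ M) := by
  induction p generalizing c with
  | nil => simp
  | cons h p ih =>
    rw [SimpleGraph.Walk.edges_cons]
    cases p with
    | nil => simp
    | cons h' p =>
      rw [SimpleGraph.Walk.edges_cons, List.isChain_cons_cons]
      refine ⟨?_, ?_⟩
      · have h1 := hp.1
        have h2 := hp.2.1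
        rw [h1, h2]
        cases c <;> simp
      · simpa using ih hp.2

theorem altWalk_of_isChain {c : Bool} {u v : V} (p : G.Walk u v)
    (h : p.edges.IsChain (fun e f => e ∈ M ↔ f ∉ M))
    (hc : ∀ e ∈ p.edges.head?, e ∈ M ↔ c = true) : AltWalk M c p := by
  induction p generalizing c with
  | nil => trivial
  | @cons u x v hux p ih =>
    rw [SimpleGraph.Walk.edges_cons] at h hc
    have h0 : s(u, x) ∈ M ↔ c = true := hc _ (by simp)
    refine ⟨h0, ih h.tail ?_⟩
    intro e he
    have h1 := (List.isChain_cons.1 h).1 e he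
    rw [h0] at h1
    cases c <;> simp_all

theorem IsAugmentingPath.altWalk {α β : V} {p : G.Walk α β} (h : IsAugmentingPath M p) :
    AltWalk M false p := by
  refine altWalk_of_isChain p h.2.2.2.2 ?_
  intro e he
  cases p with
  | nil => simp at he
  | cons h' p =>
    simp only [SimpleGraph.Walk.edges_cons, List.head?_cons, Option.mem_def,
      Option.some.injEq] at he
    subst he
    simpa using free_iff.1 h.2.2.1 _

theorem AltWalk.congr {N : Set (Sym2 V)} {c : Bool} {u v : V} (p : G.Walk u v)
    (hp : AltWalk M c p) (h : ∀ e ∈ p.edges, e ∈ M ↔ e ∈ N) : AltWalk N c p := by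
  induction p generalizing c with
  | nil => trivial
  | cons h' p ih =>
    refine ⟨?_, ih hp.2 fun e he => h e (by simp [he])⟩
    rw [← h _ (by simp)]
    exact hp.1

/-- The symmetric difference with an augmenting path is a matching that covers its two ends in
addition. -/
theorem IsMatchingSet.symmDiff_path (n : ℕ) : ∀ {M : Set (Sym2 V)} (_ : IsMatchingSet G M)
    {α β : V} (p : G.Walk α β), p.length ≤ n → p.IsPath → α ≠ β → Free M α → Free M β →
    AltWalk M false p →
    IsMatchingSet G (symmDiff M {e | e ∈ p.edges}) ∧
      covered (symmDiff M {e | e ∈ p.edges}) = covered M ∪ {α, β} := by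
  induction n with
  | zero =>
    intro M hM α β p hl hp hne
    cases p with
    | nil => exact absurd rfl hne
    | cons h p => simp at hl
  | succ n ih =>
    intro M hM α β p hl hp hne hα hβ halt
    match p, hl, hp, halt with
    | .nil, _, _, _ => exact absurd rfl hne
    | .cons h .nil, _, _, halt =>
      have hset : symmDiff M {e | e ∈ (SimpleGraph.Walk.cons h .nil).edges} =
          insert s(α, β) M := by
        have : s(α, β) ∉ M := free_iff.1 hα _
        ext e
        simp only [SimpleGraph.Walk.edges_cons, SimpleGraph.Walk.edges_nil, List.mem_singleton,
          Set.mem_symmDiff, Set.mem_ofPred_eq, Set.mem_insert_iff]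
        by_cases he : e = s(α, β)
        · subst he; simp [this]
        · simp [he]
      rw [hset]
      refine ⟨hM.insert_edge h hα hβ, ?_⟩
      ext v
      simp only [covered, Set.mem_ofPred_eq, free_insert, Set.mem_union, Set.mem_insert_iff,
        Set.mem_singleton_iff]
      tauto
    | .cons (v := x) h (.cons (v := y) h' q), hl, hp, halt =>
      have hq : q.IsPath := hp.of_cons.of_cons
      have hx : x ∉ q.support := (SimpleGraph.Walk.cons_isPath_iff _ _).1 hp.of_cons |>.2
      have hα' : α ∉ (SimpleGraph.Walk.cons h' q).support :=
        (SimpleGraph.Walk.cons_isPath_iff _ _).1 hp |>.2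
      have hαq : α ∉ q.support := fun hh => hα' (by simp [hh])
      have hαx : α ≠ x := h.ne
      have hαy : α ≠ y := fun hh => hαq (hh ▸ q.start_mem_support)
      have hxy : x ≠ y := h'.ne
      have he : s(α, x) ∉ M := free_iff.1 hα _
      have hf : s(x, y) ∈ M := by simpa using halt.2.1
      have hyβ : y ≠ β := by
        rintro rfl
        exact not_free_right hf hβ
      have hne' : s(α, x) ≠ s(x, y) := by
        intro hh
        exact he (hh ▸ hf)
      have heq : s(α, x) ∉ q.edges := fun hh => hαq (q.fst_mem_support_of_mem_edges hh)
      have hfq : s(x, y) ∉ q.edges := fun hh => hx (q.fst_mem_support_of_mem_edges hh)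
      -- Switching the first two edges covers `α` and frees `y`, which becomes the start of a path
      -- shorter by two edges.
      set M₁ : Set (Sym2 V) := insert s(α, x) (M \ {s(x, y)}) with hM₁
      have hxfree : Free (M \ {s(x, y)}) x := by
        rw [free_iff]
        intro w hw
        have := hM.unique x w y hw.1 hf
        exact hw.2 (by simp [this])
      have hyfree : Free (M \ {s(x, y)}) y := by
        rw [free_iff]
        intro w hw
        have := hM.unique y w x hw.1 (Sym2.eq_swap ▸ hf)
        exact hw.2 (by simp [this, Sym2.eq_swap])
      have hM1 : IsMatchingSet G M₁ :=
        (hM.mono Set.sdiff_subset).insert_edge h (fun e he => hα e he.1) hxfree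
      have hcov : covered M₁ = (covered M \ {y}) ∪ {α} := by
        ext v
        simp only [covered, Set.mem_ofPred_eq, hM₁, free_insert, Set.mem_union, Set.mem_sdiff,
          Set.mem_singleton_iff]
        have h1 : v ≠ x → v ≠ y → (Free (M \ {s(x, y)}) v ↔ Free M v) := by
          intro h1 h2
          rw [free_iff, free_iff]
          refine forall_congr' fun w => not_congr ?_
          simp only [Set.mem_sdiff, Set.mem_singleton_iff, Sym2.eq_iff]
          tauto
        have h2 := not_free_left hf
        have h3 := not_free_right hf
        rcases eq_or_ne v x with rfl | hvx
        · tauto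
        · rcases eq_or_ne v y with rfl | hvy
          · have := hαy.symm
            tauto
          · rw [h1 hvx hvy]
            tauto
      have hset : symmDiff M {e | e ∈ (SimpleGraph.Walk.cons h (.cons h' q)).edges} =
          symmDiff M₁ {e | e ∈ q.edges} := by
        ext e
        simp only [SimpleGraph.Walk.edges_cons, List.mem_cons, Set.mem_symmDiff,
          Set.mem_ofPred_eq, hM₁, Set.mem_insert_iff, Set.mem_sdiff, Set.mem_singleton_iff]
        by_cases h1 : e = s(α, x)
        · subst h1; simp [he, heq]
        · by_cases h2 : e = s(x, y)
          · subst h2; simp [hf, hfq, h1]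
          · simp [h1, h2]
      have hyM : Free M₁ y := by
        rw [hM₁, free_insert]
        exact ⟨hαy.symm, hxy.symm, hyfree⟩
      have hβM : Free M₁ β := by
        rw [hM₁, free_insert]
        refine ⟨hne.symm, ?_, fun e he => hβ e he.1⟩
        rintro rfl
        exact not_free_left hf hβ
      have haltq : AltWalk M₁ false q := by
        refine AltWalk.congr q halt.2.2 ?_
        intro e heq'
        have h1 : e ≠ s(α, x) := fun hh => heq (hh ▸ heq')
        have h2 : e ≠ s(x, y) := fun hh => hfq (hh ▸ heq')
        simp [hM₁, h1, h2]
      rw [hset]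
      have hlq : q.length ≤ n := by
        simp only [SimpleGraph.Walk.length_cons] at hl; omega
      obtain ⟨r1, r2⟩ := ih hM1 q hlq hq hyβ hyM hβM haltq
      refine ⟨r1, ?_⟩
      rw [r2, hcov]
      have h3 : y ∈ covered M := not_free_right hf
      ext v
      simp only [Set.mem_union, Set.mem_sdiff, Set.mem_singleton_iff, Set.mem_insert_iff]
      rcases eq_or_ne v y with rfl | hvy
      · simp [h3]
      · simp [hvy]; tauto

end AltWalk

end ScaledMatching

namespace ScaledMatching

variable {V : Type*}

/-! ### Comparing two matchings along alternating trajectories -/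

/-- The even vertices of the trajectory of `α` that alternately follows `N` and `M`. -/
noncomputable def traj (M N : Set (Sym2 V)) (α : V) : ℕ → V
  | 0 => α
  | i + 1 => mate M (mate N (traj M N α i))

/-- The trajectory of `α` can be followed for `i` double steps. -/
def Runs (M N : Set (Sym2 V)) (α : V) (i : ℕ) : Prop :=
  Free M α ∧ ∀ j < i, ¬ Free N (traj M N α j) ∧ ¬ Free M (mate N (traj M N α j))

section Trajectories

variable {G : SimpleGraph V} {M N : Set (Sym2 V)}

theorem Runs.mono {α : V} {i j : ℕ} (h : Runs M N α i) (hj : j ≤ i) : Runs M N α j :=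
  ⟨h.1, fun k hk => h.2 k (hk.trans_le hj)⟩

theorem Runs.not_free {α : V} {i : ℕ} (h : Runs M N α (i + 1)) :
    ¬ Free M (traj M N α (i + 1)) := by
  have := (h.2 i (Nat.lt_succ_self i)).2
  rwa [traj, free_mate_iff]

/-- Partner maps are injective, so a coincidence can be pulled back one double step at a time. It
can only end with both walks at their starts, since a start is free in `M` while every later even
vertex is covered. -/
theorem traj_inj (hM : IsMatchingSet G M) (hN : IsMatchingSet G N) {α β : V} :
    ∀ {i j : ℕ}, Runs M N α i → Runs M N β j → traj M N α i = traj M N β j → α = β ∧ i = j := by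
  intro i
  induction i with
  | zero =>
    intro j hi hj h
    cases j with
    | zero => exact ⟨h, rfl⟩
    | succ j => exact absurd (h ▸ hi.1) hj.not_free
  | succ i ih =>
    intro j hi hj h
    cases j with
    | zero => exact absurd (h ▸ hj.1) hi.not_free
    | succ j =>
      have := ih (hi.mono (Nat.le_succ i)) (hj.mono (Nat.le_succ j))
        (hN.mate_inj (hM.mate_inj h))
      exact ⟨this.1, by rw [this.2]⟩

/-- Even and odd vertices of a walk never coincide. A coincidence would fold the walk onto itself,
and the fold closes in from both ends until some vertex is its own partner. -/
theorem mate_traj_ne (hM : IsMatchingSet G M) (hN : IsMatchingSet G N) {α : V} (n : ℕ) :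
    ∀ {s i : ℕ}, i ≤ s + n → s ≤ i → Runs M N α i → ¬ Free N (traj M N α i) →
      mate N (traj M N α i) ≠ traj M N α s := by
  induction n using Nat.strong_induction_on with
  | _ n ih =>
    intro s i hn hsi hr hf h
    rcases Nat.eq_or_lt_of_le hsi with rfl | hlt
    · exact hN.mate_ne hf h
    · obtain ⟨i, rfl⟩ : ∃ k, i = k + 1 := ⟨i - 1, by omega⟩
      -- The coincidence moves inwards: one step on from `s`, one step back from `i`. The distance
      -- between the two positions drops by two.
      have h1 : mate N (traj M N α i) = traj M N α (s + 1) := by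
        rw [traj, ← h, hN.mate_mate, traj, hM.mate_mate]
      rcases Nat.eq_or_lt_of_le (Nat.le_of_lt_succ hlt) with rfl | hlt'
      · exact hM.mate_ne (hr.2 s (Nat.lt_succ_self s)).2 h1.symm
      · refine ih (n - 2) (by omega) (s := s + 1) (i := i) (by omega) hlt'
          (hr.mono (Nat.le_succ i)) (hr.2 i (Nat.lt_succ_self i)).1 h1

variable [Fintype V]

/-- If every trajectory from a set `S` meets `T`, then `S` is no larger than `T`. -/
theorem ncard_le_of_traj (hM : IsMatchingSet G M) (hN : IsMatchingSet G N) {S T : Set V}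
    (h : ∀ α ∈ S, ∃ i, Runs M N α i ∧ traj M N α i ∈ T) : S.ncard ≤ T.ncard := by
  classical
  choose! f hf using h
  refine Set.ncard_le_ncard_of_injOn (fun α => traj M N α (f α)) (fun α hα => (hf α hα).2) ?_
    (Set.toFinite _)
  intro α hα β hβ hab
  exact (traj_inj hM hN (hf α hα).1 (hf β hβ).1 hab).1

/-- The positions `1, …, l` of the walks are distinct and covered by `M`. Position `0` is left out
because it is free. -/
theorem ncard_mul_le_of_runs (hM : IsMatchingSet G M) (hN : IsMatchingSet G N) {S : Set V}
    {l : ℕ} (h : ∀ α ∈ S, Runs M N α l) : S.ncard * l ≤ (covered M).ncard := by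
  classical
  have : (S ×ˢ (Set.Iio l)).ncard ≤ (covered M).ncard := by
    refine Set.ncard_le_ncard_of_injOn (fun x => traj M N x.1 (x.2 + 1)) ?_ ?_ (Set.toFinite _)
    · rintro ⟨α, i⟩ ⟨hα, hi⟩
      exact ((h α hα).mono (j := i + 1) hi).not_free
    · rintro ⟨α, i⟩ ⟨hα, hi⟩ ⟨β, j⟩ ⟨hβ, hj⟩ hab
      have := traj_inj hM hN ((h α hα).mono (j := i + 1) hi) ((h β hβ).mono (j := j + 1) hj) hab
      simp only [Nat.add_right_cancel_iff] at this
      rw [this.1, this.2]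
  rwa [Set.ncard_prod, Set.ncard_eq_toFinset_card' (Set.Iio l), Set.toFinset_Iio,
    Nat.card_Iio] at this

/-- If every trajectory is long, stops at a vertex that `N` does not cover, or meets `A` at an even
vertex or `R` at any vertex, then `N` is not much larger than `M`. -/
theorem covered_ncard_le (hM : IsMatchingSet G M) (hN : IsMatchingSet G N) {A R : Set V} {l : ℕ}
    (h : ∀ α, Free M α → ¬ Free N α → Runs M N α l ∨
      ∃ i, Runs M N α i ∧ ((Free N (traj M N α i) ∧ 0 < i) ∨ traj M N α i ∈ A ∨
        traj M N α i ∈ R ∨ mate N (traj M N α i) ∈ R)) :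
    ∃ x, x * l ≤ (covered M).ncard ∧
      (covered N).ncard ≤ (covered M).ncard + x + A.ncard + 2 * R.ncard := by
  classical
  -- The walks are sorted by what stops them. `S₁` cancels against the vertices covered by `M` alone
  -- when the two covered sets are compared. `S₃` and `S₄` separate hits of `R` at even and odd
  -- positions, whence the factor two.
  let S := covered N \ covered M
  let S₀ := {α ∈ S | Runs M N α l}
  let S₁ := {α ∈ S | ∃ i, Runs M N α i ∧ traj M N α i ∈ covered M \ covered N}
  let S₂ := {α ∈ S | ∃ i, Runs M N α i ∧ traj M N α i ∈ A}
  let S₃ := {α ∈ S | ∃ i, Runs M N α i ∧ traj M N α i ∈ R}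
  let S₄ := {α ∈ S | ∃ i, Runs M N α i ∧ traj M N α i ∈ mate N ⁻¹' R}
  have h0 : S₀.ncard * l ≤ (covered M).ncard := ncard_mul_le_of_runs hM hN fun α hα => hα.2
  have h1 : S₁.ncard ≤ (covered M \ covered N).ncard := ncard_le_of_traj hM hN fun α hα => hα.2
  have h2 : S₂.ncard ≤ A.ncard := ncard_le_of_traj hM hN fun α hα => hα.2
  have h3 : S₃.ncard ≤ R.ncard := ncard_le_of_traj hM hN fun α hα => hα.2
  have h4 : S₄.ncard ≤ R.ncard := by
    refine (ncard_le_of_traj hM hN fun α hα => hα.2).trans ?_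
    exact Set.ncard_le_ncard_of_injOn (mate N) (fun v hv => hv)
      (fun v _ w _ hvw => hN.mate_inj hvw) (Set.toFinite _)
  have hS : S ⊆ S₀ ∪ S₁ ∪ S₂ ∪ S₃ ∪ S₄ := by
    intro α hα
    have hf : Free M α := by simpa [covered] using hα.2
    rcases h α hf hα.1 with h | ⟨i, hi, h | h | h | h⟩
    · exact Or.inl (Or.inl (Or.inl (Or.inl ⟨hα, h⟩)))
    · refine Or.inl (Or.inl (Or.inl (Or.inr ⟨hα, i, hi, ?_, fun hh => hh h.1⟩)))
      -- Positivity of `i` is what makes the last vertex covered by `M`.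
      obtain ⟨i, rfl⟩ : ∃ k, i = k + 1 := ⟨i - 1, by omega⟩
      exact hi.not_free
    · exact Or.inl (Or.inl (Or.inr ⟨hα, i, hi, h⟩))
    · exact Or.inl (Or.inr ⟨hα, i, hi, h⟩)
    · exact Or.inr ⟨hα, i, hi, h⟩
  have h5 : S.ncard ≤ S₀.ncard + S₁.ncard + S₂.ncard + S₃.ncard + S₄.ncard := by
    refine (Set.ncard_le_ncard hS (Set.toFinite _)).trans ?_
    refine (Set.ncard_union_le _ _).trans (Nat.add_le_add_right ?_ _)
    refine (Set.ncard_union_le _ _).trans (Nat.add_le_add_right ?_ _)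
    refine (Set.ncard_union_le _ _).trans (Nat.add_le_add_right ?_ _)
    exact Set.ncard_union_le _ _
  have h6 := Set.ncard_sdiff_add_ncard (covered N) (covered M) (Set.toFinite _) (Set.toFinite _)
  have h7 := Set.ncard_sdiff_add_ncard (covered M) (covered N) (Set.toFinite _) (Set.toFinite _)
  rw [Set.union_comm] at h7
  exact ⟨S₀.ncard, h0, by change S.ncard + _ = _ at h6; omega⟩

/-- If every edge has an endpoint in `covered M`, then `M` has at least half the size of any
matching. -/
theorem covered_ncard_le_of_maximal (hN : IsMatchingSet G N)
    (hmax : ∀ u v, G.Adj u v → ¬ (Free M u ∧ Free M v)) :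
    (covered N).ncard ≤ 2 * (covered M).ncard := by
  have h : covered N ⊆ covered M ∪ mate N ⁻¹' covered M := by
    intro v hv
    have := hmax v (mate N v) (hN.adj (mate_mem hv))
    simp only [covered, Set.mem_union, Set.mem_ofPred_eq, Set.mem_preimage]
    tauto
  have h1 : (mate N ⁻¹' covered M).ncard ≤ (covered M).ncard :=
    Set.ncard_le_ncard_of_injOn (mate N) (fun v hv => hv)
      (fun v _ w _ hvw => hN.mate_inj hvw) (Set.toFinite _)
  have h2 := (Set.ncard_le_ncard h (Set.toFinite _)).trans (Set.ncard_union_le _ _)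
  omega

end Trajectories

/-! ### Matchings as subgraphs -/

theorem isMatchingSet_edgeSet {G : SimpleGraph V} {N : G.Subgraph} (hN : N.IsMatching) :
    IsMatchingSet G N.edgeSet where
  subset := N.edgeSet_subset
  unique := by
    intro u v w h1 h2
    rw [SimpleGraph.Subgraph.mem_edgeSet] at h1 h2
    exact hN.eq_of_adj_left h1 h2

/-- The subgraph formed by the edges of a matching. -/
def IsMatchingSet.toSubgraph {G : SimpleGraph V} {M : Set (Sym2 V)} (hM : IsMatchingSet G M) :
    G.Subgraph where
  verts := covered M
  Adj u v := s(u, v) ∈ M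
  adj_sub h := hM.subset h
  edge_vert h := not_free_left h
  symm := ⟨fun _ _ h => Sym2.eq_swap ▸ h⟩

theorem IsMatchingSet.isMatching {G : SimpleGraph V} {M : Set (Sym2 V)}
    (hM : IsMatchingSet G M) : hM.toSubgraph.IsMatching := fun v hv =>
  ⟨mate M v, mate_mem hv, fun _ hw => (hM.mate_eq hw).symm⟩

theorem IsMatchingSet.edgeSet_toSubgraph {G : SimpleGraph V} {M : Set (Sym2 V)}
    (hM : IsMatchingSet G M) : hM.toSubgraph.edgeSet = M := by
  ext e
  induction e with
  | _ u v => rw [SimpleGraph.Subgraph.mem_edgeSet]; rfl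

theorem IsMatchingSet.ncard_covered [Finite V] {G : SimpleGraph V} (n : ℕ) :
    ∀ {M : Set (Sym2 V)}, IsMatchingSet G M → M.ncard = n → (covered M).ncard = 2 * n := by
  induction n with
  | zero =>
    intro M _ h
    rw [Set.ncard_eq_zero (Set.toFinite _)] at h
    subst h
    simp [covered, Free]
  | succ n ih =>
    intro M hM h
    obtain ⟨e, he⟩ : M.Nonempty := by
      rw [← Set.ncard_pos (Set.toFinite _)]; omega
    induction e with
    | _ a b =>
      have hM' := hM.mono (N := M \ {s(a, b)}) Set.sdiff_subset
      have hc : (M \ {s(a, b)}).ncard = n := by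
        rw [Set.ncard_sdiff_singleton_of_mem he]; omega
      have ha : Free (M \ {s(a, b)}) a := by
        rw [free_iff]
        intro w hw
        exact hw.2 (by rw [hM.unique a w b hw.1 he]; rfl)
      have hb : Free (M \ {s(a, b)}) b := by
        rw [free_iff]
        intro w hw
        refine hw.2 ?_
        rw [hM.unique b w a hw.1 (Sym2.eq_swap ▸ he), Sym2.eq_swap]; rfl
      have hcov : covered M = insert a (insert b (covered (M \ {s(a, b)}))) := by
        have hMe : M = insert s(a, b) (M \ {s(a, b)}) := by simp [Set.insert_eq_of_mem he]
        ext v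
        conv_lhs => rw [hMe]
        simp only [covered, Set.mem_ofPred_eq, free_insert, Set.mem_insert_iff]
        tauto
      rw [hcov, Set.ncard_insert_of_notMem, Set.ncard_insert_of_notMem, ih hM' hc]
      · ring
      · exact fun h => h hb
      · rintro (h | h)
        · exact (hM.adj he).ne h
        · exact h ha

/-! ### The greedy matching -/

/-- Induction from the end of the list matches the left fold. Free vertices only become fewer, so an
arc once blocked stays blocked. -/
theorem greedy_spec {G : SimpleGraph V} (l : List (V × V)) (hl : ∀ a ∈ l, G.Adj a.1 a.2) :
    IsMatchingSet G (greedy l) ∧ ∀ a ∈ l, ¬ (Free (greedy l) a.1 ∧ Free (greedy l) a.2) := by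
  classical
  induction l using List.reverseRecOn with
  | nil => exact ⟨⟨by simp [greedy], by simp [greedy]⟩, by simp⟩
  | append_singleton l a ih =>
    obtain ⟨h1, h2⟩ := ih fun a ha => hl a (by simp [ha])
    have hstep : greedy (l ++ [a]) = if Free (greedy l) a.1 ∧ Free (greedy l) a.2 then
        insert s(a.1, a.2) (greedy l) else greedy l := by
      simp only [greedy, List.foldl_append, List.foldl_cons, List.foldl_nil]
      congr
    rw [hstep]
    split_ifs with hf
    · refine ⟨h1.insert_edge (hl a (by simp)) hf.1 hf.2, ?_⟩
      intro b hb hfb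
      rw [free_insert, free_insert] at hfb
      rcases List.mem_append.1 hb with hb | hb
      · exact h2 b hb ⟨hfb.1.2.2, hfb.2.2.2⟩
      · rw [List.mem_singleton] at hb
        subst hb
        exact hfb.1.1 rfl
    · refine ⟨h1, ?_⟩
      intro b hb
      rcases List.mem_append.1 hb with hb | hb
      · exact h2 b hb
      · rw [List.mem_singleton] at hb
        subst hb
        exact hf

end ScaledMatching

namespace ScaledMatching

variable {V : Type*}

/-! ### The forest of contracted structures -/

/-- A description of a state by vertices: `base v` is the base of the root blossom of `v`, `par v`
is the tail of the unmatched tree arc that enters an inner vertex `v`, `out` and `inn` are the sets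
of outer and inner vertices, and the working vertex of a structure is given by its base. -/
structure AState (V : Type*) where
  base : V → V
  par : V → V
  out : Set V
  inn : Set V
  own : V → Set V
  wk : V → Option V
  lab : V × V → ℕ
  removed : Set V
  onHold : Set V
  modified : Set V

namespace AState

variable (M : Set (Sym2 V)) (a : AState V)

/-- `p` is the parent of `c` in the forest whose nodes are the bases. -/
def Child (p c : V) : Prop :=
  a.base c = c ∧ ((c ∈ a.out ∧ ¬ Free M c ∧ p = mate M c) ∨ (c ∈ a.inn ∧ p = a.base (a.par c)))

/-- `p` is an ancestor of `c`. -/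
def Anc : V → V → Prop := Relation.ReflTransGen (a.Child M)

open Classical in
/-- The label that determines the distance of a node. -/
noncomputable def D (y : V) : ℕ :=
  if y ∈ a.out then (if Free M y then 0 else a.lab (mate M y, y)) else a.lab (y, mate M y)

open Classical in
/-- A rank that increases from parent to child. -/
noncomputable def rank (y : V) : ℕ := 2 * a.D M y + if y ∈ a.out then 1 else 0

/-- The invariants of a phase that do not depend on the order of operations. -/
structure Valid (G : SimpleGraph V) (l : ℕ) : Prop where
  base_base : ∀ v, a.base (a.base v) = a.base v
  base_out : ∀ {v}, v ∈ a.out → a.base v ∈ a.out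
  base_not : ∀ {v}, v ∉ a.out → a.base v = v
  inn_not : ∀ {v}, v ∈ a.inn → v ∉ a.out
  inn_cov : ∀ {v}, v ∈ a.inn → ¬ Free M v
  inn_mate : ∀ {v}, v ∈ a.inn → mate M v ∈ a.out
  inn_mate_base : ∀ {v}, v ∈ a.inn → a.base (mate M v) = mate M v
  out_free : ∀ {v}, v ∈ a.out → Free M v → a.base v = v
  -- In a blossom every vertex except the base is matched within the blossom.
  out_mate : ∀ {v}, v ∈ a.out → ¬ Free M v → a.base v ≠ v → a.base (mate M v) = a.base v
  base_mate : ∀ {v}, v ∈ a.out → ¬ Free M v → a.base v = v → mate M v ∈ a.inn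
  par_out : ∀ {v}, v ∈ a.inn → a.par v ∈ a.out
  par_adj : ∀ {v}, v ∈ a.inn → G.Adj (a.par v) v
  -- The strict growth of distances along unmatched tree arcs replaces any explicit requirement that
  -- the parent relation be acyclic.
  par_lt : ∀ {v}, v ∈ a.inn → a.D M (a.base (a.par v)) < a.lab (v, mate M v)
  lab_le : ∀ {v}, v ∈ a.inn → a.lab (v, mate M v) ≤ l
  -- A label below the initial value thus certifies that the head of the arc is outer, or that its
  -- tail was removed.
  lab_top : ∀ {v}, ¬ Free M v → v ∉ a.removed → mate M v ∉ a.out → a.lab (v, mate M v) = l + 1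
  own_disj : ∀ {x α β}, x ∈ a.own α → x ∈ a.own β → α = β
  own_mem : ∀ {x α}, x ∈ a.own α → x ∈ a.out ∨ x ∈ a.inn
  mem_own : ∀ {x}, x ∈ a.out ∨ x ∈ a.inn → ∃ α, x ∈ a.own α
  own_base : ∀ {x α}, x ∈ a.own α → a.base x ∈ a.own α
  own_mate : ∀ {x α}, x ∈ a.own α → ¬ Free M x → mate M x ∈ a.own α
  own_par : ∀ {x α}, x ∈ a.inn → x ∈ a.own α → a.par x ∈ a.own α
  own_free : ∀ {x α}, x ∈ a.own α → Free M x → x = α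
  own_root : ∀ {x α}, x ∈ a.own α → α ∈ a.own α ∧ Free M α
  free_own : ∀ {x}, Free M x → x ∉ a.removed → x ∈ a.own x
  removed_own : ∀ {x α}, x ∈ a.removed → x ∉ a.own α
  removed_mate : ∀ {x}, x ∈ a.removed → mate M x ∈ a.removed
  wk_own : ∀ {α w}, a.wk α = some w → w ∈ a.own α
  wk_out : ∀ {α w}, a.wk α = some w → w ∈ a.out
  wk_base : ∀ {α w}, a.wk α = some w → a.base w = w

variable {M a} {G : SimpleGraph V} {l : ℕ}

theorem D_inn (h : a.Valid M G l) {y : V} (hy : y ∈ a.inn) : a.D M y = a.lab (y, mate M y) := by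
  rw [D, if_neg (h.inn_not hy)]

theorem D_free {y : V} (hy : y ∈ a.out) (hf : Free M y) : a.D M y = 0 := by
  rw [D, if_pos hy, if_pos hf]

theorem D_out {y : V} (hy : y ∈ a.out) (hf : ¬ Free M y) : a.D M y = a.lab (mate M y, y) := by
  rw [D, if_pos hy, if_neg hf]

theorem base_idem_mem (h : a.Valid M G l) {x : V} (hx : a.base x ∈ a.out ∨ a.base x ∈ a.inn) :
    x ∈ a.out ∨ x ∈ a.inn := by
  by_cases hxo : x ∈ a.out
  · exact Or.inl hxo
  · rw [h.base_not hxo] at hx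
    exact hx

theorem base_mem_out (h : a.Valid M G l) {x : V} (hx : a.base x ∈ a.out) : x ∈ a.out := by
  by_contra hxo
  rw [h.base_not hxo] at hx
  exact hxo hx

theorem own_of_base (h : a.Valid M G l) {x α : V} (hx : a.base x ∈ a.own α) : x ∈ a.own α := by
  obtain ⟨β, hβ⟩ := h.mem_own (base_idem_mem h (h.own_mem hx))
  rwa [h.own_disj hx (h.own_base hβ)]

theorem own_of_mate (hM : IsMatchingSet G M) (h : a.Valid M G l) {x α : V}
    (hx : mate M x ∈ a.own α) : x ∈ a.own α := by
  by_cases hf : Free M x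
  · rwa [mate_of_free hf] at hx
  · have := h.own_mate hx (by rwa [free_mate_iff])
    rwa [hM.mate_mate] at this

/-- The partner of an outer base that is not free is inner, and conversely. -/
theorem mate_out_iff (hM : IsMatchingSet G M) (h : a.Valid M G l) {v : V} (hv : v ∉ a.out)
    (hf : ¬ Free M v) : mate M v ∈ a.out ↔ v ∈ a.inn := by
  refine ⟨fun ht => ?_, h.inn_mate⟩
  have hft : ¬ Free M (mate M v) := by rwa [free_mate_iff]
  have hb : a.base (mate M v) = mate M v := by
    by_contra hne
    have := h.out_mate ht hft hne
    rw [hM.mate_mate, h.base_not hv] at this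
    exact hv (this ▸ h.base_out ht)
  have := h.base_mate ht hft hb
  rwa [hM.mate_mate] at this

theorem base_mate_of_not_out (hM : IsMatchingSet G M) (h : a.Valid M G l) {v : V}
    (hv : v ∉ a.out) (hf : ¬ Free M v) : a.base (mate M v) = mate M v := by
  by_cases ht : mate M v ∈ a.out
  · exact h.inn_mate_base ((mate_out_iff hM h hv hf).1 ht)
  · exact h.base_not ht

theorem mate_not_inn (hM : IsMatchingSet G M) (h : a.Valid M G l) {v : V} (hv : v ∉ a.out) :
    mate M v ∉ a.inn := by
  intro ht
  have := h.inn_mate ht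
  rw [hM.mate_mate] at this
  exact hv this

theorem mate_out_of_out (h : a.Valid M G l) {v : V} (hv : v ∈ a.out)
    (hm : mate M v ∉ a.out) : a.base v = v ∧ mate M v ∈ a.inn := by
  have hf : ¬ Free M v := fun hf => hm (by rwa [mate_of_free hf])
  have hb : a.base v = v := by
    by_contra hne
    have := h.out_mate hv hf hne
    rw [h.base_not hm] at this
    exact hm (this ▸ h.base_out hv)
  exact ⟨hb, h.base_mate hv hf hb⟩

section Child

theorem Child.cases (h : a.Valid M G l) {p c : V} (hc : a.Child M p c) :
    (c ∈ a.out ∧ ¬ Free M c ∧ p = mate M c ∧ p ∈ a.inn) ∨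
      (c ∈ a.inn ∧ p = a.base (a.par c) ∧ p ∈ a.out) := by
  rcases hc with ⟨hb, ⟨h1, h2, rfl⟩ | ⟨h1, rfl⟩⟩
  · exact Or.inl ⟨h1, h2, rfl, h.base_mate h1 h2 hb⟩
  · exact Or.inr ⟨h1, rfl, h.base_out (h.par_out h1)⟩

theorem Child.right_mem {p c : V} (hc : a.Child M p c) : c ∈ a.out ∨ c ∈ a.inn := by
  rcases hc with ⟨-, ⟨h1, -, -⟩ | ⟨h1, -⟩⟩
  · exact Or.inl h1
  · exact Or.inr h1

theorem Child.left_mem (h : a.Valid M G l) {p c : V} (hc : a.Child M p c) :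
    p ∈ a.out ∨ p ∈ a.inn := by
  rcases hc.cases h with ⟨-, -, -, h1⟩ | ⟨-, -, h1⟩
  · exact Or.inr h1
  · exact Or.inl h1

theorem Child.not_free (h : a.Valid M G l) {p c : V} (hc : a.Child M p c) : ¬ Free M c := by
  rcases hc.cases h with ⟨-, h1, -⟩ | ⟨h1, -⟩
  · exact h1
  · exact h.inn_cov h1

theorem Child.base_left (h : a.Valid M G l) {p c : V} (hc : a.Child M p c) : a.base p = p := by
  rcases hc.cases h with ⟨h1, h2, rfl, h3⟩ | ⟨h1, rfl, h3⟩
  · exact h.base_not (h.inn_not h3)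
  · exact h.base_base _

theorem Child.unique (h : a.Valid M G l) {p q c : V} (hp : a.Child M p c) (hq : a.Child M q c) :
    p = q := by
  rcases hp.cases h with ⟨h1, -, rfl, -⟩ | ⟨h1, rfl, -⟩ <;>
    rcases hq.cases h with ⟨h2, -, rfl, -⟩ | ⟨h2, rfl, -⟩
  · rfl
  · exact absurd h1 (h.inn_not h2)
  · exact absurd h2 (h.inn_not h1)
  · rfl

/-- An inner vertex has its partner as its only child. -/
theorem Child.of_inn (hM : IsMatchingSet G M) (h : a.Valid M G l) {p c : V}
    (hc : a.Child M p c) (hp : p ∈ a.inn) : c = mate M p := by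
  rcases hc.cases h with ⟨-, -, rfl, -⟩ | ⟨-, rfl, h3⟩
  · rw [hM.mate_mate]
  · exact absurd h3 (h.inn_not hp)

theorem child_mate (hM : IsMatchingSet G M) (h : a.Valid M G l) {v : V} (hv : v ∈ a.inn) :
    a.Child M v (mate M v) :=
  ⟨h.inn_mate_base hv, Or.inl ⟨h.inn_mate hv, by
    rw [free_mate_iff]; exact h.inn_cov hv, (hM.mate_mate v).symm⟩⟩

theorem child_par (h : a.Valid M G l) {v : V} (hv : v ∈ a.inn) :
    a.Child M (a.base (a.par v)) v :=
  ⟨h.base_not (h.inn_not hv), Or.inr ⟨hv, rfl⟩⟩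

theorem Child.own (hM : IsMatchingSet G M) (h : a.Valid M G l) {p c γ : V}
    (hc : a.Child M p c) : p ∈ a.own γ ↔ c ∈ a.own γ := by
  rcases hc.cases h with ⟨-, h1, rfl, -⟩ | ⟨h1, rfl, -⟩
  · exact ⟨own_of_mate hM h, fun h' => h.own_mate h' h1⟩
  · refine ⟨fun h' => ?_, fun h' => h.own_base (h.own_par h1 h')⟩
    obtain ⟨β, hβ⟩ := h.mem_own (Or.inr h1)
    rwa [h.own_disj h' (h.own_base (h.own_par h1 hβ))]

theorem Child.D_le (hM : IsMatchingSet G M) (h : a.Valid M G l) {p c : V}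
    (hc : a.Child M p c) : a.D M p ≤ a.D M c := by
  rcases hc.cases h with ⟨h1, h2, rfl, h3⟩ | ⟨h1, rfl, -⟩
  · rw [D_inn h h3, D_out h1 h2, hM.mate_mate]
  · rw [D_inn h h1]
    exact (h.par_lt h1).le

/-- An unmatched tree arc raises the distance by at least one, which outweighs the unit lost from
outer to inner. A matched tree arc keeps the distance, and the unit for outer nodes breaks the tie.
-/
theorem Child.rank_lt (hM : IsMatchingSet G M) (h : a.Valid M G l) {p c : V}
    (hc : a.Child M p c) : a.rank M p < a.rank M c := by
  have hD := hc.D_le hM h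
  rcases hc.cases h with ⟨h1, h2, rfl, h3⟩ | ⟨h1, rfl, h3⟩
  · rw [rank, rank, if_neg (h.inn_not h3), if_pos h1]
    omega
  · have := h.par_lt h1
    rw [← D_inn h h1] at this
    rw [rank, rank, if_pos h3, if_neg (h.inn_not h1)]
    omega

end Child

section Anc

theorem Anc.rank_lt (hM : IsMatchingSet G M) (h : a.Valid M G l) {b c : V}
    (hbc : a.Anc M b c) : b = c ∨ a.rank M b < a.rank M c := by
  induction hbc with
  | refl => exact Or.inl rfl
  | tail _ hc ih =>
    have := hc.rank_lt hM h
    rcases ih with rfl | ih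
    · exact Or.inr this
    · exact Or.inr (ih.trans this)

theorem Anc.antisymm (hM : IsMatchingSet G M) (h : a.Valid M G l) {b c : V}
    (hbc : a.Anc M b c) (hcb : a.Anc M c b) : b = c := by
  rcases hbc.rank_lt hM h with rfl | h1
  · rfl
  · rcases hcb.rank_lt hM h with rfl | h2
    · rfl
    · omega

theorem Anc.D_le (hM : IsMatchingSet G M) (h : a.Valid M G l) {b c : V}
    (hbc : a.Anc M b c) : a.D M b ≤ a.D M c := by
  induction hbc with
  | refl => exact le_rfl
  | tail _ hc ih => exact ih.trans (hc.D_le hM h)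

theorem Anc.own (hM : IsMatchingSet G M) (h : a.Valid M G l) {b c γ : V}
    (hbc : a.Anc M b c) : b ∈ a.own γ ↔ c ∈ a.own γ := by
  induction hbc with
  | refl => exact Iff.rfl
  | tail _ hc ih => exact ih.trans (hc.own hM h)

theorem Anc.base_left (h : a.Valid M G l) {b c : V} (hbc : a.Anc M b c) (hc : a.base c = c) :
    a.base b = b := by
  rcases Relation.ReflTransGen.cases_head hbc with rfl | ⟨d, hd, -⟩
  · exact hc
  · exact hd.base_left h

theorem Anc.tail_cases {b c : V} (hbc : a.Anc M b c) :
    b = c ∨ ∃ p, a.Anc M b p ∧ a.Child M p c := by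
  rcases Relation.ReflTransGen.cases_tail hbc with h | ⟨d, h1, h2⟩
  · exact Or.inl h.symm
  · exact Or.inr ⟨d, h1, h2⟩

theorem Anc.of_child (h : a.Valid M G l) {b p c : V} (hbc : a.Anc M b c) (hne : b ≠ c)
    (hp : a.Child M p c) : a.Anc M b p := by
  rcases hbc.tail_cases with rfl | ⟨q, h1, h2⟩
  · exact absurd rfl hne
  · rwa [hp.unique h h2]

/-- Parents are unique, so the ancestors of a node form a chain. -/
theorem Anc.total (h : a.Valid M G l) {b c d : V} (hb : a.Anc M b d) (hc : a.Anc M c d) :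
    a.Anc M b c ∨ a.Anc M c b := by
  induction hb with
  | refl => exact Or.inr hc
  | @tail e f _ hef ih =>
    rcases hc.tail_cases with rfl | ⟨q, h1, h2⟩
    · exact Or.inl (Relation.ReflTransGen.tail ‹_› hef)
    · rw [h2.unique h hef] at h1
      exact ih h1

/-- Below an inner vertex lies the subtree of its partner. -/
theorem Anc.mate_left (hM : IsMatchingSet G M) (h : a.Valid M G l) {b c : V}
    (hb : b ∈ a.inn) (hbc : a.Anc M b c) (hne : b ≠ c) : a.Anc M (mate M b) c := by
  rcases Relation.ReflTransGen.cases_head hbc with rfl | ⟨d, hd, h'⟩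
  · exact absurd rfl hne
  · rwa [hd.of_inn hM h hb] at h'

/-- Every node that is not free has a parent of smaller rank in the same structure. The ascent ends
at a free vertex, and `α` is the only free vertex that `α` owns. -/
theorem anc_root (hM : IsMatchingSet G M) (h : a.Valid M G l) (n : ℕ) : ∀ {x α : V},
    a.rank M x ≤ n → x ∈ a.own α → a.base x = x → a.Anc M α x := by
  induction n using Nat.strong_induction_on with
  | _ n ih =>
    intro x α hn hx hb
    by_cases hf : Free M x
    · rw [h.own_free hx hf]
      exact Relation.ReflTransGen.refl
    · obtain ⟨p, hp⟩ : ∃ p, a.Child M p x := by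
        rcases h.own_mem hx with ho | hi
        · exact ⟨_, hb, Or.inl ⟨ho, hf, rfl⟩⟩
        · exact ⟨_, child_par h hi⟩
      have h1 := hp.rank_lt hM h
      exact Relation.ReflTransGen.tail
        (ih (a.rank M p) (by omega) le_rfl ((hp.own hM h).2 hx) (hp.base_left h)) hp

theorem root_anc (hM : IsMatchingSet G M) (h : a.Valid M G l) {x α : V} (hx : x ∈ a.own α) :
    a.Anc M α (a.base x) :=
  anc_root hM h _ le_rfl (h.own_base hx) (h.base_base x)

end Anc

end AState

end ScaledMatching

namespace ScaledMatching

variable {V : Type*}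

namespace AState

variable {M : Set (Sym2 V)} {a : AState V} {G : SimpleGraph V} {l : ℕ}

/-! ### Overtaking -/

variable (M a) in
/-- The nodes of the subtree of the arc `(v, t)`. -/
def Below (v t c : V) : Prop := c = v ∨ c = t ∨ a.Anc M v c

variable (M a) in
open Classical in
/-- The effect of `Overtake` on the description of a state, for given new working vertices. -/
noncomputable def overtake (α u v t : V) (k : ℕ) (wk' : V → Option V) : AState V where
  base := a.base
  par := fun x => if x = v then u else a.par x
  out := a.out ∪ {t}
  inn := a.inn ∪ {v}
  own := fun γ => if γ = α then a.own α ∪ {x | a.Below M v t (a.base x)}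
    else a.own γ \ {x | a.Below M v t (a.base x)}
  wk := wk'
  lab := fun b => if b = (v, t) then k else a.lab b
  removed := a.removed
  onHold := a.onHold
  modified := a.modified ∪ {α} ∪ {γ | v ∈ a.own γ}

variable (M a) in
/-- The new working vertices after `Overtake`. -/
def OvertakeWork (α v t : V) (wk' : V → Option V) : Prop :=
  (wk' α = some t ∧ ∀ γ ≠ α, wk' γ = a.wk γ ∧ ∀ w, a.wk γ = some w → ¬ a.Anc M t w) ∨
  ∃ β w, β ≠ α ∧ a.wk β = some w ∧ a.Anc M t w ∧ v ∈ a.inn ∧ wk' α = some w ∧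
    wk' β = some (a.base (a.par v)) ∧ ∀ γ ≠ α, γ ≠ β → wk' γ = a.wk γ

variable (M a G) in
/-- The situation in which `Overtake` is performed. -/
structure OvertakeAt (α u v t : V) : Prop where
  u_own : u ∈ a.own α
  u_out : u ∈ a.out
  wk : a.wk α = some (a.base u)
  v_out : v ∉ a.out
  v_cov : ¬ Free M v
  mate : mate M v = t
  v_rem : v ∉ a.removed
  adj : G.Adj u v
  lt : a.D M (a.base u) + 1 < a.lab (v, t)

section Overtake

variable {α u v t : V} {k : ℕ} {wk' : V → Option V}

section Basic

variable (hM : IsMatchingSet G M) (h : a.Valid M G l) (c : a.OvertakeAt M G α u v t)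
include hM h c

theorem OvertakeAt.t_out_iff : t ∈ a.out ↔ v ∈ a.inn := by
  rw [← c.mate, mate_out_iff hM h c.v_out c.v_cov]

theorem OvertakeAt.base_t : a.base t = t := by
  rw [← c.mate, base_mate_of_not_out hM h c.v_out c.v_cov]

theorem OvertakeAt.t_inn : t ∉ a.inn := by
  rw [← c.mate]; exact mate_not_inn hM h c.v_out

theorem OvertakeAt.v_ne_t : v ≠ t := by
  rw [← c.mate]; exact (hM.mate_ne c.v_cov).symm

omit hM in
theorem OvertakeAt.base_v : a.base v = v := h.base_not c.v_out

omit h in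
theorem OvertakeAt.mate_t : ScaledMatching.mate M t = v := by rw [← c.mate, hM.mate_mate]

omit h in
theorem OvertakeAt.t_cov : ¬ Free M t := by rw [← c.mate, free_mate_iff]; exact c.v_cov

omit h in
theorem OvertakeAt.t_rem (h : a.Valid M G l) : t ∉ a.removed := by
  intro ht
  have := h.removed_mate ht
  rw [c.mate_t hM] at this
  exact c.v_rem this

theorem OvertakeAt.base_eq_v {x : V} (hx : a.base x = v) : x = v := by
  have : x ∉ a.out := fun ho => c.v_out (hx ▸ h.base_out ho)
  rw [← hx, h.base_not this]

theorem OvertakeAt.base_u_ne_t : a.base u ≠ t := by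
  intro hu
  have h1 := c.lt
  have h2 : t ∈ a.out := hu ▸ h.base_out c.u_out
  rw [hu, D_out h2 (c.t_cov hM), c.mate_t hM] at h1
  omega

theorem OvertakeAt.lab_of_not_inn (hv : v ∉ a.inn) : a.lab (v, t) = l + 1 := by
  have h1 : ScaledMatching.mate M v ∉ a.out := by
    rw [mate_out_iff hM h c.v_out c.v_cov]; exact hv
  have := h.lab_top c.v_cov c.v_rem h1
  rwa [c.mate] at this

theorem OvertakeAt.lab_le : a.lab (v, t) ≤ l + 1 := by
  by_cases hv : v ∈ a.inn
  · have := h.lab_le hv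
    rw [c.mate] at this
    omega
  · exact (c.lab_of_not_inn hM h hv).le

/-- Distances do not decrease downwards, but the distance of `v` exceeds that of `u` by more than
one. Hence hanging `v` below `u` closes no cycle. -/
theorem OvertakeAt.not_anc_u : ¬ a.Anc M v (a.base u) := by
  intro hv
  have h1 := hv.D_le hM h
  have h2 := c.lt
  rw [D, if_neg c.v_out, c.mate] at h1
  omega

theorem OvertakeAt.not_anc_par (hv : v ∈ a.inn) : ¬ a.Anc M v (a.base (a.par v)) := by
  intro hv'
  have h1 := hv'.rank_lt hM h
  have h2 := (child_par h hv).rank_lt hM h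
  rcases h1 with h1 | h1
  · rw [← h1] at h2; omega
  · omega

theorem OvertakeAt.anc_t {x : V} (hx : a.Anc M v x) (hne : x ≠ v) : a.Anc M t x := by
  rcases Relation.ReflTransGen.cases_head hx with rfl | ⟨d, hd, h'⟩
  · exact absurd rfl hne
  · rcases hd.left_mem h with h1 | h1
    · exact absurd h1 c.v_out
    · rw [← c.mate, ← hd.of_inn hM h h1]
      exact h'

/-- A node below `(v, t)` other than `v` and `t` has its parent below `(v, t)`. -/
theorem OvertakeAt.below_child {p x : V} (hp : a.Child M p x) (hx : a.Below M v t p) :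
    a.Below M v t x := by
  rcases hx with rfl | rfl | hx
  · exact Or.inr (Or.inr (Relation.ReflTransGen.single hp))
  · have hv : v ∈ a.inn := by
      rcases hp.left_mem h with h1 | h1
      · exact (c.t_out_iff hM h).1 h1
      · exact absurd h1 (c.t_inn hM h)
    have h1 := child_mate hM h hv
    rw [c.mate] at h1
    exact Or.inr (Or.inr ((Relation.ReflTransGen.single h1).tail hp))
  · exact Or.inr (Or.inr (hx.tail hp))

theorem OvertakeAt.below_parent {p x : V} (hp : a.Child M p x) (hx : a.Below M v t x)
    (hne : x ≠ v) : a.Below M v t p := by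
  rcases hx with rfl | rfl | hx
  · exact absurd rfl hne
  · rcases hp.cases h with ⟨-, -, rfl, -⟩ | ⟨h1, -, -⟩
    · exact Or.inl (c.mate_t hM)
    · exact absurd h1 (c.t_inn hM h)
  · exact Or.inr (Or.inr (hx.of_child h hne.symm hp))

theorem OvertakeAt.below_mem {x : V} (hx : a.Below M v t (a.base x)) :
    x = v ∨ x = t ∨ x ∈ a.out ∨ x ∈ a.inn := by
  rcases hx with hx | hx | hx
  · exact Or.inl (c.base_eq_v hM h hx)
  · by_cases ho : x ∈ a.out
    · exact Or.inr (Or.inr (Or.inl ho))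
    · rw [h.base_not ho] at hx
      exact Or.inr (Or.inl hx)
  · rcases hx.tail_cases with hx | ⟨p, -, hp⟩
    · exact Or.inl (c.base_eq_v hM h hx.symm)
    · exact Or.inr (Or.inr (base_idem_mem h hp.right_mem))

theorem OvertakeAt.below_not_free {x : V} (hx : a.Below M v t (a.base x)) : ¬ Free M x := by
  intro hf
  have hb : a.base x = x := by
    by_cases ho : x ∈ a.out
    · exact h.out_free ho hf
    · exact h.base_not ho
  rw [hb] at hx
  rcases hx with rfl | rfl | hx
  · exact c.v_cov hf
  · exact c.t_cov hM hf
  · rcases hx.tail_cases with rfl | ⟨p, -, hp⟩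
    · exact c.v_cov hf
    · exact hp.not_free h hf

/-- The moved part is a union of matched edges: partners share a blossom, or are an inner node and
its only child. -/
theorem OvertakeAt.below_mate {x : V} (hx : a.Below M v t (a.base x)) :
    a.Below M v t (a.base (ScaledMatching.mate M x)) := by
  have hf := c.below_not_free hM h hx
  rcases eq_or_ne x v with rfl | hv
  · rw [c.mate, c.base_t hM h]; exact Or.inr (Or.inl rfl)
  rcases eq_or_ne x t with rfl | ht
  · rw [c.mate_t hM, c.base_v h]; exact Or.inl rfl
  by_cases ho : x ∈ a.out
  · by_cases hb : a.base x = x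
    · have hi := h.base_mate ho hf hb
      have hc := child_mate hM h hi
      rw [hM.mate_mate] at hc
      rw [hc.base_left h]
      rw [hb] at hx
      exact c.below_parent hM h hc hx hv
    · rwa [h.out_mate ho hf hb]
  · have hi : x ∈ a.inn := by
      rcases c.below_mem hM h hx with h1 | h1 | h1 | h1
      · exact absurd h1 hv
      · exact absurd h1 ht
      · exact absurd h1 ho
      · exact h1
    rw [h.inn_mate_base hi]
    rw [h.base_not ho] at hx
    exact c.below_child hM h (child_mate hM h hi) hx

theorem OvertakeAt.below_mate_iff {x : V} :
    a.Below M v t (a.base (ScaledMatching.mate M x)) ↔ a.Below M v t (a.base x) := by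
  refine ⟨fun hx => ?_, c.below_mate hM h⟩
  have := c.below_mate hM h hx
  rwa [hM.mate_mate] at this

end Basic

theorem mem_overtake_inn {x : V} :
    x ∈ (a.overtake M α u v t k wk').inn ↔ x ∈ a.inn ∨ x = v := Iff.rfl

theorem mem_overtake_out {x : V} :
    x ∈ (a.overtake M α u v t k wk').out ↔ x ∈ a.out ∨ x = t := Iff.rfl

theorem overtake_par_self : (a.overtake M α u v t k wk').par v = u := if_pos rfl

theorem overtake_par_ne {x : V} (hx : x ≠ v) :
    (a.overtake M α u v t k wk').par x = a.par x := if_neg hx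

theorem overtake_lab_self : (a.overtake M α u v t k wk').lab (v, t) = k := if_pos rfl

theorem overtake_lab_ne {b : V × V} (hb : b ≠ (v, t)) :
    (a.overtake M α u v t k wk').lab b = a.lab b := if_neg hb

theorem mem_overtake_own_self {x : V} : x ∈ (a.overtake M α u v t k wk').own α ↔
    x ∈ a.own α ∨ a.Below M v t (a.base x) := by
  simp [overtake]

theorem mem_overtake_own_ne {γ x : V} (hγ : γ ≠ α) : x ∈ (a.overtake M α u v t k wk').own γ ↔
    x ∈ a.own γ ∧ ¬ a.Below M v t (a.base x) := by
  simp [overtake, hγ]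

variable (hM : IsMatchingSet G M) (h : a.Valid M G l) (c : a.OvertakeAt M G α u v t)
include hM h c

theorem overtake_D_of_ne {y : V} (h1 : y ≠ v) (h2 : y ≠ t) :
    (a.overtake M α u v t k wk').D M y = a.D M y := by
  have e1 : (ScaledMatching.mate M y, y) ≠ (v, t) := fun h' => h2 (Prod.ext_iff.1 h').2
  have e2 : (y, ScaledMatching.mate M y) ≠ (v, t) := fun h' => h1 (Prod.ext_iff.1 h').1
  have e3 : y ∈ (a.overtake M α u v t k wk').out ↔ y ∈ a.out := by simp [mem_overtake_out, h2]
  rw [D, D, overtake_lab_ne e1, overtake_lab_ne e2]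
  by_cases hy : y ∈ a.out
  · rw [if_pos hy, if_pos (e3.2 hy)]
  · rw [if_neg hy, if_neg (mt e3.1 hy)]

theorem overtake_D_t : (a.overtake M α u v t k wk').D M t = k := by
  rw [D, if_pos (mem_overtake_out.2 (Or.inr rfl)), if_neg (c.t_cov hM), c.mate_t hM,
    overtake_lab_self]

theorem overtake_D_v : (a.overtake M α u v t k wk').D M v = k := by
  rw [D, if_neg, c.mate, overtake_lab_self]
  rintro (h1 | h1)
  · exact c.v_out h1
  · exact c.v_ne_t hM h h1

theorem overtake_D_le (hk : k ≤ a.lab (v, t)) {y : V} (hy : y ∈ a.out) :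
    (a.overtake M α u v t k wk').D M y ≤ a.D M y := by
  rcases eq_or_ne y t with rfl | ht
  · rw [overtake_D_t hM h c, D_out hy (c.t_cov hM), c.mate_t hM]
    exact hk
  · rw [overtake_D_of_ne hM h c _ ht]
    rintro rfl
    exact c.v_out hy

theorem overtake_D_u : (a.overtake M α u v t k wk').D M (a.base u) = a.D M (a.base u) :=
  overtake_D_of_ne hM h c (fun hu => c.v_out (hu ▸ h.base_out c.u_out)) (c.base_u_ne_t hM h)

/-- The moved subtree keeps its shape and its root arc becomes `(u, v)`. The new arc has the
required growth of distance because `k` is one more than the unchanged distance of `u`. All other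
tree arcs keep it because distances of outer nodes only fall, while their own labels stay. -/
theorem overtake_valid (hk : k = a.D M (a.base u) + 1) (hw : a.OvertakeWork M α v t wk') :
    (a.overtake M α u v t k wk').Valid M G l := by
  have hlt := c.lt
  have hle := c.lab_le hM h
  have hbt := c.base_t hM h
  have hS : ∀ {x γ}, x ∈ a.own γ → ∃ δ, x ∈ (a.overtake M α u v t k wk').own δ ∧
      (a.Below M v t (a.base x) → δ = α) ∧ (¬ a.Below M v t (a.base x) → δ = γ) := by
    intro x γ hx
    by_cases hb : a.Below M v t (a.base x)
    · exact ⟨α, mem_overtake_own_self.2 (Or.inr hb), fun _ => rfl, fun hb' => absurd hb hb'⟩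
    · rcases eq_or_ne γ α with rfl | hγ
      · exact ⟨γ, mem_overtake_own_self.2 (Or.inl hx), fun _ => rfl, fun _ => rfl⟩
      · exact ⟨γ, (mem_overtake_own_ne hγ).2 ⟨hx, hb⟩, fun hb' => absurd hb' hb, fun _ => rfl⟩
  have hroot := h.own_root c.u_own
  refine
    { base_base := h.base_base
      base_out := ?_
      base_not := fun {x} hx => h.base_not fun h' => hx (Or.inl h')
      inn_not := ?_
      inn_cov := ?_
      inn_mate := ?_
      inn_mate_base := ?_
      out_free := ?_
      out_mate := ?_
      base_mate := ?_
      par_out := ?_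
      par_adj := ?_
      par_lt := ?_
      lab_le := ?_
      lab_top := ?_
      own_disj := ?_
      own_mem := ?_
      mem_own := ?_
      own_base := ?_
      own_mate := ?_
      own_par := ?_
      own_free := ?_
      own_root := ?_
      free_own := ?_
      removed_own := ?_
      removed_mate := h.removed_mate
      wk_own := ?_
      wk_out := ?_
      wk_base := ?_ }
  · rintro x (hx | rfl)
    · exact Or.inl (h.base_out hx)
    · exact Or.inr hbt
  · rintro x (hx | rfl) (h' | h')
    · exact h.inn_not hx h'
    · exact c.t_inn hM h (h' ▸ hx)
    · exact c.v_out h'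
    · exact c.v_ne_t hM h h'
  · rintro x (hx | rfl)
    · exact h.inn_cov hx
    · exact c.v_cov
  · rintro x (hx | rfl)
    · exact Or.inl (h.inn_mate hx)
    · exact Or.inr c.mate
  · rintro x (hx | rfl)
    · exact h.inn_mate_base hx
    · rw [c.mate]; exact hbt
  · rintro x (hx | rfl) hf
    · exact h.out_free hx hf
    · exact absurd hf (c.t_cov hM)
  · rintro x (hx | rfl) hf hb
    · exact h.out_mate hx hf hb
    · exact absurd hbt hb
  · rintro x (hx | rfl) hf hb
    · exact Or.inl (h.base_mate hx hf hb)
    · exact Or.inr (c.mate_t hM)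
  · rintro x hx
    rcases eq_or_ne x v with rfl | hne
    · rw [overtake_par_self]; exact Or.inl c.u_out
    · rw [overtake_par_ne hne]; exact Or.inl (h.par_out (hx.resolve_right hne))
  · rintro x hx
    rcases eq_or_ne x v with rfl | hne
    · rw [overtake_par_self]; exact c.adj
    · rw [overtake_par_ne hne]; exact h.par_adj (hx.resolve_right hne)
  · rintro x hx
    rcases eq_or_ne x v with rfl | hne
    · rw [overtake_par_self, c.mate, overtake_lab_self]
      change AState.D M _ (a.base u) < k
      rw [overtake_D_u hM h c]
      omega
    · rw [overtake_par_ne hne, overtake_lab_ne fun h' => hne (Prod.ext_iff.1 h').1]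
      have hx' := hx.resolve_right hne
      exact (overtake_D_le hM h c (by omega) (h.base_out (h.par_out hx'))).trans_lt (h.par_lt hx')
  · rintro x hx
    rcases eq_or_ne x v with rfl | hne
    · rw [c.mate, overtake_lab_self]; omega
    · rw [overtake_lab_ne fun h' => hne (Prod.ext_iff.1 h').1]
      exact h.lab_le (hx.resolve_right hne)
  · intro x hf hr hm
    rw [overtake_lab_ne]
    · exact h.lab_top hf hr fun h' => hm (Or.inl h')
    · intro h'
      exact hm (Or.inr (Prod.ext_iff.1 h').2)
  · intro x γ δ h1 h2
    by_cases hγ : γ = α <;> by_cases hδ : δ = α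
    · rw [hγ, hδ]
    · rw [hγ, mem_overtake_own_self] at h1
      rw [mem_overtake_own_ne hδ] at h2
      rcases h1 with h1 | h1
      · rw [hγ]; exact h.own_disj h1 h2.1
      · exact absurd h1 h2.2
    · rw [hδ, mem_overtake_own_self] at h2
      rw [mem_overtake_own_ne hγ] at h1
      rcases h2 with h2 | h2
      · rw [hδ]; exact h.own_disj h1.1 h2
      · exact absurd h2 h1.2
    · rw [mem_overtake_own_ne hγ] at h1
      rw [mem_overtake_own_ne hδ] at h2
      exact h.own_disj h1.1 h2.1
  · intro x γ hx
    rw [mem_overtake_out, mem_overtake_inn]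
    have : x = v ∨ x = t ∨ x ∈ a.out ∨ x ∈ a.inn := by
      by_cases hγ : γ = α
      · rw [hγ, mem_overtake_own_self] at hx
        rcases hx with hx | hx
        · exact Or.inr (Or.inr (h.own_mem hx))
        · exact c.below_mem hM h hx
      · rw [mem_overtake_own_ne hγ] at hx
        exact Or.inr (Or.inr (h.own_mem hx.1))
    tauto
  · intro x hx
    rw [mem_overtake_out, mem_overtake_inn] at hx
    by_cases hx' : x ∈ a.out ∨ x ∈ a.inn
    · obtain ⟨γ, hγ⟩ := h.mem_own hx'
      obtain ⟨δ, hδ, -⟩ := hS hγ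
      exact ⟨δ, hδ⟩
    · refine ⟨α, mem_overtake_own_self.2 (Or.inr ?_)⟩
      rcases hx with (hx | rfl) | (hx | rfl)
      · exact absurd (Or.inl hx) hx'
      · rw [c.base_t hM h]; exact Or.inr (Or.inl rfl)
      · exact absurd (Or.inr hx) hx'
      · rw [c.base_v h]; exact Or.inl rfl
  · intro x γ hx
    change a.base x ∈ _
    by_cases hγ : γ = α
    · subst hγ
      rw [mem_overtake_own_self] at hx ⊢
      rw [h.base_base]
      exact hx.imp h.own_base id
    · rw [mem_overtake_own_ne hγ] at hx ⊢
      rw [h.base_base]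
      exact hx.imp h.own_base id
  · intro x γ hx hf
    by_cases hγ : γ = α
    · subst hγ
      rw [mem_overtake_own_self] at hx ⊢
      exact hx.imp (fun h' => h.own_mate h' hf) (c.below_mate hM h)
    · rw [mem_overtake_own_ne hγ] at hx ⊢
      rw [c.below_mate_iff hM h]
      exact hx.imp (fun h' => h.own_mate h' hf) id
  · intro x γ hx hxγ
    rcases eq_or_ne x v with rfl | hne
    · rw [overtake_par_self]
      by_cases hγ : γ = α
      · subst hγ; exact mem_overtake_own_self.2 (Or.inl c.u_own)
      · rw [mem_overtake_own_ne hγ, c.base_v h] at hxγ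
        exact absurd (Or.inl rfl) hxγ.2
    · have hx' := hx.resolve_right hne
      rw [overtake_par_ne hne]
      have hc := child_par h hx'
      by_cases hγ : γ = α
      · subst hγ
        rw [mem_overtake_own_self] at hxγ ⊢
        refine hxγ.imp (h.own_par hx') fun hb => ?_
        rw [hc.1] at hb
        exact c.below_parent hM h hc hb hne
      · rw [mem_overtake_own_ne hγ] at hxγ ⊢
        refine hxγ.imp (h.own_par hx') fun hb hb' => hb ?_
        rw [hc.1]
        exact c.below_child hM h hc hb'
  · intro x γ hx hf
    by_cases hγ : γ = α
    · subst hγ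
      rw [mem_overtake_own_self] at hx
      rcases hx with hx | hx
      · exact h.own_free hx hf
      · exact absurd hf (c.below_not_free hM h hx)
    · rw [mem_overtake_own_ne hγ] at hx
      exact h.own_free hx.1 hf
  · intro x γ hx
    by_cases hγ : γ = α
    · subst hγ
      exact ⟨mem_overtake_own_self.2 (Or.inl hroot.1), hroot.2⟩
    · rw [mem_overtake_own_ne hγ] at hx ⊢
      have := h.own_root hx.1
      exact ⟨⟨this.1, fun hb => c.below_not_free hM h hb this.2⟩, this.2⟩
  · intro x hf hr
    have := h.free_own hf hr
    by_cases hγ : x = α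
    · subst hγ
      exact mem_overtake_own_self.2 (Or.inl hroot.1)
    · rw [mem_overtake_own_ne hγ]
      exact ⟨this, fun hb => c.below_not_free hM h hb hf⟩
  · intro x γ hr hx
    by_cases hγ : γ = α
    · subst hγ
      rw [mem_overtake_own_self] at hx
      rcases hx with hx | hx
      · exact h.removed_own hr hx
      · rcases c.below_mem hM h hx with rfl | rfl | hx
        · exact c.v_rem hr
        · exact c.t_rem hM h hr
        · obtain ⟨δ, hδ⟩ := h.mem_own hx
          exact h.removed_own hr hδ
    · rw [mem_overtake_own_ne hγ] at hx
      exact h.removed_own hr hx.1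
  · intro γ w hγw
    rcases hw with ⟨h1, h2⟩ | ⟨β, w', hβ, h1, h2, h3, h4, h5, h6⟩
    · by_cases hγ : γ = α
      · subst hγ
        change wk' γ = some w at hγw
        rw [h1, Option.some.injEq] at hγw
        subst hγw
        rw [mem_overtake_own_self, c.base_t hM h]
        exact Or.inr (Or.inr (Or.inl rfl))
      · change wk' γ = some w at hγw
        rw [(h2 γ hγ).1] at hγw
        rw [mem_overtake_own_ne hγ, h.wk_base hγw]
        refine ⟨h.wk_own hγw, ?_⟩
        rintro (rfl | rfl | hb)
        · exact c.v_out (h.wk_out hγw)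
        · exact (h2 γ hγ).2 _ hγw Relation.ReflTransGen.refl
        · refine (h2 γ hγ).2 _ hγw (c.anc_t hM h hb ?_)
          rintro rfl
          exact c.v_out (h.wk_out hγw)
    · change wk' γ = some w at hγw
      have hct := child_mate hM h h3
      rw [c.mate] at hct
      by_cases hγ : γ = α
      · subst hγ
        rw [h4, Option.some.injEq] at hγw
        subst hγw
        rw [mem_overtake_own_self, h.wk_base h1]
        exact Or.inr (Or.inr (Or.inr (Relation.ReflTransGen.head hct h2)))
      · rw [mem_overtake_own_ne hγ]
        have hvβ : v ∈ a.own β := (Anc.own hM h (Relation.ReflTransGen.head hct h2 : a.Anc M v w')).2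
          (h.wk_own h1)
        by_cases hγβ : γ = β
        · subst hγβ
          rw [h5, Option.some.injEq] at hγw
          subst hγw
          rw [h.base_base]
          refine ⟨h.own_base (h.own_par h3 hvβ), ?_⟩
          rintro (hb | hb | hb)
          · exact c.v_out (hb ▸ h.base_out (h.par_out h3))
          -- The old parent of `v` cannot be `t`, whose distance is the label of `(v, t)` and so
          -- exceeds that of the parent.
          · have h8 := h.par_lt h3
            rw [hb, D_out ((c.t_out_iff hM h).2 h3) (c.t_cov hM), c.mate_t hM, c.mate] at h8
            omega
          · exact c.not_anc_par hM h h3 hb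
        · rw [h6 γ hγ hγβ] at hγw
          rw [h.wk_base hγw]
          refine ⟨h.wk_own hγw, fun hb => hγβ ?_⟩
          have : a.Anc M v w := by
            rcases hb with rfl | rfl | hb
            · exact Relation.ReflTransGen.refl
            · exact Relation.ReflTransGen.single hct
            · exact hb
          exact h.own_disj (h.wk_own hγw) ((this.own hM h).1 hvβ)
  · intro γ w hγw
    change wk' γ = some w at hγw
    rcases hw with ⟨h1, h2⟩ | ⟨β, w', hβ, h1, h2, h3, h4, h5, h6⟩
    · by_cases hγ : γ = α
      · subst hγ
        rw [h1, Option.some.injEq] at hγw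
        exact Or.inr hγw.symm
      · rw [(h2 γ hγ).1] at hγw
        exact Or.inl (h.wk_out hγw)
    · by_cases hγ : γ = α
      · subst hγ
        rw [h4, Option.some.injEq] at hγw
        exact Or.inl (hγw ▸ h.wk_out h1)
      · by_cases hγβ : γ = β
        · subst hγβ
          rw [h5, Option.some.injEq] at hγw
          exact Or.inl (hγw ▸ h.base_out (h.par_out h3))
        · rw [h6 γ hγ hγβ] at hγw
          exact Or.inl (h.wk_out hγw)
  · intro γ w hγw
    change wk' γ = some w at hγw
    change a.base w = w
    rcases hw with ⟨h1, h2⟩ | ⟨β, w', hβ, h1, h2, h3, h4, h5, h6⟩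
    · by_cases hγ : γ = α
      · subst hγ
        rw [h1, Option.some.injEq] at hγw
        rw [← hγw]
        exact c.base_t hM h
      · rw [(h2 γ hγ).1] at hγw
        exact h.wk_base hγw
    · by_cases hγ : γ = α
      · subst hγ
        rw [h4, Option.some.injEq] at hγw
        exact hγw ▸ h.wk_base h1
      · by_cases hγβ : γ = β
        · subst hγβ
          rw [h5, Option.some.injEq] at hγw
          exact hγw ▸ h.base_base _
        · rw [h6 γ hγ hγβ] at hγw
          exact h.wk_base hγw

end Overtake

end AState

end ScaledMatching

namespace ScaledMatching

variable {V : Type*}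

namespace AState

variable {M : Set (Sym2 V)} {a : AState V} {G : SimpleGraph V} {l : ℕ}

/-! ### Quantities that measure progress -/

variable (M a)

/-- The outer vertices on active paths. -/
def Act : Set V := {b | b ∈ a.out ∧ a.base b = b ∧ ∃ γ w, a.wk γ = some w ∧ a.Anc M b w}

/-- The outer vertices on active paths, without the roots. -/
def ActN : Set V := {b | b ∈ a.Act M ∧ ¬ Free M b}

/-- The active structures. -/
def active : Set V := {γ | ∃ w, a.wk γ = some w}

/-- Subtrees are small. -/
def Sized (l H : ℕ) : Prop := ∀ b, b ∈ a.out ∨ b ∈ a.inn → a.base b = b →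
  {x | a.Anc M b (a.base x)}.ncard ≤ 6 * H * (l - a.D M b) + 2

open Classical in
/-- The sum of the labels of the matched arcs. -/
noncomputable def phi [Fintype V] : ℕ := ∑ v, if Free M v then 0 else a.lab (v, mate M v)

/-- What all operations of a pass-bundle have in common. -/
structure Adv [Fintype V] (a' : AState V) : Prop where
  lab_le : ∀ e, a'.lab e ≤ a.lab e
  out : ∀ {u}, u ∈ a.out → u ∈ a'.out ∨ u ∈ a'.removed
  removed : a.removed ⊆ a'.removed
  base : ∀ {u v}, u ∈ a.out → v ∈ a.out → u ∈ a'.out → v ∈ a'.out → a.base u = a.base v →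
    a'.base u = a'.base v
  -- Vertices off the active paths are not disturbed, so what was settled about their arcs stays
  -- settled.
  act : ∀ {u}, u ∈ a'.out → a'.base u ∉ a'.Act M →
    u ∈ a.out ∧ a.base u ∉ a.Act M ∧ a'.D M (a'.base u) = a.D M (a.base u)
  modified : a.modified ⊆ a'.modified
  onHold : a'.onHold = a.onHold
  wk_eq : ∀ {γ}, γ ∉ a'.modified → a'.wk γ = a.wk γ
  own_eq : ∀ {γ}, γ ∉ a'.modified → a'.own γ = a.own γ
  -- An unmodified structure looks as it did at the start of the pass-bundle, so arcs read earlier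
  -- need not be reread.
  vert_eq : ∀ {γ u}, γ ∉ a'.modified → u ∈ a.own γ → (u ∈ a'.out ↔ u ∈ a.out) ∧
    a'.base u = a.base u ∧ a'.D M (a.base u) = a.D M (a.base u)
  -- Together with `keep` this confines newly outer vertices to working blossoms, where the
  -- contraction loop handles their arcs.
  new : ∀ {u}, u ∈ a'.out → u ∉ a.out → ∃ γ ∈ a'.modified, a'.wk γ = some (a'.base u)
  keep : ∀ {u γ}, u ∈ a.out → u ∈ a'.out → γ ∈ a.modified → a.wk γ = some (a.base u) →
    ∃ δ ∈ a'.modified, a'.wk δ = some (a'.base u)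
  phi_le : a'.phi M ≤ a.phi M
  -- The factor two pays for an overtaking, which marks up to two structures while `phi` drops by at
  -- least one.
  mod_le : (a'.modified ∩ a'.active).ncard + 2 * a'.phi M ≤
    (a.modified ∩ a.active).ncard + 2 * a.phi M
  -- Only overtaking can put a new outer node on an active path, and then only `t`, again at the
  -- price of a label.
  actN_le : (a'.ActN M).ncard + a'.phi M ≤ (a.ActN M).ncard + a.phi M
  active : a'.active ⊆ a.active

variable {M a}

theorem Adv.refl [Fintype V] : a.Adv M a where
  lab_le _ := le_rfl
  out := Or.inl
  removed := le_rfl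
  base _ _ _ _ := id
  act h1 h2 := ⟨h1, h2, rfl⟩
  modified := le_rfl
  onHold := rfl
  wk_eq _ := rfl
  own_eq _ := rfl
  vert_eq _ _ := ⟨Iff.rfl, rfl, rfl⟩
  new h1 h2 := absurd h1 h2
  keep _ _ h1 h2 := ⟨_, h1, h2⟩
  phi_le := le_rfl
  mod_le := le_rfl
  actN_le := le_rfl
  active := le_rfl

theorem Adv.trans [Fintype V] {b c : AState V} (hc : c.Valid M G l)
    (h1 : a.Adv M b) (h2 : b.Adv M c) : a.Adv M c := by
  -- A vertex that ceased to be outer in between was removed, and removed vertices never return.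
  have hno : ∀ {u}, u ∈ c.out → u ∈ a.out → u ∈ b.out := by
    intro u huc hua
    rcases h1.out hua with h | h
    · exact h
    · obtain ⟨γ, hγ⟩ := hc.mem_own (Or.inl huc)
      exact absurd hγ (hc.removed_own (h2.removed h))
  refine
    { lab_le := fun e => (h2.lab_le e).trans (h1.lab_le e)
      out := ?_
      removed := h1.removed.trans h2.removed
      base := fun hu hv hu' hv' he => h2.base (hno hu' hu) (hno hv' hv) hu' hv'
        (h1.base hu hv (hno hu' hu) (hno hv' hv) he)
      act := ?_
      modified := h1.modified.trans h2.modified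
      onHold := h2.onHold.trans h1.onHold
      wk_eq := fun h => (h2.wk_eq h).trans (h1.wk_eq fun h' => h (h2.modified h'))
      own_eq := fun h => (h2.own_eq h).trans (h1.own_eq fun h' => h (h2.modified h'))
      vert_eq := ?_
      new := ?_
      keep := ?_
      phi_le := h2.phi_le.trans h1.phi_le
      mod_le := h2.mod_le.trans h1.mod_le
      actN_le := h2.actN_le.trans h1.actN_le
      active := h2.active.trans h1.active }
  · intro u hu
    rcases h1.out hu with h | h
    · exact h2.out h
    · exact Or.inr (h2.removed h)
  · intro u hu hn
    obtain ⟨e1, e2, e3⟩ := h2.act hu hn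
    obtain ⟨f1, f2, f3⟩ := h1.act e1 e2
    exact ⟨f1, f2, e3.trans f3⟩
  · intro γ u hγ hu
    have hγ' : γ ∉ b.modified := fun h' => hγ (h2.modified h')
    obtain ⟨e1, e2, e3⟩ := h1.vert_eq hγ' hu
    have hu' : u ∈ b.own γ := by rwa [h1.own_eq hγ']
    obtain ⟨f1, f2, f3⟩ := h2.vert_eq hγ hu'
    rw [e2] at f2 f3
    exact ⟨f1.trans e1, f2, f3.trans e3⟩
  · intro u hu hn
    by_cases hb' : u ∈ b.out
    · obtain ⟨γ, g1, g2⟩ := h1.new hb' hn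
      exact h2.keep hb' hu g1 g2
    · exact h2.new hu hb'
  · intro u γ hu hu' hγ hw
    obtain ⟨δ, g1, g2⟩ := h1.keep hu (hno hu' hu) hγ hw
    exact h2.keep (hno hu' hu) hu' g1 g2

theorem ActN_subset_of {b : AState V} {s : Set V} (h : ∀ x, x ∈ a.Act M → ¬ Free M x →
    x ∈ b.Act M ∨ x ∈ s) : a.ActN M ⊆ b.ActN M ∪ s := by
  rintro x ⟨h1, h2⟩
  rcases h x h1 h2 with h3 | h3
  · exact Or.inl ⟨h3, h2⟩
  · exact Or.inr h3

/-! ### Progress under overtaking -/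

section Overtake

variable {α u v t : V} {k : ℕ} {wk' : V → Option V}
variable (hM : IsMatchingSet G M) (h : a.Valid M G l) (c : a.OvertakeAt M G α u v t)
include hM h c

/-- All three cases of overtaking change the forest in the same way: `v` is hung below the node of
`u`, and `t` below `v`. -/
theorem overtake_child_iff {p x : V} : (a.overtake M α u v t k wk').Child M p x ↔
    (x ≠ v ∧ x ≠ t ∧ a.Child M p x) ∨ (x = v ∧ p = a.base u) ∨ (x = t ∧ p = v) := by
  have hbv := c.base_v h
  have hbt := c.base_t hM h
  have hvt := c.v_ne_t hM h
  rcases eq_or_ne x v with rfl | hv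
  · have h2 : x ∉ (a.overtake M α u x t k wk').out := by
      rw [mem_overtake_out]; rintro (h3 | h3)
      · exact c.v_out h3
      · exact hvt h3
    constructor
    · rintro ⟨-, ⟨h3, -⟩ | ⟨-, h3⟩⟩
      · exact absurd h3 h2
      · rw [overtake_par_self] at h3
        exact Or.inr (Or.inl ⟨rfl, h3⟩)
    · rintro (⟨h3, -⟩ | ⟨-, h3⟩ | ⟨h3, -⟩)
      · exact absurd rfl h3
      · refine ⟨hbv, Or.inr ⟨Or.inr rfl, ?_⟩⟩
        rw [overtake_par_self]; exact h3
      · exact absurd h3 hvt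
  · rcases eq_or_ne x t with rfl | ht
    · constructor
      · rintro ⟨-, ⟨-, -, h3⟩ | ⟨h3, -⟩⟩
        · rw [c.mate_t hM] at h3
          exact Or.inr (Or.inr ⟨rfl, h3⟩)
        · rcases h3 with h3 | h3
          · exact absurd h3 (c.t_inn hM h)
          · exact absurd h3 hv
      · rintro (⟨-, h3, -⟩ | ⟨h3, -⟩ | ⟨-, h3⟩)
        · exact absurd rfl h3
        · exact absurd h3 hv
        · exact ⟨hbt, Or.inl ⟨Or.inr rfl, c.t_cov hM, h3.trans (c.mate_t hM).symm⟩⟩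
    · unfold Child
      rw [mem_overtake_out, mem_overtake_inn, overtake_par_ne hv]
      simp only [hv, ht, overtake, or_false, ne_eq, not_false_eq_true, true_and, false_and]

/-- A new downward path that is not an old one either crosses the new arc, and so comes from above
`u` into the moved part, or starts at `v`. -/
theorem overtake_anc_imp {b x : V} (hb : (a.overtake M α u v t k wk').Anc M b x) :
    a.Anc M b x ∨ (a.Anc M b (a.base u) ∧ a.Below M v t x) ∨
      (b = v ∧ a.Below M v t x) := by
  induction hb with
  | refl => exact Or.inl Relation.ReflTransGen.refl
  | @tail p x _ hpx ih =>
    rw [overtake_child_iff hM h c] at hpx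
    rcases hpx with ⟨h1, h2, h3⟩ | ⟨rfl, rfl⟩ | ⟨rfl, rfl⟩
    · rcases ih with ih | ⟨ih1, ih2⟩ | ⟨ih1, ih2⟩
      · exact Or.inl (ih.tail h3)
      · exact Or.inr (Or.inl ⟨ih1, c.below_child hM h h3 ih2⟩)
      · exact Or.inr (Or.inr ⟨ih1, c.below_child hM h h3 ih2⟩)
    · rcases ih with ih | ⟨ih1, ih2⟩ | ⟨ih1, ih2⟩
      · exact Or.inr (Or.inl ⟨ih, Or.inl rfl⟩)
      · exact Or.inr (Or.inl ⟨ih1, Or.inl rfl⟩)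
      · exact Or.inr (Or.inr ⟨ih1, Or.inl rfl⟩)
    · rcases ih with ih | ⟨ih1, ih2⟩ | ⟨ih1, ih2⟩
      · rcases ih.tail_cases with rfl | ⟨q, hq1, hq2⟩
        · exact Or.inr (Or.inr ⟨rfl, Or.inr (Or.inl rfl)⟩)
        · have hi : p ∈ a.inn := hq2.right_mem.resolve_left c.v_out
          have hc := child_mate hM h hi
          rw [c.mate] at hc
          exact Or.inl (ih.tail hc)
      · exact Or.inr (Or.inl ⟨ih1, Or.inr (Or.inl rfl)⟩)
      · exact Or.inr (Or.inr ⟨ih1, Or.inr (Or.inl rfl)⟩)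

theorem overtake_child_of {p x : V} (hp : a.Child M p x) (hx : x ≠ v) :
    (a.overtake M α u v t k wk').Child M p x := by
  rw [overtake_child_iff hM h c]
  rcases eq_or_ne x t with rfl | ht
  · rcases hp.cases h with ⟨-, -, rfl, -⟩ | ⟨h1, -, -⟩
    · exact Or.inr (Or.inr ⟨rfl, c.mate_t hM⟩)
    · exact absurd h1 (c.t_inn hM h)
  · exact Or.inl ⟨hx, ht, hp⟩

/-- An old path can break only at the replaced arc into `v`. -/
theorem overtake_anc_of {b x : V} (hx : a.Anc M b x) :
    (a.overtake M α u v t k wk').Anc M b x ∨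
      (v ∈ a.inn ∧ a.Anc M b (a.base (a.par v)) ∧ a.Anc M v x) := by
  induction hx with
  | refl => exact Or.inl Relation.ReflTransGen.refl
  | @tail p x hbp hpx ih =>
    rcases eq_or_ne x v with rfl | hne
    · have hi : x ∈ a.inn := hpx.right_mem.resolve_left c.v_out
      rw [hpx.unique h (child_par h hi)] at hbp
      exact Or.inr ⟨hi, hbp, Relation.ReflTransGen.refl⟩
    · rcases ih with ih | ⟨ih1, ih2, ih3⟩
      · exact Or.inl (ih.tail (overtake_child_of hM h c hpx hne))
      · exact Or.inr ⟨ih1, ih2, ih3.tail hpx⟩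

theorem overtake_anc_of_not {b x : V} (hx : a.Anc M b x) (hv : ¬ a.Anc M v x) :
    (a.overtake M α u v t k wk').Anc M b x :=
  (overtake_anc_of hM h c hx).resolve_right fun h' => hv h'.2.2

theorem overtake_anc_t : (a.overtake M α u v t k wk').Anc M (a.base u) t :=
  Relation.ReflTransGen.tail (Relation.ReflTransGen.single
    ((overtake_child_iff hM h c).2 (Or.inr (Or.inl ⟨rfl, rfl⟩))))
    ((overtake_child_iff hM h c).2 (Or.inr (Or.inr ⟨rfl, rfl⟩)))

theorem overtake_anc_t_of {x : V} (hx : a.Anc M t x) :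
    (a.overtake M α u v t k wk').Anc M t x := by
  refine (overtake_anc_of hM h c hx).resolve_right ?_
  rintro ⟨hi, h1, -⟩
  have h2 := child_mate hM h hi
  rw [c.mate] at h2
  exact c.not_anc_par hM h hi (Relation.ReflTransGen.head h2 h1)

theorem OvertakeAt.below_own {x γ : V} (hx : a.Below M v t (a.base x)) (hγ : x ∈ a.own γ) :
    v ∈ a.own γ := by
  rcases hx with hx | hx | hx
  · rwa [← c.base_eq_v hM h hx]
  · have := h.own_base hγ
    rw [hx, ← c.mate] at this
    exact own_of_mate hM h this
  · exact (hx.own hM h).2 (h.own_base hγ)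

/-- The active path of `α` is prolonged. If it takes over the working vertex of another structure,
that structure's path is cut at `v`: the part below `v` goes to `α`, and the part above remains
active because the old parent of `v` becomes the working vertex there. -/
theorem overtake_act_subset (hw : a.OvertakeWork M α v t wk') {b : V} (hb : b ∈ a.Act M) :
    b ∈ (a.overtake M α u v t k wk').Act M := by
  obtain ⟨hbo, hbb, γ, w, hγ, hbw⟩ := hb
  refine ⟨Or.inl hbo, hbb, ?_⟩
  have hbv : b ≠ v := fun hb => c.v_out (hb ▸ hbo)
  rcases hw with ⟨h1, h2⟩ | ⟨β, w', hβ, h1, h2, h3, h4, h5, h6⟩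
  · by_cases hγα : γ = α
    · subst hγα
      rw [c.wk, Option.some.injEq] at hγ
      subst hγ
      exact ⟨γ, t, h1, (overtake_anc_of_not hM h c hbw (c.not_anc_u hM h)).trans
        (overtake_anc_t hM h c)⟩
    · refine ⟨γ, w, (h2 γ hγα).1.trans hγ, overtake_anc_of_not hM h c hbw fun hv => ?_⟩
      refine (h2 γ hγα).2 w hγ (c.anc_t hM h hv ?_)
      rintro rfl
      exact c.v_out (h.wk_out hγ)
  · by_cases hγα : γ = α
    · subst hγα
      rw [c.wk, Option.some.injEq] at hγ
      subst hγ
      exact ⟨γ, w', h4, ((overtake_anc_of_not hM h c hbw (c.not_anc_u hM h)).trans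
        (overtake_anc_t hM h c)).trans (overtake_anc_t_of hM h c h2)⟩
    · by_cases hγβ : γ = β
      · subst hγβ
        rw [h1, Option.some.injEq] at hγ
        subst hγ
        rcases overtake_anc_of (u := u) (k := k) (wk' := wk') hM h c hbw with h7 | ⟨-, h7, -⟩
        · exact ⟨α, w', h4, h7⟩
        · exact ⟨γ, _, h5, overtake_anc_of_not hM h c h7 (c.not_anc_par hM h h3)⟩
      · refine ⟨γ, w, (h6 γ hγα hγβ).trans hγ, overtake_anc_of_not hM h c hbw fun hv => hγβ ?_⟩
        have h7 := (hv.own hM h).2 (h.wk_own hγ)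
        have h8 := child_mate hM h h3
        rw [c.mate] at h8
        exact h.own_disj h7 ((Anc.own hM h (Relation.ReflTransGen.head h8 h2)).2 (h.wk_own h1))

theorem overtake_act_imp (hw : a.OvertakeWork M α v t wk') {b : V}
    (hb : b ∈ (a.overtake M α u v t k wk').Act M) : b ∈ a.Act M ∨ b = t := by
  obtain ⟨hbo, hbb, γ, w, hγ, hbw⟩ := hb
  rcases hbo with hbo | hbo
  swap
  · exact Or.inr hbo
  have hbv : b ≠ v := fun hb => c.v_out (hb ▸ hbo)
  have key : ∀ {w}, (a.overtake M α u v t k wk').Anc M b w → a.Anc M b w ∨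
      (a.Anc M b (a.base u) ∧ a.Below M v t w) := by
    intro w hbw
    rcases overtake_anc_imp hM h c hbw with h1 | h1 | h1
    · exact Or.inl h1
    · exact Or.inr h1
    · exact absurd h1.1 hbv
  have huAct : a.Anc M b (a.base u) → b ∈ a.Act M := fun h' => ⟨hbo, hbb, α, _, c.wk, h'⟩
  change wk' γ = some w at hγ
  rcases hw with ⟨h1, h2⟩ | ⟨β, w', hβ, h1, h2, h3, h4, h5, h6⟩
  · by_cases hγα : γ = α
    · subst hγα
      rw [h1, Option.some.injEq] at hγ
      subst hγ
      rcases hbw.tail_cases with h3 | ⟨p, hp, hpt⟩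
      · exact Or.inr h3
      rw [overtake_child_iff hM h c] at hpt
      obtain rfl : p = v := by
        rcases hpt with ⟨-, h3, -⟩ | ⟨h3, -⟩ | ⟨-, h3⟩
        · exact absurd rfl h3
        · exact absurd h3.symm (c.v_ne_t hM h)
        · exact h3
      rcases hp.tail_cases with h3 | ⟨q, hq, hqv⟩
      · exact absurd h3 hbv
      rw [overtake_child_iff hM h c] at hqv
      obtain rfl : q = a.base u := by
        rcases hqv with ⟨h3, -⟩ | ⟨-, h3⟩ | ⟨h3, -⟩
        · exact absurd rfl h3
        · exact h3
        · exact absurd h3 (c.v_ne_t hM h)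
      rcases key hq with h3 | h3
      · exact Or.inl (huAct h3)
      · exact Or.inl (huAct h3.1)
    · rw [(h2 γ hγα).1] at hγ
      rcases key hbw with h3 | h3
      · exact Or.inl ⟨hbo, hbb, γ, w, hγ, h3⟩
      · exact Or.inl (huAct h3.1)
  · rcases key hbw with h9 | h9
    swap
    · exact Or.inl (huAct h9.1)
    by_cases hγα : γ = α
    · subst hγα
      rw [h4, Option.some.injEq] at hγ
      subst hγ
      exact Or.inl ⟨hbo, hbb, β, _, h1, h9⟩
    · by_cases hγβ : γ = β
      · subst hγβ
        rw [h5, Option.some.injEq] at hγ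
        subst hγ
        have h8 := child_mate hM h h3
        rw [c.mate] at h8
        exact Or.inl ⟨hbo, hbb, γ, _, h1, ((h9.tail (child_par h h3)).tail h8).trans h2⟩
      · rw [h6 γ hγα hγβ] at hγ
        exact Or.inl ⟨hbo, hbb, γ, w, hγ, h9⟩

variable [Fintype V]

theorem overtake_phi (hk : k < a.lab (v, t)) :
    (a.overtake M α u v t k wk').phi M + 1 ≤ a.phi M := by
  classical
  refine Nat.succ_le_of_lt (Finset.sum_lt_sum (fun x _ => ?_) ⟨v, Finset.mem_univ v, ?_⟩)
  · split_ifs with hf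
    · exact le_rfl
    · rcases eq_or_ne x v with rfl | hx
      · rw [c.mate, overtake_lab_self]; exact hk.le
      · rw [overtake_lab_ne fun h' => hx (Prod.ext_iff.1 h').1]
  · rw [if_neg c.v_cov, if_neg c.v_cov, c.mate, overtake_lab_self]
    exact hk

theorem overtake_active (hw : a.OvertakeWork M α v t wk') :
    (a.overtake M α u v t k wk').active ⊆ a.active := by
  rintro γ ⟨w, hγ⟩
  change wk' γ = some w at hγ
  by_cases hγα : γ = α
  · exact ⟨_, hγα ▸ c.wk⟩
  rcases hw with ⟨h1, h2⟩ | ⟨β, w', hβ, h1, h2, h3, h4, h5, h6⟩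
  · exact ⟨w, (h2 γ hγα).1 ▸ hγ⟩
  · by_cases hγβ : γ = β
    · exact ⟨_, hγβ ▸ h1⟩
    · exact ⟨w, h6 γ hγα hγβ ▸ hγ⟩

theorem overtake_adv (hk : k = a.D M (a.base u) + 1) (hw : a.OvertakeWork M α v t wk')
    (hα : α ∉ a.modified) : a.Adv M (a.overtake M α u v t k wk') := by
  have hlt := c.lt
  have hphi := overtake_phi (u := u) (wk' := wk') hM h c (k := k) (by omega)
  have hactive := overtake_active (u := u) (k := k) hM h c hw
  have hbt := c.base_t hM h
  have hbv := c.base_v h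
  refine
    { lab_le := ?_
      out := fun hu => Or.inl (Or.inl hu)
      removed := le_rfl
      base := fun _ _ _ _ => id
      act := ?_
      modified := fun x hx => Or.inl (Or.inl hx)
      onHold := rfl
      wk_eq := ?_
      own_eq := ?_
      vert_eq := ?_
      new := ?_
      keep := ?_
      phi_le := by omega
      mod_le := ?_
      actN_le := ?_
      active := hactive }
  · intro e
    by_cases he : e = (v, t)
    · rw [he, overtake_lab_self]; omega
    · rw [overtake_lab_ne he]
  · intro x hx hn
    -- After the operation `t` lies on the active path of `α`, so it is not a base off the active
    -- paths.
    have hxt : a.base x ≠ t := by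
      intro hxt
      refine hn ?_
      change a.base x ∈ _
      rw [hxt]
      refine ⟨Or.inr rfl, hbt, ?_⟩
      rcases hw with ⟨h1, h2⟩ | ⟨β, w', hβ, h1, h2, h3, h4, h5, h6⟩
      · exact ⟨α, t, h1, Relation.ReflTransGen.refl⟩
      · exact ⟨α, w', h4, overtake_anc_t_of hM h c h2⟩
    have hxo : x ∈ a.out := by
      rcases hx with hx | rfl
      · exact hx
      · exact absurd hbt hxt
    refine ⟨hxo, fun h' => hn (overtake_act_subset hM h c hw h'), ?_⟩
    refine overtake_D_of_ne hM h c (fun h' => c.v_out (h' ▸ h.base_out hxo)) hxt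
  · intro γ hγ
    have hγα : γ ≠ α := fun h' => hγ (Or.inl (Or.inr h'))
    rcases hw with ⟨h1, h2⟩ | ⟨β, w', hβ, h1, h2, h3, h4, h5, h6⟩
    · exact (h2 γ hγα).1
    · refine h6 γ hγα ?_
      rintro rfl
      refine hγ (Or.inr ?_)
      have h8 := child_mate hM h h3
      rw [c.mate] at h8
      exact (Anc.own hM h (Relation.ReflTransGen.head h8 h2)).2 (h.wk_own h1)
  · intro γ hγ
    have hγα : γ ≠ α := fun h' => hγ (Or.inl (Or.inr h'))
    ext x
    rw [mem_overtake_own_ne hγα]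
    refine ⟨fun h' => h'.1, fun hx => ⟨hx, fun hb => hγ (Or.inr (c.below_own hM h hb hx))⟩⟩
  · intro γ x hγ hx
    have hvγ : v ∉ a.own γ := fun h' => hγ (Or.inr h')
    have htγ : t ∉ a.own γ := fun h' => hvγ (own_of_mate hM h (by rwa [c.mate]))
    refine ⟨⟨fun h' => h'.resolve_right ?_, Or.inl⟩, rfl, ?_⟩
    · rintro rfl; exact htγ hx
    · refine overtake_D_of_ne hM h c ?_ ?_
      · intro h'; exact hvγ (h' ▸ h.own_base hx)
      · intro h'; exact htγ (h' ▸ h.own_base hx)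
  · intro x hx hxn
    obtain rfl : x = t := hx.resolve_left hxn
    refine ⟨α, Or.inl (Or.inr rfl), ?_⟩
    change wk' α = some (a.base x)
    rw [hbt]
    rcases hw with ⟨h1, h2⟩ | ⟨β, w', hβ, h1, h2, h3, h4, h5, h6⟩
    · exact h1
    · exact absurd ((c.t_out_iff hM h).2 h3) hxn
  · intro x γ hx _ hγ hxw
    change ∃ δ ∈ _, wk' δ = some (a.base x)
    have hγα : γ ≠ α := fun h' => hα (h' ▸ hγ)
    rcases hw with ⟨h1, h2⟩ | ⟨β, w', hβ, h1, h2, h3, h4, h5, h6⟩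
    · exact ⟨γ, Or.inl (Or.inl hγ), (h2 γ hγα).1.trans hxw⟩
    · by_cases hγβ : γ = β
      · subst hγβ
        rw [h1] at hxw
        exact ⟨α, Or.inl (Or.inr rfl), h4.trans hxw⟩
      · exact ⟨γ, Or.inl (Or.inl hγ), (h6 γ hγα hγβ).trans hxw⟩
  · have h1 : (a.overtake M α u v t k wk').modified ∩ (a.overtake M α u v t k wk').active ⊆
        (a.modified ∩ a.active) ∪ {α} ∪ {γ | v ∈ a.own γ} := by
      rintro γ ⟨(h1 | h1) | h1, h2⟩
      · exact Or.inl (Or.inl ⟨h1, hactive h2⟩)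
      · exact Or.inl (Or.inr h1)
      · exact Or.inr h1
    -- Besides `α` only the previous owner of `v`, if any, is marked.
    have h2 : {γ | v ∈ a.own γ}.ncard ≤ 1 := by
      rw [Set.ncard_le_one (Set.toFinite _)]
      intro x hx y hy
      exact h.own_disj hx hy
    have h3 := (Set.ncard_le_ncard h1 (Set.toFinite _)).trans (Set.ncard_union_le _ _)
    have h4 := Set.ncard_union_le (a.modified ∩ a.active) {α}
    rw [Set.ncard_singleton] at h4
    omega
  · have h1 : (a.overtake M α u v t k wk').ActN M ⊆ a.ActN M ∪ {t} :=
      ActN_subset_of fun x hx _ => overtake_act_imp hM h c hw hx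
    have h3 := (Set.ncard_le_ncard h1 (Set.toFinite _)).trans (Set.ncard_union_le _ _)
    rw [Set.ncard_singleton] at h3
    omega

/-- The subtrees that grow belong to ancestors of `u`, and such a subtree stays inside the small
structure `S_α` together with the moved part. The bound for the moved part refers to the old label
of `(v, t)`. The ancestors of `u` have distances smaller by at least two, which leaves room for the
`6 * H` vertices of `S_α`. -/
theorem overtake_sized {H : ℕ} (hs : a.Sized M l H) (hα : (a.own α).ncard ≤ 6 * H)
    (hk : k = a.D M (a.base u) + 1) : (a.overtake M α u v t k wk').Sized M l H := by
  have hlt := c.lt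
  have hle := c.lab_le hM h
  have hbt := c.base_t hM h
  have hbv := c.base_v h
  set P : Set V := {x | a.Below M v t (a.base x)} with hP
  -- If `v` was already inner this is the old bound at `v`. Otherwise the moved part is just `{v,
  -- t}`, which explains the additive two.
  have hPc : P.ncard ≤ 6 * H * (l - a.lab (v, t)) + 2 := by
    by_cases hi : v ∈ a.inn
    · have h1 := hs v (Or.inr hi) hbv
      rw [D_inn h hi, c.mate] at h1
      refine le_trans (Set.ncard_le_ncard ?_ (Set.toFinite _)) h1
      have h8 := child_mate hM h hi
      rw [c.mate] at h8
      rintro x (hx | hx | hx)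
      · change a.Anc M v (a.base x)
        rw [hx]; exact Relation.ReflTransGen.refl
      · change a.Anc M v (a.base x)
        rw [hx]; exact Relation.ReflTransGen.single h8
      · exact hx
    · have h1 : P ⊆ {v, t} := by
        rintro x (hx | hx | hx)
        · exact Or.inl (c.base_eq_v hM h hx)
        · right
          have ho : x ∉ a.out := by
            intro ho
            have := h.base_out ho
            rw [hx, c.t_out_iff hM h] at this
            exact hi this
          rwa [h.base_not ho] at hx
        · rcases Relation.ReflTransGen.cases_head hx with h1 | ⟨d, hd, -⟩
          · exact Or.inl (c.base_eq_v hM h h1.symm)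
          · rcases hd.left_mem h with h2 | h2
            · exact absurd h2 c.v_out
            · exact absurd h2 hi
      have h2 := (Set.ncard_le_ncard h1 (Set.toFinite _)).trans (Set.ncard_insert_le _ _)
      rw [Set.ncard_singleton] at h2
      omega
  have hPk : P.ncard ≤ 6 * H * (l - k) + 2 := by
    refine hPc.trans (Nat.add_le_add_right (Nat.mul_le_mul_left _ ?_) _)
    omega
  intro b hb hbb
  change a.base b = b at hbb
  change {x | (a.overtake M α u v t k wk').Anc M b (a.base x)}.ncard ≤ _
  rcases eq_or_ne b v with rfl | hbv'
  · rw [overtake_D_v hM h c]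
    refine (Set.ncard_le_ncard ?_ (Set.toFinite _)).trans hPk
    intro x hx
    rcases overtake_anc_imp hM h c hx with h1 | h1 | h1
    · exact Or.inr (Or.inr h1)
    · exact h1.2
    · exact h1.2
  rcases eq_or_ne b t with rfl | hbt'
  · rw [overtake_D_t hM h c]
    refine (Set.ncard_le_ncard ?_ (Set.toFinite _)).trans hPk
    intro x hx
    rcases overtake_anc_imp hM h c hx with h1 | h1 | h1
    · rcases Relation.ReflTransGen.cases_head h1 with h1 | ⟨d, hd, h2⟩
      · exact Or.inr (Or.inl h1.symm)
      · have h3 := c.below_child hM h hd (Or.inr (Or.inl rfl))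
        rcases h3 with rfl | rfl | h3
        · exact Or.inr (Or.inr h2)
        · exact absurd (hd.rank_lt hM h) (lt_irrefl _)
        · exact Or.inr (Or.inr (h3.trans h2))
    · exact h1.2
    · exact h1.2
  rw [overtake_D_of_ne hM h c hbv' hbt']
  have hb' : b ∈ a.out ∨ b ∈ a.inn := by
    rcases hb with (hb | hb) | (hb | hb)
    · exact Or.inl hb
    · exact absurd hb hbt'
    · exact Or.inr hb
    · exact absurd hb hbv'
  by_cases hbu : a.Anc M b (a.base u)
  · have hbα : b ∈ a.own α := (hbu.own hM h).2 (h.own_base c.u_own)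
    have h1 : {x | (a.overtake M α u v t k wk').Anc M b (a.base x)} ⊆ a.own α ∪ P := by
      intro x hx
      rcases overtake_anc_imp hM h c hx with h1 | h1 | h1
      · exact Or.inl (own_of_base h ((h1.own hM h).1 hbα))
      · exact Or.inr h1.2
      · exact absurd h1.1 hbv'
    have h2 := (Set.ncard_le_ncard h1 (Set.toFinite _)).trans (Set.ncard_union_le _ _)
    have h3 := hbu.D_le hM h
    -- Since `D b + 1 < lab (v, t) ≤ l + 1`, a unit is available even when the left difference
    -- truncates to zero.
    have h4 : l - a.lab (v, t) + 1 ≤ l - a.D M b := by omega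
    have h5 := Nat.mul_le_mul_left (6 * H) h4
    rw [Nat.mul_add, Nat.mul_one] at h5
    omega
  · refine (Set.ncard_le_ncard ?_ (Set.toFinite _)).trans (hs b hb' hbb)
    intro x hx
    rcases overtake_anc_imp hM h c hx with h1 | h1 | h1
    · exact h1
    · exact absurd h1.1 hbu
    · exact absurd h1.1 hbv'

end Overtake

end AState

end ScaledMatching

namespace ScaledMatching

variable {V : Type*}

namespace AState

variable {M : Set (Sym2 V)} {a : AState V} {G : SimpleGraph V} {l : ℕ}

/-! ### Contracting -/

variable (M a) in
/-- The nodes of the cycle closed by an arc between the nodes `p` and `q` with lowest common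
ancestor `L`. -/
def cyc (L p q : V) : Set V := {z | a.Anc M L z ∧ (a.Anc M z p ∨ a.Anc M z q)}

variable (M a) in
open Classical in
/-- The effect of `Contract` on the description of a state: the nodes in `K` are merged into one
node with base `L`. -/
noncomputable def contract (α L : V) (K : Set V) : AState V where
  base := fun x => if a.base x ∈ K then L else a.base x
  par := a.par
  out := a.out ∪ {x | a.base x ∈ K}
  inn := a.inn \ K
  own := a.own
  wk := fun γ => if γ = α then some L else a.wk γ
  lab := fun e => if s(e.1, e.2) ∈ M ∧ a.base e.1 ∈ K ∧ a.base e.2 ∈ K then 0 else a.lab e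
  removed := a.removed
  onHold := a.onHold
  modified := insert α a.modified

variable (M a) in
/-- The situation in which `Contract` is performed. -/
structure ContractAt (α u v L : V) : Prop where
  u_own : u ∈ a.own α
  v_own : v ∈ a.own α
  u_out : u ∈ a.out
  v_out : v ∈ a.out
  ne : a.base u ≠ a.base v
  wk : a.wk α = some (a.base u)
  anc_u : a.Anc M L (a.base u)
  anc_v : a.Anc M L (a.base v)
  lowest : ∀ Z, a.Anc M Z (a.base u) → a.Anc M Z (a.base v) → a.Anc M Z L

/-- The root is a common ancestor. Common ancestors form a chain, so one of maximal rank is below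
all others. -/
theorem exists_lowest (hM : IsMatchingSet G M) (h : a.Valid M G l) {α u v : V}
    (hu : u ∈ a.own α) (hv : v ∈ a.own α) [Finite V] : ∃ L, a.Anc M L (a.base u) ∧
      a.Anc M L (a.base v) ∧
      ∀ Z, a.Anc M Z (a.base u) → a.Anc M Z (a.base v) → a.Anc M Z L := by
  obtain ⟨L, hL, hmax⟩ := Set.exists_max_image
    {Z | a.Anc M Z (a.base u) ∧ a.Anc M Z (a.base v)} (a.rank M) (Set.toFinite _)
    ⟨α, root_anc hM h hu, root_anc hM h hv⟩
  refine ⟨L, hL.1, hL.2, fun Z h1 h2 => ?_⟩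
  rcases h1.total h hL.1 with h3 | h3
  · exact h3
  · have h4 := hmax Z ⟨h1, h2⟩
    rcases h3.rank_lt hM h with rfl | h5
    · exact Relation.ReflTransGen.refl
    · omega

section Contract

variable {α u v L : V}

section Basic

variable (hM : IsMatchingSet G M) (h : a.Valid M G l) (c : a.ContractAt M α u v L)
include hM h c

local notation "K" => a.cyc M L (a.base u) (a.base v)

theorem ContractAt.L_mem : L ∈ K := ⟨Relation.ReflTransGen.refl, Or.inl c.anc_u⟩

theorem ContractAt.u_mem : a.base u ∈ K := ⟨c.anc_u, Or.inl Relation.ReflTransGen.refl⟩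

theorem ContractAt.v_mem : a.base v ∈ K := ⟨c.anc_v, Or.inr Relation.ReflTransGen.refl⟩

theorem ContractAt.K_base {z : V} (hz : z ∈ K) : a.base z = z := by
  rcases hz.2 with h1 | h1
  · exact h1.base_left h (h.base_base u)
  · exact h1.base_left h (h.base_base v)

theorem ContractAt.K_own {z : V} (hz : z ∈ K) : z ∈ a.own α := by
  rcases hz.2 with h1 | h1
  · exact (h1.own hM h).2 (h.own_base c.u_own)
  · exact (h1.own hM h).2 (h.own_base c.v_own)

/-- An inner node has a single child, which would be a lower common ancestor of the two outer ends.
-/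
theorem ContractAt.L_out : L ∈ a.out := by
  refine (h.own_mem (c.K_own hM h (c.L_mem hM h))).resolve_right fun hi => ?_
  have h1 : L ≠ a.base u := fun hh => h.inn_not hi (hh ▸ h.base_out c.u_out)
  have h2 : L ≠ a.base v := fun hh => h.inn_not hi (hh ▸ h.base_out c.v_out)
  have h3 := c.lowest _ (c.anc_u.mate_left hM h hi h1) (c.anc_v.mate_left hM h hi h2)
  have h4 := (child_mate hM h hi).rank_lt hM h
  rcases h3.rank_lt hM h with h5 | h5
  · rw [h5] at h4; omega
  · omega

theorem ContractAt.L_base : a.base L = L := c.K_base hM h (c.L_mem hM h)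

theorem ContractAt.K_inn_mate {z : V} (hz : z ∈ K) (hi : z ∈ a.inn) :
    ScaledMatching.mate M z ∈ K := by
  refine ⟨hz.1.tail (child_mate hM h hi), ?_⟩
  refine hz.2.imp (fun h1 => h1.mate_left hM h hi ?_) (fun h1 => h1.mate_left hM h hi ?_)
  · intro hh; exact h.inn_not hi (hh ▸ h.base_out c.u_out)
  · intro hh; exact h.inn_not hi (hh ▸ h.base_out c.v_out)

theorem ContractAt.K_parent {p z : V} (hz : z ∈ K) (hne : z ≠ L) (hp : a.Child M p z) :
    p ∈ K :=
  ⟨hz.1.of_child h hne.symm hp, hz.2.imp (Relation.ReflTransGen.head hp)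
    (Relation.ReflTransGen.head hp)⟩

theorem ContractAt.K_exists_parent {z : V} (hz : z ∈ K) (hne : z ≠ L) :
    ∃ p, a.Child M p z ∧ p ∈ K := by
  rcases hz.1.tail_cases with h1 | ⟨p, -, hp⟩
  · exact absurd h1.symm hne
  · exact ⟨p, hp, c.K_parent hM h hz hne hp⟩

theorem ContractAt.K_out_mate {z : V} (hz : z ∈ K) (hne : z ≠ L) (ho : z ∈ a.out) :
    ScaledMatching.mate M z ∈ K ∧ ScaledMatching.mate M z ∈ a.inn ∧ ¬ Free M z := by
  obtain ⟨p, hp, hpK⟩ := c.K_exists_parent hM h hz hne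
  rcases hp.cases h with ⟨-, h1, rfl, h2⟩ | ⟨h1, -⟩
  · exact ⟨hpK, h2, h1⟩
  · exact absurd ho (h.inn_not h1)

theorem ContractAt.mate_L (hf : ¬ Free M L) : ScaledMatching.mate M L ∈ a.inn ∧
    ScaledMatching.mate M L ∉ K := by
  have h1 := h.base_mate (c.L_out hM h) hf (c.L_base hM h)
  refine ⟨h1, fun h2 => ?_⟩
  have h3 := child_mate hM h h1
  rw [hM.mate_mate] at h3
  have h4 := h3.rank_lt hM h
  rcases h2.1.rank_lt hM h with h5 | h5
  · rw [← h5] at h4; omega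
  · omega

/-- Apart from `L` the cycle consists of inner nodes paired with their outer partners, and inside an
older blossom only the base is matched outwards. -/
theorem ContractAt.below_mate {x : V} (hx : a.base x ∈ K) (hne : x ≠ L) :
    ¬ Free M x ∧ a.base (ScaledMatching.mate M x) ∈ K := by
  by_cases ho : x ∈ a.out
  · by_cases hb : a.base x = x
    · rw [hb] at hx
      obtain ⟨h1, h2, h3⟩ := c.K_out_mate hM h hx hne ho
      exact ⟨h3, by rwa [h.base_not (h.inn_not h2)]⟩
    · have hf : ¬ Free M x := fun hf => hb (h.out_free ho hf)
      exact ⟨hf, by rwa [h.out_mate ho hf hb]⟩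
  · rw [h.base_not ho] at hx
    have hi := (h.own_mem (c.K_own hM h hx)).resolve_left ho
    exact ⟨h.inn_cov hi, by rw [h.inn_mate_base hi]; exact c.K_inn_mate hM h hx hi⟩

theorem contract_base_pos {x : V} (hx : a.base x ∈ K) : (a.contract M α L K).base x = L :=
  if_pos hx

theorem contract_base_neg {x : V} (hx : a.base x ∉ K) :
    (a.contract M α L K).base x = a.base x := if_neg hx

theorem contract_lab_le (e : V × V) : (a.contract M α L K).lab e ≤ a.lab e := by
  simp only [contract]
  split_ifs
  · exact Nat.zero_le _
  · exact le_rfl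

theorem contract_lab_left {e : V × V} (he : a.base e.1 ∉ K) :
    (a.contract M α L K).lab e = a.lab e := if_neg fun h' => he h'.2.1

theorem contract_lab_right {e : V × V} (he : a.base e.2 ∉ K) :
    (a.contract M α L K).lab e = a.lab e := if_neg fun h' => he h'.2.2

/-- The matched arc that determines the distance of `L` comes from its parent, which is off the
cycle, so its label is not reset. -/
theorem contract_D_L : (a.contract M α L K).D M L = a.D M L := by
  have hL := c.L_out hM h
  have hL' : L ∈ (a.contract M α L K).out := Or.inl hL
  by_cases hf : Free M L
  · rw [D_free hL hf, D_free hL' hf]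
  · rw [D_out hL hf, D_out hL' hf]
    refine contract_lab_left hM h c ?_
    obtain ⟨h1, h2⟩ := c.mate_L hM h hf
    rwa [h.base_not (h.inn_not h1)]

theorem contract_D_neg {y : V} (hy : a.base y ∉ K) :
    (a.contract M α L K).D M y = a.D M y := by
  by_cases ho : y ∈ a.out
  · have ho' : y ∈ (a.contract M α L K).out := Or.inl ho
    by_cases hf : Free M y
    · rw [D_free ho hf, D_free ho' hf]
    · rw [D_out ho hf, D_out ho' hf]
      exact contract_lab_right hM h c hy
  · have ho' : y ∉ (a.contract M α L K).out := fun h' => h'.elim ho hy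
    rw [D, D, if_neg ho, if_neg ho']
    exact contract_lab_left hM h c hy

theorem contract_D_base_le {x : V} :
    (a.contract M α L K).D M ((a.contract M α L K).base x) ≤ a.D M (a.base x) := by
  by_cases hx : a.base x ∈ K
  · rw [contract_base_pos hM h c hx, contract_D_L hM h c]
    exact hx.1.D_le hM h
  · rw [contract_base_neg hM h c hx, contract_D_neg hM h c (by rwa [h.base_base])]

theorem contract_valid : (a.contract M α L K).Valid M G l := by
  have hLb := c.L_base hM h
  have hLo := c.L_out hM h
  have hLK := c.L_mem hM h
  refine
    { base_base := ?_
      base_out := ?_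
      base_not := ?_
      inn_not := ?_
      inn_cov := fun hx => h.inn_cov hx.1
      inn_mate := fun hx => Or.inl (h.inn_mate hx.1)
      inn_mate_base := ?_
      out_free := ?_
      out_mate := ?_
      base_mate := ?_
      par_out := fun hx => Or.inl (h.par_out hx.1)
      par_adj := fun hx => h.par_adj hx.1
      par_lt := ?_
      lab_le := fun hx => (contract_lab_le hM h c _).trans (h.lab_le hx.1)
      lab_top := ?_
      own_disj := h.own_disj
      own_mem := ?_
      mem_own := ?_
      own_base := ?_
      own_mate := h.own_mate
      own_par := fun hx => h.own_par hx.1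
      own_free := h.own_free
      own_root := h.own_root
      free_own := h.free_own
      removed_own := h.removed_own
      removed_mate := h.removed_mate
      wk_own := ?_
      wk_out := ?_
      wk_base := ?_ }
  · intro x
    by_cases hx : a.base x ∈ K
    · rw [contract_base_pos hM h c hx, contract_base_pos hM h c (by rwa [hLb])]
    · have hx' : a.base (a.base x) ∉ K := by rwa [h.base_base]
      rw [contract_base_neg hM h c hx, contract_base_neg hM h c hx', h.base_base]
  · intro x hx
    by_cases hxK : a.base x ∈ K
    · rw [contract_base_pos hM h c hxK]; exact Or.inl hLo
    · rw [contract_base_neg hM h c hxK]; exact Or.inl (h.base_out (hx.resolve_right hxK))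
  · intro x hx
    rw [contract_base_neg hM h c fun h' => hx (Or.inr h')]
    exact h.base_not fun h' => hx (Or.inl h')
  · rintro x hx (h1 | h1)
    · exact h.inn_not hx.1 h1
    · change a.base x ∈ K at h1
      rw [h.base_not (h.inn_not hx.1)] at h1
      exact hx.2 h1
  · intro x hx
    have h1 := h.inn_mate_base hx.1
    by_cases hm : a.base (ScaledMatching.mate M x) ∈ K
    · rw [contract_base_pos hM h c hm]
      rw [h1] at hm
      by_contra hne
      have h2 := (c.K_out_mate hM h hm (Ne.symm hne) (h.inn_mate hx.1)).1
      rw [hM.mate_mate] at h2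
      exact hx.2 h2
    · rw [contract_base_neg hM h c hm, h1]
  · intro x hx hf
    by_cases hxK : a.base x ∈ K
    · rw [contract_base_pos hM h c hxK]
      by_contra hne
      exact (c.below_mate hM h hxK (Ne.symm hne)).1 hf
    · rw [contract_base_neg hM h c hxK]
      exact h.out_free (hx.resolve_right hxK) hf
  · intro x hx hf hb
    by_cases hxK : a.base x ∈ K
    · rw [contract_base_pos hM h c hxK] at hb ⊢
      exact contract_base_pos hM h c (c.below_mate hM h hxK hb.symm).2
    · rw [contract_base_neg hM h c hxK] at hb ⊢
      have h1 := h.out_mate (hx.resolve_right hxK) hf hb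
      rw [contract_base_neg hM h c (by rwa [h1]), h1]
  · intro x hx hf hb
    by_cases hxK : a.base x ∈ K
    · rw [contract_base_pos hM h c hxK] at hb
      subst hb
      exact c.mate_L hM h hf
    · rw [contract_base_neg hM h c hxK] at hb
      have h1 := h.base_mate (hx.resolve_right hxK) hf hb
      refine ⟨h1, fun h2 => hxK ?_⟩
      have h3 := c.K_inn_mate hM h h2 h1
      rw [hM.mate_mate] at h3
      rwa [hb]
  · intro x hx
    have h1 : a.base x ∉ K := by
      rw [h.base_not (h.inn_not hx.1)]; exact hx.2
    rw [contract_lab_left hM h c h1]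
    exact (contract_D_base_le hM h c).trans_lt (h.par_lt hx.1)
  · intro x hf hr hm
    rw [contract_lab_right hM h c (e := (x, ScaledMatching.mate M x)) fun h' => hm (Or.inr h')]
    exact h.lab_top hf hr fun h' => hm (Or.inl h')
  · intro x γ hx
    by_cases hxK : a.base x ∈ K
    · exact Or.inl (Or.inr hxK)
    · refine (h.own_mem hx).imp Or.inl fun hi => ⟨hi, fun h' => hxK ?_⟩
      rwa [h.base_not (h.inn_not hi)]
  · rintro x ((hx | hx) | hx)
    · exact h.mem_own (Or.inl hx)
    · exact ⟨α, own_of_base h (c.K_own hM h hx)⟩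
    · exact h.mem_own (Or.inr hx.1)
  · intro x γ hx
    by_cases hxK : a.base x ∈ K
    · rw [contract_base_pos hM h c hxK]
      change L ∈ a.own γ
      rw [h.own_disj hx (own_of_base h (c.K_own hM h hxK))]
      exact c.K_own hM h hLK
    · rw [contract_base_neg hM h c hxK]
      exact h.own_base hx
  · intro γ w hw
    by_cases hγ : γ = α
    · subst hγ
      simp only [contract, if_true, Option.some.injEq] at hw
      exact hw ▸ c.K_own hM h hLK
    · simp only [contract, if_neg hγ] at hw
      exact h.wk_own hw
  · intro γ w hw
    by_cases hγ : γ = α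
    · subst hγ
      simp only [contract, if_true, Option.some.injEq] at hw
      exact Or.inl (hw ▸ hLo)
    · simp only [contract, if_neg hγ] at hw
      exact Or.inl (h.wk_out hw)
  · intro γ w hw
    by_cases hγ : γ = α
    · subst hγ
      simp only [contract, if_true, Option.some.injEq] at hw
      rw [← hw]
      exact contract_base_pos hM h c (by rwa [hLb])
    · simp only [contract, if_neg hγ] at hw
      have hwK : a.base w ∉ K := by
        rw [h.wk_base hw]
        intro h'
        exact hγ (h.own_disj (h.wk_own hw) (c.K_own hM h h'))
      rw [contract_base_neg hM h c hwK]
      exact h.wk_base hw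

theorem contract_child_imp {p x : V} (hp : (a.contract M α L K).Child M p x) :
    a.Anc M p x := by
  obtain ⟨h1, ⟨h2, h3, rfl⟩ | ⟨h2, rfl⟩⟩ := hp
  · by_cases hxK : a.base x ∈ K
    · rw [contract_base_pos hM h c hxK] at h1
      subst h1
      exact Relation.ReflTransGen.single ⟨c.L_base hM h, Or.inl ⟨c.L_out hM h, h3, rfl⟩⟩
    · rw [contract_base_neg hM h c hxK] at h1
      exact Relation.ReflTransGen.single ⟨h1, Or.inl ⟨h2.resolve_right hxK, h3, rfl⟩⟩
  · have h4 := child_par h h2.1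
    change a.Anc M ((a.contract M α L K).base (a.par x)) x
    by_cases hxK : a.base (a.par x) ∈ K
    · rw [contract_base_pos hM h c hxK]
      exact hxK.1.tail h4
    · rw [contract_base_neg hM h c hxK]
      exact Relation.ReflTransGen.single h4

theorem contract_anc_imp {b x : V} (hb : (a.contract M α L K).Anc M b x) : a.Anc M b x := by
  induction hb with
  | refl => exact Relation.ReflTransGen.refl
  | tail _ hp ih => exact ih.trans (contract_child_imp hM h c hp)

/-- Contraction maps the forest to the new one: a step inside the cycle becomes trivial, and any
other step remains a parent step between the images. -/
theorem contract_anc_base {b x : V} (hb : a.Anc M b x) :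
    (a.contract M α L K).Anc M ((a.contract M α L K).base b)
      ((a.contract M α L K).base x) := by
  induction hb with
  | refl => exact Relation.ReflTransGen.refl
  | @tail p x hbp hp ih =>
    have hpb := hp.base_left h
    have hxb := hp.1
    by_cases hxK : x ∈ K
    · by_cases hxL : x = L
      · subst hxL
        have hpK : p ∉ a.cyc M x (a.base u) (a.base v) := by
          intro hpK
          have h1 := hp.rank_lt hM h
          rcases hpK.1.rank_lt hM h with h2 | h2
          · rw [h2] at h1; omega
          · omega
        rw [contract_base_neg hM h c (x := p) (by rwa [hpb]), hpb] at ih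
        rw [contract_base_pos hM h c (x := x) (by rwa [hxb])]
        refine ih.tail ⟨contract_base_pos hM h c (by rwa [hxb]), Or.inl ⟨?_, ?_⟩⟩
        · exact Or.inl (c.L_out hM h)
        · rcases hp.cases h with ⟨-, h1, h2, -⟩ | ⟨h1, -⟩
          · exact ⟨h1, h2⟩
          · exact absurd (c.L_out hM h) (h.inn_not h1)
      · have hpK := c.K_parent hM h hxK hxL hp
        rw [contract_base_pos hM h c (x := p) (by rwa [hpb])] at ih
        rwa [contract_base_pos hM h c (x := x) (by rwa [hxb])]
    · have hxK' : a.base x ∉ K := by rwa [hxb]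
      have hbx : (a.contract M α L K).base x = x := by
        rw [contract_base_neg hM h c hxK', hxb]
      rw [hbx]
      refine ih.tail ⟨hbx, ?_⟩
      rcases hp.cases h with ⟨h1, h2, h3, h4⟩ | ⟨h1, h2, h3⟩
      · refine Or.inl ⟨Or.inl h1, h2, ?_⟩
        rw [contract_base_neg hM h c, hpb, h3]
        rw [hpb]
        intro hpK
        have h5 := c.K_inn_mate hM h hpK h4
        rw [h3, hM.mate_mate] at h5
        exact hxK h5
      · refine Or.inr ⟨⟨h1, hxK⟩, ?_⟩
        change _ = (a.contract M α L K).base (a.par x)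
        by_cases h5 : a.base (a.par x) ∈ K
        · rw [contract_base_pos hM h c h5, contract_base_pos hM h c (by rwa [hpb, h2])]
        · rw [contract_base_neg hM h c h5, contract_base_neg hM h c (by rwa [hpb, h2]), hpb, h2]

theorem contract_wk_self : (a.contract M α L K).wk α = some L := if_pos rfl

theorem contract_wk_ne {γ : V} (hγ : γ ≠ α) : (a.contract M α L K).wk γ = a.wk γ := if_neg hγ

theorem contract_act_imp {b : V} (hb : b ∈ (a.contract M α L K).Act M) : b ∈ a.Act M := by
  obtain ⟨hbo, hbb, γ, w, hγ, hbw⟩ := hb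
  have h1 : b ∈ a.out ∧ a.base b = b := by
    by_cases hbK : a.base b ∈ K
    · rw [contract_base_pos hM h c hbK] at hbb
      subst hbb
      exact ⟨c.L_out hM h, c.L_base hM h⟩
    · rw [contract_base_neg hM h c hbK] at hbb
      exact ⟨hbo.resolve_right hbK, hbb⟩
  have h2 := contract_anc_imp hM h c hbw
  by_cases hγα : γ = α
  · subst hγα
    rw [contract_wk_self hM h c, Option.some.injEq] at hγ
    subst hγ
    exact ⟨h1.1, h1.2, γ, _, c.wk, h2.trans c.anc_u⟩
  · rw [contract_wk_ne hM h c hγα] at hγ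
    exact ⟨h1.1, h1.2, γ, w, hγ, h2⟩

theorem contract_act_of {b : V} (hb : b ∈ a.Act M) :
    (a.contract M α L K).base b ∈ (a.contract M α L K).Act M := by
  have hv := contract_valid hM h c
  obtain ⟨hbo, hbb, γ, w, hγ, hbw⟩ := hb
  have h1 := contract_anc_base hM h c hbw
  refine ⟨hv.base_out (Or.inl hbo), hv.base_base b, ?_⟩
  by_cases hγα : γ = α
  · subst hγα
    rw [c.wk, Option.some.injEq] at hγ
    subst hγ
    rw [contract_base_pos hM h c (x := a.base u)
      (by rw [h.base_base]; exact c.u_mem hM h)] at h1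
    exact ⟨γ, L, contract_wk_self hM h c, h1⟩
  · refine ⟨γ, w, by rw [contract_wk_ne hM h c hγα, hγ], ?_⟩
    have h2 : (a.contract M α L K).wk γ = some w := by rw [contract_wk_ne hM h c hγα, hγ]
    rwa [hv.wk_base h2] at h1

theorem contract_L_act : L ∈ (a.contract M α L K).Act M :=
  ⟨Or.inl (c.L_out hM h), contract_base_pos hM h c (by
    rw [c.L_base hM h]; exact c.L_mem hM h), α, L, contract_wk_self hM h c,
    Relation.ReflTransGen.refl⟩

variable [Fintype V]

/-- The cycle has an outer node other than `L`, and its inner partner is on the cycle too. The label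
of that matched arc was positive, as it exceeds the distance of the inner node's parent, and it
becomes zero. -/
theorem contract_phi : (a.contract M α L K).phi M + 1 ≤ a.phi M := by
  classical
  obtain ⟨z, hzK, hzi⟩ : ∃ z ∈ K, z ∈ a.inn := by
    have : ∃ z ∈ K, z ≠ L ∧ z ∈ a.out := by
      by_cases hu : a.base u = L
      · exact ⟨_, c.v_mem hM h, fun h' => c.ne (hu.trans h'.symm), h.base_out c.v_out⟩
      · exact ⟨_, c.u_mem hM h, hu, h.base_out c.u_out⟩
    obtain ⟨z, h1, h2, h3⟩ := this
    obtain ⟨h4, h5, -⟩ := c.K_out_mate hM h h1 h2 h3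
    exact ⟨_, h4, h5⟩
  refine Nat.succ_le_of_lt (Finset.sum_lt_sum (fun x _ => ?_) ⟨z, Finset.mem_univ z, ?_⟩)
  · split_ifs with hf
    · exact le_rfl
    · exact contract_lab_le hM h c _
  · have hf := h.inn_cov hzi
    rw [if_neg hf, if_neg hf]
    have h1 : (a.contract M α L K).lab (z, ScaledMatching.mate M z) = 0 := by
      refine if_pos ⟨mate_mem hf, ?_, ?_⟩
      · rwa [c.K_base hM h hzK]
      · rw [h.inn_mate_base hzi]
        exact c.K_inn_mate hM h hzK hzi
    rw [h1]
    exact (Nat.zero_le _).trans_lt (h.par_lt hzi)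

theorem contract_adv : a.Adv M (a.contract M α L K) := by
  have hphi := contract_phi hM h c
  have hv := contract_valid hM h c
  have hactive : (a.contract M α L K).active ⊆ a.active := by
    rintro γ ⟨w, hw⟩
    by_cases hγ : γ = α
    · exact ⟨_, hγ ▸ c.wk⟩
    · exact ⟨w, by rwa [contract_wk_ne hM h c hγ] at hw⟩
  refine
    { lab_le := contract_lab_le hM h c
      out := fun hu => Or.inl (Or.inl hu)
      removed := le_rfl
      base := ?_
      act := ?_
      modified := Set.subset_insert _ _
      onHold := rfl
      wk_eq := fun hγ => contract_wk_ne hM h c fun h' => hγ (Or.inl h')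
      own_eq := fun _ => rfl
      vert_eq := ?_
      new := ?_
      keep := ?_
      phi_le := by omega
      mod_le := ?_
      actN_le := ?_
      active := hactive }
  · intro x y _ _ _ _ he
    by_cases hx : a.base x ∈ K
    · rw [contract_base_pos hM h c hx, contract_base_pos hM h c (he ▸ hx)]
    · rw [contract_base_neg hM h c hx, contract_base_neg hM h c (he ▸ hx), he]
  · intro x hx hn
    have hxK : a.base x ∉ K := by
      intro hxK
      rw [contract_base_pos hM h c hxK] at hn
      exact hn (contract_L_act hM h c)
    refine ⟨hx.resolve_right hxK, fun h' => hn ?_, ?_⟩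
    · have := contract_act_of hM h c h'
      rw [contract_base_neg hM h c (by rwa [h.base_base]), h.base_base] at this
      rwa [contract_base_neg hM h c hxK]
    · rw [contract_base_neg hM h c hxK]
      exact contract_D_neg hM h c (by rwa [h.base_base])
  · intro γ x hγ hx
    have hxK : a.base x ∉ K := fun h' => hγ (Or.inl
      (h.own_disj (h.own_base hx) (c.K_own hM h h')))
    refine ⟨⟨fun h' => h'.resolve_right hxK, Or.inl⟩, contract_base_neg hM h c hxK, ?_⟩
    exact contract_D_neg hM h c (by rwa [h.base_base])
  · intro x hx hn
    refine ⟨α, Or.inl rfl, ?_⟩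
    rw [contract_wk_self hM h c, contract_base_pos hM h c (hx.resolve_left hn)]
  · intro x γ hx _ hγ hw
    by_cases hγα : γ = α
    · subst hγα
      rw [c.wk, Option.some.injEq] at hw
      refine ⟨γ, Or.inl rfl, ?_⟩
      rw [contract_wk_self hM h c, contract_base_pos hM h c]
      rw [← hw]; exact c.u_mem hM h
    · refine ⟨γ, Or.inr hγ, ?_⟩
      have h1 : (a.contract M α L K).wk γ = some (a.base x) := by
        rw [contract_wk_ne hM h c hγα, hw]
      have hxK : a.base x ∉ K := fun h' => hγα
        (h.own_disj (h.wk_own hw) (c.K_own hM h h'))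
      rw [h1, contract_base_neg hM h c hxK]
  · have h1 : (a.contract M α L K).modified ∩ (a.contract M α L K).active ⊆
        insert α (a.modified ∩ a.active) := by
      rintro γ ⟨h1 | h1, h2⟩
      · exact Or.inl h1
      · exact Or.inr ⟨h1, hactive h2⟩
    have h3 := (Set.ncard_le_ncard h1 (Set.toFinite _)).trans (Set.ncard_insert_le _ _)
    omega
  · have h1 : (a.contract M α L K).ActN M ⊆ a.ActN M := fun x hx =>
      ⟨contract_act_imp hM h c hx.1, hx.2⟩
    have h3 := Set.ncard_le_ncard h1 (Set.toFinite _)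
    omega

/-- A surviving node keeps its distance, and its new subtree is contained in its old one, because
the cycle already lay below `L`. -/
theorem contract_sized {H : ℕ} (hs : a.Sized M l H) : (a.contract M α L K).Sized M l H := by
  intro b hb hbb
  have h1 : (b ∈ a.out ∨ b ∈ a.inn) ∧ a.base b = b ∧ (a.contract M α L K).D M b = a.D M b := by
    by_cases hbK : a.base b ∈ K
    · rw [contract_base_pos hM h c hbK] at hbb
      subst hbb
      exact ⟨Or.inl (c.L_out hM h), c.L_base hM h, contract_D_L hM h c⟩
    · rw [contract_base_neg hM h c hbK] at hbb
      refine ⟨?_, hbb, contract_D_neg hM h c hbK⟩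
      rcases hb with hb | hb
      · exact Or.inl (hb.resolve_right hbK)
      · exact Or.inr hb.1
  rw [h1.2.2]
  refine (Set.ncard_le_ncard ?_ (Set.toFinite _)).trans (hs b h1.1 h1.2.1)
  intro x hx
  change a.Anc M b (a.base x)
  have h2 := contract_anc_imp hM h c hx
  by_cases hxK : a.base x ∈ K
  · rw [contract_base_pos hM h c hxK] at h2
    exact h2.trans hxK.1
  · rwa [contract_base_neg hM h c hxK] at h2

end Basic

end Contract

/-! ### Removing two structures -/

variable (a) in
open Classical in
/-- The effect of `Augment` on the description of a state. -/
noncomputable def remove (α β : V) : AState V where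
  base := fun x => if x ∈ a.own α ∪ a.own β then x else a.base x
  par := a.par
  out := a.out \ (a.own α ∪ a.own β)
  inn := a.inn \ (a.own α ∪ a.own β)
  own := fun γ => if γ = α ∨ γ = β then ∅ else a.own γ
  wk := fun γ => if γ = α ∨ γ = β then none else a.wk γ
  lab := a.lab
  removed := a.removed ∪ (a.own α ∪ a.own β)
  onHold := a.onHold
  modified := a.modified ∪ {α, β}

section Remove

variable {α β : V}

theorem remove_base_pos {x : V} (hx : x ∈ a.own α ∪ a.own β) : (a.remove α β).base x = x :=
  if_pos hx

theorem remove_base_neg {x : V} (hx : x ∉ a.own α ∪ a.own β) :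
    (a.remove α β).base x = a.base x := if_neg hx

theorem remove_D {y : V} (hy : y ∉ a.own α ∪ a.own β) :
    (a.remove α β).D M y = a.D M y := by
  have h1 : y ∈ (a.remove α β).out ↔ y ∈ a.out := ⟨fun h => h.1, fun h => ⟨h, hy⟩⟩
  by_cases ho : y ∈ a.out
  · rw [D, D, if_pos ho, if_pos (h1.2 ho)]
    rfl
  · rw [D, D, if_neg ho, if_neg (mt h1.1 ho)]
    rfl

theorem mem_remove_own {x γ : V} :
    x ∈ (a.remove α β).own γ ↔ x ∈ a.own γ ∧ γ ≠ α ∧ γ ≠ β := by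
  by_cases hγ : γ = α ∨ γ = β
  · simp only [remove, if_pos hγ, Set.mem_empty_iff_false, false_iff]
    tauto
  · simp only [remove, if_neg hγ]
    tauto

theorem remove_wk_eq_some {w γ : V} :
    (a.remove α β).wk γ = some w ↔ a.wk γ = some w ∧ γ ≠ α ∧ γ ≠ β := by
  by_cases hγ : γ = α ∨ γ = β
  · simp only [remove, if_pos hγ, reduceCtorEq, false_iff]
    tauto
  · simp only [remove, if_neg hγ]
    tauto

variable (hM : IsMatchingSet G M) (h : a.Valid M G l)
include hM h

theorem remove_own_not {x γ : V} (hx : x ∈ (a.remove α β).own γ) :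
    x ∈ a.own γ ∧ x ∉ a.own α ∪ a.own β := by
  rw [mem_remove_own] at hx
  refine ⟨hx.1, ?_⟩
  rintro (h1 | h1)
  · exact hx.2.1 (h.own_disj hx.1 h1)
  · exact hx.2.2 (h.own_disj hx.1 h1)

theorem remove_own_of {x γ : V} (hx : x ∈ a.own γ) (hn : x ∉ a.own α ∪ a.own β) :
    x ∈ (a.remove α β).own γ := by
  rw [mem_remove_own]
  refine ⟨hx, ?_, ?_⟩
  · rintro rfl; exact hn (Or.inl hx)
  · rintro rfl; exact hn (Or.inr hx)

theorem mem_union_base {x : V} :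
    a.base x ∈ a.own α ∪ a.own β ↔ x ∈ a.own α ∪ a.own β :=
  ⟨Or.imp (own_of_base h) (own_of_base h), Or.imp h.own_base h.own_base⟩

theorem mem_union_mate {x : V} :
    mate M x ∈ a.own α ∪ a.own β ↔ x ∈ a.own α ∪ a.own β := by
  refine ⟨Or.imp (own_of_mate hM h) (own_of_mate hM h), fun hx => ?_⟩
  by_cases hf : Free M x
  · rwa [mate_of_free hf]
  · exact hx.imp (fun h' => h.own_mate h' hf) (fun h' => h.own_mate h' hf)

theorem remove_base_base (x : V) : (a.remove α β).base (a.base x) = a.base x := by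
  by_cases hx : x ∈ a.own α ∪ a.own β
  · exact remove_base_pos ((mem_union_base hM h).2 hx)
  · rw [remove_base_neg (mt (mem_union_base hM h).1 hx), h.base_base]

theorem mem_union_par {x : V} (hx : x ∈ a.inn) :
    a.par x ∈ a.own α ∪ a.own β ↔ x ∈ a.own α ∪ a.own β := by
  obtain ⟨γ, hγ⟩ := h.mem_own (Or.inr hx)
  have h1 := h.own_par hx hγ
  refine ⟨Or.imp (fun h' => ?_) (fun h' => ?_), Or.imp (h.own_par hx) (h.own_par hx)⟩
  · rwa [h.own_disj h' h1]
  · rwa [h.own_disj h' h1]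

/-- The two removed structures together are closed under bases, partners and parents in both
directions, so no link between the rest and them exists. -/
theorem remove_valid : (a.remove α β).Valid M G l := by
  refine
    { base_base := ?_
      base_out := ?_
      base_not := ?_
      inn_not := fun hx h' => h.inn_not hx.1 h'.1
      inn_cov := fun hx => h.inn_cov hx.1
      inn_mate := fun hx => ⟨h.inn_mate hx.1, fun h' => hx.2 ((mem_union_mate hM h).1 h')⟩
      inn_mate_base := ?_
      out_free := ?_
      out_mate := ?_
      base_mate := ?_
      par_out := fun hx => ⟨h.par_out hx.1, fun h' => hx.2 ((mem_union_par hM h hx.1).1 h')⟩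
      par_adj := fun hx => h.par_adj hx.1
      par_lt := ?_
      lab_le := fun hx => h.lab_le hx.1
      lab_top := ?_
      own_disj := fun h1 h2 => h.own_disj (mem_remove_own.1 h1).1 (mem_remove_own.1 h2).1
      own_mem := ?_
      mem_own := ?_
      own_base := ?_
      own_mate := ?_
      own_par := ?_
      own_free := fun hx => h.own_free (mem_remove_own.1 hx).1
      own_root := ?_
      free_own := ?_
      removed_own := ?_
      removed_mate := ?_
      wk_own := ?_
      wk_out := ?_
      wk_base := ?_ }
  · intro x
    by_cases hx : x ∈ a.own α ∪ a.own β
    · rw [remove_base_pos hx, remove_base_pos hx]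
    · rw [remove_base_neg hx, remove_base_base hM h]
  · rintro x ⟨hx, hn⟩
    rw [remove_base_neg hn]
    exact ⟨h.base_out hx, mt (mem_union_base hM h).1 hn⟩
  · intro x hx
    by_cases hn : x ∈ a.own α ∪ a.own β
    · rw [remove_base_pos hn]
    · rw [remove_base_neg hn]
      exact h.base_not fun h' => hx ⟨h', hn⟩
  · rintro x ⟨hx, hn⟩
    rw [remove_base_neg (mt (mem_union_mate hM h).1 hn)]
    exact h.inn_mate_base hx
  · rintro x ⟨hx, hn⟩ hf
    rw [remove_base_neg hn]
    exact h.out_free hx hf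
  · rintro x ⟨hx, hn⟩ hf hb
    rw [remove_base_neg hn] at hb ⊢
    rw [remove_base_neg (mt (mem_union_mate hM h).1 hn)]
    exact h.out_mate hx hf hb
  · rintro x ⟨hx, hn⟩ hf hb
    rw [remove_base_neg hn] at hb
    exact ⟨h.base_mate hx hf hb, mt (mem_union_mate hM h).1 hn⟩
  · rintro x ⟨hx, hn⟩
    have h1 := mt (mem_union_par hM h hx).1 hn
    change (a.remove α β).D M ((a.remove α β).base (a.par x)) < a.lab (x, mate M x)
    rw [remove_base_neg h1, remove_D (mt (mem_union_base hM h).1 h1)]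
    exact h.par_lt hx
  · intro x hf hr hm
    have hn : x ∉ a.own α ∪ a.own β := fun h' => hr (Or.inr h')
    exact h.lab_top hf (fun h' => hr (Or.inl h'))
      fun h' => hm ⟨h', mt (mem_union_mate hM h).1 hn⟩
  · intro x γ hx
    obtain ⟨h1, h2⟩ := remove_own_not hM h hx
    exact (h.own_mem h1).imp (fun h' => ⟨h', h2⟩) (fun h' => ⟨h', h2⟩)
  · rintro x hx
    have h1 : (x ∈ a.out ∨ x ∈ a.inn) ∧ x ∉ a.own α ∪ a.own β := by
      rcases hx with hx | hx
      · exact ⟨Or.inl hx.1, hx.2⟩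
      · exact ⟨Or.inr hx.1, hx.2⟩
    obtain ⟨γ, hγ⟩ := h.mem_own h1.1
    exact ⟨γ, remove_own_of hM h hγ h1.2⟩
  · intro x γ hx
    obtain ⟨h1, h2⟩ := remove_own_not hM h hx
    rw [remove_base_neg h2]
    exact remove_own_of hM h (h.own_base h1) (mt (mem_union_base hM h).1 h2)
  · intro x γ hx hf
    obtain ⟨h1, h2⟩ := remove_own_not hM h hx
    exact remove_own_of hM h (h.own_mate h1 hf) (mt (mem_union_mate hM h).1 h2)
  · intro x γ hxi hx
    obtain ⟨h1, h2⟩ := remove_own_not hM h hx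
    exact remove_own_of hM h (h.own_par hxi.1 h1) (mt (mem_union_par hM h hxi.1).1 h2)
  · intro x γ hx
    rw [mem_remove_own] at hx ⊢
    have := h.own_root hx.1
    exact ⟨⟨this.1, hx.2⟩, this.2⟩
  · intro x hf hr
    exact remove_own_of hM h (h.free_own hf fun h' => hr (Or.inl h')) fun h' => hr (Or.inr h')
  · rintro x γ (hr | hr) hx
    · exact h.removed_own hr (mem_remove_own.1 hx).1
    · exact (remove_own_not hM h hx).2 hr
  · rintro x (hr | hr)
    · exact Or.inl (h.removed_mate hr)
    · exact Or.inr ((mem_union_mate hM h).2 hr)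
  · intro γ w hw
    rw [remove_wk_eq_some] at hw
    exact mem_remove_own.2 ⟨h.wk_own hw.1, hw.2⟩
  · intro γ w hw
    rw [remove_wk_eq_some] at hw
    exact ⟨h.wk_out hw.1,
      (remove_own_not hM h (mem_remove_own.2 ⟨h.wk_own hw.1, hw.2⟩)).2⟩
  · intro γ w hw
    rw [remove_wk_eq_some] at hw
    rw [remove_base_neg (remove_own_not hM h (mem_remove_own.2 ⟨h.wk_own hw.1, hw.2⟩)).2]
    exact h.wk_base hw.1

theorem remove_child_iff {p x : V} : (a.remove α β).Child M p x ↔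
    a.Child M p x ∧ x ∉ a.own α ∪ a.own β := by
  by_cases hx : x ∈ a.own α ∪ a.own β
  · refine ⟨?_, fun h' => absurd hx h'.2⟩
    rintro ⟨-, ⟨h1, -⟩ | ⟨h1, -⟩⟩
    · exact absurd hx h1.2
    · exact absurd hx h1.2
  · simp only [Child, remove_base_neg hx]
    have h1 : x ∈ a.inn → (a.remove α β).base (a.par x) = a.base (a.par x) := fun hi =>
      remove_base_neg (mt (mem_union_par hM h hi).1 hx)
    have h2 : x ∈ (a.remove α β).out ↔ x ∈ a.out := ⟨fun h => h.1, fun h => ⟨h, hx⟩⟩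
    have h3 : x ∈ (a.remove α β).inn ↔ x ∈ a.inn := ⟨fun h => h.1, fun h => ⟨h, hx⟩⟩
    have h4 : (a.remove α β).par = a.par := rfl
    rw [h2, h3, h4]
    constructor
    · rintro ⟨e1, e2 | ⟨e2, e3⟩⟩
      · exact ⟨⟨e1, Or.inl e2⟩, hx⟩
      · exact ⟨⟨e1, Or.inr ⟨e2, (h1 e2) ▸ e3⟩⟩, hx⟩
    · rintro ⟨⟨e1, e2 | ⟨e2, e3⟩⟩, -⟩
      · exact ⟨e1, Or.inl e2⟩
      · exact ⟨e1, Or.inr ⟨e2, (h1 e2).symm ▸ e3⟩⟩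

theorem remove_anc_imp {b x : V} (hb : (a.remove α β).Anc M b x) : a.Anc M b x := by
  induction hb with
  | refl => exact Relation.ReflTransGen.refl
  | tail _ hp ih => exact ih.tail ((remove_child_iff hM h).1 hp).1

theorem remove_anc_of {b x : V} (hb : a.Anc M b x) (hx : x ∉ a.own α ∪ a.own β) :
    (a.remove α β).Anc M b x := by
  induction hb with
  | refl => exact Relation.ReflTransGen.refl
  | @tail p x _ hp ih =>
    refine (ih fun h' => hx ?_).tail ((remove_child_iff hM h).2 ⟨hp, hx⟩)
    exact h'.imp (hp.own hM h).1 (hp.own hM h).1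

theorem remove_act_iff {b : V} : b ∈ (a.remove α β).Act M ↔
    b ∈ a.Act M ∧ b ∉ a.own α ∪ a.own β := by
  constructor
  · rintro ⟨hbo, hbb, γ, w, hγ, hbw⟩
    rw [remove_base_neg hbo.2] at hbb
    exact ⟨⟨hbo.1, hbb, γ, w, (remove_wk_eq_some.1 hγ).1, remove_anc_imp hM h hbw⟩, hbo.2⟩
  · rintro ⟨⟨hbo, hbb, γ, w, hγ, hbw⟩, hn⟩
    have hb' : b ∈ a.own γ := (hbw.own hM h).2 (h.wk_own hγ)
    refine ⟨⟨hbo, hn⟩, by rwa [remove_base_neg hn], γ, w, ?_, ?_⟩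
    · rw [remove_wk_eq_some]
      exact ⟨hγ, (mem_remove_own.1 (remove_own_of hM h hb' hn)).2⟩
    · refine remove_anc_of hM h hbw fun h' => hn ?_
      exact h'.imp (hbw.own hM h).2 (hbw.own hM h).2

variable [Fintype V]

/-- Labels do not change, and none need pay: the marked structures `α` and `β` are no longer active.
-/
theorem remove_adv : a.Adv M (a.remove α β) := by
  have hphi : (a.remove α β).phi M = a.phi M := rfl
  have hactive : (a.remove α β).active ⊆ a.active := fun γ hγ =>
    hγ.imp fun w hw => (remove_wk_eq_some.1 hw).1
  have hmod : ∀ {γ}, γ ∉ (a.remove α β).modified → ¬ (γ = α ∨ γ = β) := fun hγ h' =>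
    hγ (Or.inr h')
  refine
    { lab_le := fun _ => le_rfl
      out := ?_
      removed := Set.subset_union_left
      base := ?_
      act := ?_
      modified := Set.subset_union_left
      onHold := rfl
      wk_eq := fun hγ => if_neg (hmod hγ)
      own_eq := fun hγ => if_neg (hmod hγ)
      vert_eq := ?_
      new := fun h1 h2 => absurd h1.1 h2
      keep := ?_
      phi_le := hphi.le
      mod_le := ?_
      actN_le := ?_
      active := hactive }
  · intro x hx
    by_cases hn : x ∈ a.own α ∪ a.own β
    · exact Or.inr (Or.inr hn)
    · exact Or.inl ⟨hx, hn⟩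
  · intro x y _ _ hx hy he
    rwa [remove_base_neg hx.2, remove_base_neg hy.2]
  · intro x hx hn
    rw [remove_base_neg hx.2] at hn ⊢
    have h1 := mt (mem_union_base hM h).1 hx.2
    exact ⟨hx.1, fun h' => hn ((remove_act_iff hM h).2 ⟨h', h1⟩), remove_D h1⟩
  · intro γ x hγ hx
    have h1 : x ∉ a.own α ∪ a.own β := by
      rintro (h1 | h1)
      · exact hmod hγ (Or.inl (h.own_disj hx h1))
      · exact hmod hγ (Or.inr (h.own_disj hx h1))
    exact ⟨⟨fun h' => h'.1, fun h' => ⟨h', h1⟩⟩, remove_base_neg h1,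
      remove_D (mt (mem_union_base hM h).1 h1)⟩
  · intro x γ _ hx hγ hw
    refine ⟨γ, Or.inl hγ, ?_⟩
    rw [remove_base_neg hx.2, remove_wk_eq_some]
    exact ⟨hw, (mem_remove_own.1 (remove_own_of hM h (h.wk_own hw)
      (mt (mem_union_base hM h).1 hx.2))).2⟩
  · have h1 : (a.remove α β).modified ∩ (a.remove α β).active ⊆ a.modified ∩ a.active := by
      rintro γ ⟨h1, w, hw⟩
      rw [remove_wk_eq_some] at hw
      rcases h1 with h1 | h1
      · exact ⟨h1, w, hw.1⟩
      · exact absurd h1 (fun h' => h'.elim hw.2.1 hw.2.2)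
    have h3 := Set.ncard_le_ncard h1 (Set.toFinite _)
    omega
  · have h1 : (a.remove α β).ActN M ⊆ a.ActN M := fun x hx =>
      ⟨((remove_act_iff hM h).1 hx.1).1, hx.2⟩
    have h3 := Set.ncard_le_ncard h1 (Set.toFinite _)
    omega

theorem remove_sized {H : ℕ} (hs : a.Sized M l H) : (a.remove α β).Sized M l H := by
  intro b hb hbb
  have h1 : (b ∈ a.out ∨ b ∈ a.inn) ∧ b ∉ a.own α ∪ a.own β := by
    rcases hb with hb | hb
    · exact ⟨Or.inl hb.1, hb.2⟩
    · exact ⟨Or.inr hb.1, hb.2⟩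
  rw [remove_base_neg h1.2] at hbb
  rw [remove_D h1.2]
  refine (Set.ncard_le_ncard ?_ (Set.toFinite _)).trans (hs b h1.1 hbb)
  intro x hx
  have h2 := remove_anc_imp hM h hx
  by_cases hxn : x ∈ a.own α ∪ a.own β
  · rw [remove_base_pos hxn] at h2
    exact absurd (hxn.imp (h2.own hM h).2 (h2.own hM h).2) h1.2
  · rwa [remove_base_neg hxn] at h2

end Remove

end AState

end ScaledMatching

namespace ScaledMatching

variable {V : Type*}

/-! ### Even alternating paths -/

/-- There is an alternating path of even length from `b` to `x` that starts with an unmatched edge,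
uses only edges in `F` and visits only vertices in `S`. -/
def EvenPath (G : SimpleGraph V) (M F : Set (Sym2 V)) (S : Set V) (b x : V) : Prop :=
  ∃ p : G.Walk b x, p.IsPath ∧ AltWalk M false p ∧ p.length % 2 = 0 ∧
    (∀ e ∈ p.edges, e ∈ F) ∧ ∀ y ∈ p.support, y ∈ S

section EvenPath

variable {G : SimpleGraph V} {M F F' : Set (Sym2 V)} {S S' : Set V}

theorem EvenPath.mono {b x : V} (h : EvenPath G M F S b x) (hF : F ⊆ F') (hS : S ⊆ S') :
    EvenPath G M F' S' b x := by
  obtain ⟨p, h1, h2, h3, h4, h5⟩ := h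
  exact ⟨p, h1, h2, h3, fun e he => hF (h4 e he), fun y hy => hS (h5 y hy)⟩

theorem isPath_append {u v w : V} {p : G.Walk u v} {q : G.Walk v w} (hp : p.IsPath)
    (hq : q.IsPath) (h : ∀ y ∈ p.support, y ∉ q.support.tail) : (p.append q).IsPath := by
  rw [SimpleGraph.Walk.isPath_def, SimpleGraph.Walk.support_append, List.nodup_append]
  refine ⟨hp.support_nodup, hq.support_nodup.tail, ?_⟩
  intro y hy z hz hyz
  exact h y hy (hyz ▸ hz)

/-- An even path can be prolonged by an unmatched edge, a matched edge and another even path. -/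
theorem EvenPath.extend {b p m c x : V} (h : EvenPath G M F S b p) (h' : EvenPath G M F' S' c x)
    (hpm : G.Adj p m) (hmc : G.Adj m c) (h1 : s(p, m) ∉ M) (h2 : s(m, c) ∈ M) (hmS : m ∉ S)
    (hmS' : m ∉ S') (hd : Disjoint S S') :
    EvenPath G M (F ∪ F' ∪ {s(p, m), s(m, c)}) (insert m (S ∪ S')) b x := by
  obtain ⟨P, hP1, hP2, hP3, hP4, hP5⟩ := h
  obtain ⟨Q, hQ1, hQ2, hQ3, hQ4, hQ5⟩ := h'
  have hQ' : (SimpleGraph.Walk.cons hpm (.cons hmc Q)).IsPath := by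
    rw [SimpleGraph.Walk.cons_isPath_iff, SimpleGraph.Walk.cons_isPath_iff]
    refine ⟨⟨hQ1, fun h => hmS' (hQ5 _ h)⟩, ?_⟩
    rw [SimpleGraph.Walk.support_cons, List.mem_cons, not_or]
    exact ⟨hpm.ne, fun h => Set.disjoint_left.1 hd (hP5 _ P.end_mem_support) (hQ5 _ h)⟩
  refine ⟨P.append (.cons hpm (.cons hmc Q)), isPath_append hP1 hQ' ?_, ?_, ?_, ?_, ?_⟩
  · intro y hy hy'
    rw [SimpleGraph.Walk.support_cons, List.tail_cons, SimpleGraph.Walk.support_cons,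
      List.mem_cons] at hy'
    rcases hy' with rfl | hy'
    · exact hmS (hP5 _ hy)
    · exact Set.disjoint_left.1 hd (hP5 _ hy) (hQ5 _ hy')
  · refine altWalk_append _ _ hP2 ?_
    simp only [hP3]
    exact ⟨by simpa using h1, by simpa using h2, by simpa using hQ2⟩
  · rw [SimpleGraph.Walk.length_append, SimpleGraph.Walk.length_cons,
      SimpleGraph.Walk.length_cons]
    omega
  · intro e he
    rw [SimpleGraph.Walk.edges_append, List.mem_append, SimpleGraph.Walk.edges_cons,
      SimpleGraph.Walk.edges_cons, List.mem_cons, List.mem_cons] at he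
    rcases he with he | he | he | he
    · exact Or.inl (Or.inl (hP4 e he))
    · exact Or.inr (Or.inl he)
    · exact Or.inr (Or.inr he)
    · exact Or.inl (Or.inr (hQ4 e he))
  · intro y hy
    rw [SimpleGraph.Walk.mem_support_append_iff, SimpleGraph.Walk.support_cons,
      SimpleGraph.Walk.support_cons, List.mem_cons, List.mem_cons] at hy
    rcases hy with hy | rfl | rfl | hy
    · exact Or.inr (Or.inl (hP5 y hy))
    · exact Or.inr (Or.inl (hP5 _ P.end_mem_support))
    · exact Or.inl rfl
    · exact Or.inr (Or.inr (hQ5 y hy))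

/-- Two disjoint even paths whose ends are joined by an unmatched edge form an alternating path of
odd length. -/
theorem EvenPath.join {b c u v : V} (h : EvenPath G M F S b u) (h' : EvenPath G M F' S' c v)
    (huv : G.Adj u v) (h1 : s(u, v) ∉ M) (hd : Disjoint S S') :
    ∃ p : G.Walk b c, p.IsPath ∧ AltWalk M false p ∧ p.length % 2 = 1 ∧
      (∀ e ∈ p.edges, e = s(u, v) ∨ e ∈ F ∨ e ∈ F') ∧ ∀ y ∈ p.support, y ∈ S ∪ S' := by
  obtain ⟨P, hP1, hP2, hP3, hP4, hP5⟩ := h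
  obtain ⟨Q, hQ1, hQ2, hQ3, hQ4, hQ5⟩ := h'
  have hQr := altWalk_reverse Q hQ2
  rw [hQ3] at hQr
  have hu : u ∉ Q.support := fun h =>
    Set.disjoint_left.1 hd (hP5 _ P.end_mem_support) (hQ5 _ h)
  have hQ' : (SimpleGraph.Walk.cons huv Q.reverse).IsPath := by
    rw [SimpleGraph.Walk.cons_isPath_iff]
    refine ⟨hQ1.reverse, ?_⟩
    simpa using hu
  refine ⟨P.append (.cons huv Q.reverse), isPath_append hP1 hQ' ?_, ?_, ?_, ?_, ?_⟩
  · intro y hy hy'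
    rw [SimpleGraph.Walk.support_cons, List.tail_cons, SimpleGraph.Walk.support_reverse,
      List.mem_reverse] at hy'
    exact Set.disjoint_left.1 hd (hP5 _ hy) (hQ5 _ hy')
  · refine altWalk_append _ _ hP2 ?_
    simp only [hP3]
    exact ⟨by simpa using h1, by simpa using hQr⟩
  · rw [SimpleGraph.Walk.length_append, SimpleGraph.Walk.length_cons,
      SimpleGraph.Walk.length_reverse]
    omega
  · intro e he
    rw [SimpleGraph.Walk.edges_append, List.mem_append, SimpleGraph.Walk.edges_cons,
      List.mem_cons, SimpleGraph.Walk.edges_reverse, List.mem_reverse] at he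
    rcases he with he | he | he
    · exact Or.inr (Or.inl (hP4 e he))
    · exact Or.inl he
    · exact Or.inr (Or.inr (hQ4 e he))
  · intro y hy
    rw [SimpleGraph.Walk.mem_support_append_iff, SimpleGraph.Walk.support_cons,
      List.mem_cons, SimpleGraph.Walk.support_reverse, List.mem_reverse] at hy
    rcases hy with hy | rfl | hy
    · exact Or.inl (hP5 y hy)
    · exact Or.inl (hP5 _ P.end_mem_support)
    · exact Or.inr (hQ5 y hy)

/-- The even path around an odd cycle to a vertex whose partner lies on the other side. -/
theorem EvenPath.detour {b c u v x : V} (h : EvenPath G M F S b u) (h' : EvenPath G M F' S' c v)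
    (huv : G.Adj u v) (h1 : s(u, v) ∉ M) (hcx : G.Adj c x) (h2 : s(c, x) ∈ M) (hxS : x ∉ S)
    (hxS' : x ∉ S') (hd : Disjoint S S') :
    EvenPath G M (F ∪ F' ∪ {s(u, v), s(c, x)}) (insert x (S ∪ S')) b x := by
  obtain ⟨p, hp1, hp2, hp3, hp4, hp5⟩ := h.join h' huv h1 hd
  refine ⟨p.append (.cons hcx .nil), isPath_append hp1 ?_ ?_, ?_, ?_, ?_, ?_⟩
  · simp [hcx.ne]
  · intro y hy hy'
    simp only [SimpleGraph.Walk.support_cons, SimpleGraph.Walk.support_nil, List.tail_cons,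
      List.mem_singleton] at hy'
    subst hy'
    exact (hp5 _ hy).elim hxS hxS'
  · refine altWalk_append _ _ hp2 ?_
    simp only [hp3]
    exact ⟨by simpa using h2, trivial⟩
  · rw [SimpleGraph.Walk.length_append, SimpleGraph.Walk.length_cons,
      SimpleGraph.Walk.length_nil]
    omega
  · intro e he
    rw [SimpleGraph.Walk.edges_append, List.mem_append, SimpleGraph.Walk.edges_cons,
      SimpleGraph.Walk.edges_nil, List.mem_singleton] at he
    rcases he with he | he
    · rcases hp4 e he with h' | h' | h'
      · exact Or.inr (Or.inl h')
      · exact Or.inl (Or.inl h')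
      · exact Or.inl (Or.inr h')
    · exact Or.inr (Or.inr he)
  · intro y hy
    rw [SimpleGraph.Walk.mem_support_append_iff, SimpleGraph.Walk.support_cons,
      SimpleGraph.Walk.support_nil, List.mem_cons, List.mem_singleton] at hy
    rcases hy with hy | rfl | rfl
    · exact Or.inr (hp5 y hy)
    · exact Or.inr (hp5 _ p.end_mem_support)
    · exact Or.inl rfl

theorem EvenPath.single {v : V} (hv : v ∈ S) : EvenPath G M F S v v :=
  ⟨.nil, by simp, trivial, by simp, by simp, by simpa using hv⟩

end EvenPath

/-! ### States and their descriptions -/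

/-- The description `a` represents the state `st`. -/
structure Rep (G : SimpleGraph V) (M : Set (Sym2 V)) (st : State V) (a : AState V) : Prop where
  verts : ∀ α, (st.struc α).verts = a.own α
  label : st.label = a.lab
  removed : st.removed = a.removed
  onHold : st.onHold = a.onHold
  modified : st.modified = a.modified
  work : ∀ α, (st.struc α).work = (a.wk α).map fun w => {x | a.base x = a.base w}
  -- Arcs inside a root blossom are left undetermined: structures keep the arcs absorbed by
  -- contractions, and the trees do not see them.
  arcs : ∀ α x y, a.base x ≠ a.base y → ((x, y) ∈ (st.struc α).arcs ↔
    x ∈ a.own α ∧ y ∈ a.own α ∧ ((y ∈ a.inn ∧ x = a.par y) ∨ (x ∈ a.inn ∧ y = mate M x)))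
  arc_own : ∀ {α x y}, (x, y) ∈ (st.struc α).arcs → x ∈ a.own α ∧ y ∈ a.own α ∧ G.Adj x y
  blossom_own : ∀ {α B x}, B ∈ (st.struc α).blossoms → x ∈ B.verts → x ∈ a.own α
  blossom_base : ∀ {α B x y}, B ∈ (st.struc α).blossoms → x ∈ B.verts → y ∈ B.verts →
    a.base x = a.base y
  blossom_edges : ∀ {α B e x}, B ∈ (st.struc α).blossoms → e ∈ B.edges → x ∈ e → x ∈ B.verts
  blossom_out : ∀ {α x}, x ∈ a.own α → x ∈ a.out → ∃ B ∈ (st.struc α).blossoms,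
    B.verts = {y | a.base y = a.base x} ∧
      ∀ y ∈ B.verts, EvenPath G M B.edges B.verts (a.base x) y

/-! ### Trees, distances and paths read off from the description -/

namespace Rep

open AState

variable {G : SimpleGraph V} {M : Set (Sym2 V)} {st : State V} {a : AState V} {l : ℕ}
variable (hM : IsMatchingSet G M) (h : a.Valid M G l) (r : Rep G M st a)
include hM h r

/-- Every blossom lies in one class of equal bases. The class of an outer vertex is itself a
blossom, and any other vertex is alone in its class. -/
theorem root (v : V) : st.root v = {x | a.base x = a.base v} := by
  ext x
  constructor
  · rintro ⟨B, ⟨α, hB⟩ | ⟨w, rfl⟩, hv, hx⟩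
    · exact r.blossom_base hB hx hv
    · have hv' : v = w := hv
      have hx' : x = w := hx
      rw [hv', hx']; rfl
  · intro hx
    change a.base x = a.base v at hx
    by_cases hv : v ∈ a.out
    · obtain ⟨α, hα⟩ := h.mem_own (Or.inl hv)
      obtain ⟨B, hB, hBv, -⟩ := r.blossom_out hα hv
      exact ⟨B, Or.inl ⟨α, hB⟩, by rw [hBv]; rfl, by rw [hBv]; exact hx⟩
    · have hx' : x ∉ a.out := fun ho => hv (base_mem_out h (hx ▸ h.base_out ho))
      rw [h.base_not hv, h.base_not hx'] at hx
      subst hx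
      exact ⟨Blossom.triv x, Or.inr ⟨x, rfl⟩, rfl, rfl⟩

theorem root_eq_iff {x y : V} : st.root x = st.root y ↔ a.base x = a.base y := by
  rw [r.root hM h, r.root hM h]
  constructor
  · intro hxy
    have : x ∈ {z | a.base z = a.base x} := rfl
    rw [hxy] at this
    exact this
  · intro hxy; rw [hxy]

theorem root_base (x : V) : st.root (a.base x) = st.root x :=
  (r.root_eq_iff hM h).2 (h.base_base x)

theorem work_iff {α u : V} :
    (st.struc α).work = some (st.root u) ↔ a.wk α = some (a.base u) := by
  rw [r.work, Option.map_eq_some_iff]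
  constructor
  · rintro ⟨w, h1, h2⟩
    rw [← r.root hM h, r.root_eq_iff hM h, h.wk_base h1] at h2
    rw [h1, h2]
  · intro h1
    exact ⟨_, h1, by rw [← r.root hM h, r.root_base hM h]⟩

theorem parent_iff {α : V} {X Y : Set V} : st.Parent α X Y ↔
    ∃ p c, a.Child M p c ∧ c ∈ a.own α ∧ X = st.root p ∧ Y = st.root c := by
  constructor
  · rintro ⟨hne, x, y, hxy, rfl, rfl⟩
    have hne' := mt (r.root_eq_iff hM h).2 hne
    rw [r.arcs α x y hne'] at hxy
    obtain ⟨hx, hy, ⟨h1, rfl⟩ | ⟨h1, rfl⟩⟩ := hxy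
    · exact ⟨_, y, child_par h h1, hy, (r.root_base hM h _).symm, rfl⟩
    · exact ⟨x, _, child_mate hM h h1, hy, rfl, rfl⟩
  · rintro ⟨p, c, hpc, hc, rfl, rfl⟩
    have hp := (hpc.own hM h).2 hc
    rcases hpc.cases h with ⟨h1, h2, rfl, h3⟩ | ⟨h1, rfl, h2⟩
    · have hne : a.base (mate M c) ≠ a.base c := by
        rw [hpc.base_left h, hpc.1]
        intro h4
        rw [h4] at h3
        exact h.inn_not h3 h1
      refine ⟨mt (r.root_eq_iff hM h).1 hne, mate M c, c, ?_, rfl, rfl⟩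
      rw [r.arcs α _ _ hne]
      exact ⟨hp, hc, Or.inr ⟨h3, (hM.mate_mate c).symm⟩⟩
    · have hne : a.base (a.par c) ≠ a.base c := by
        rw [hpc.1]
        intro h4
        exact h.inn_not h1 (h4 ▸ h2)
      rw [r.root_base hM h]
      refine ⟨mt (r.root_eq_iff hM h).1 hne, a.par c, c, ?_, rfl, rfl⟩
      rw [r.arcs α _ _ hne]
      exact ⟨h.own_par h1 hc, hc, Or.inl ⟨h1, rfl⟩⟩

theorem parent_root_iff {α c : V} {X : Set V} (hc : c ∈ a.own α) (hb : a.base c = c) :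
    st.Parent α X (st.root c) ↔ ∃ p, a.Child M p c ∧ X = st.root p := by
  rw [r.parent_iff hM h]
  constructor
  · rintro ⟨p, d, hpd, -, hX, hd⟩
    rw [r.root_eq_iff hM h, hb, hpd.1] at hd
    exact ⟨p, hd ▸ hpd, hX⟩
  · rintro ⟨p, hpc, hX⟩
    exact ⟨p, c, hpc, hc, hX, rfl⟩

theorem ancestor_root_iff {α y : V} {X : Set V} (hy : y ∈ a.own α) :
    st.Ancestor α X (st.root y) ↔ ∃ z, a.Anc M z (a.base y) ∧ X = st.root z := by
  constructor
  · intro hXY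
    have key : ∀ Y, st.Ancestor α X Y → ∀ y ∈ a.own α, a.base y = y → Y = st.root y →
        ∃ z, a.Anc M z y ∧ X = st.root z := by
      intro Y hXY
      induction hXY with
      | refl => intro y _ _ hY; exact ⟨y, Relation.ReflTransGen.refl, hY⟩
      | tail _ hp ih =>
        rintro y hy hb rfl
        rw [r.parent_root_iff hM h hy hb] at hp
        obtain ⟨p, hpy, rfl⟩ := hp
        obtain ⟨z, hz, hX⟩ := ih p ((hpy.own hM h).2 hy) (hpy.base_left h) rfl
        exact ⟨z, hz.tail hpy, hX⟩
    exact key _ hXY (a.base y) (h.own_base hy) (h.base_base y) (r.root_base hM h y).symm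
  · rintro ⟨z, hz, rfl⟩
    have key : ∀ y, a.Anc M z y → y ∈ a.own α → st.Ancestor α (st.root z) (st.root y) := by
      intro y hzy
      induction hzy with
      | refl => intro _; exact Relation.ReflTransGen.refl
      | @tail p c _ hp ih =>
        intro hc
        exact Relation.ReflTransGen.tail (ih ((hp.own hM h).2 hc))
          ((r.parent_iff hM h).2 ⟨p, c, hp, hc, rfl, rfl⟩)
    rw [← r.root_base hM h y]
    exact key _ hz (h.own_base hy)

theorem ancestor_iff {α x y : V} (hy : y ∈ a.own α) :
    st.Ancestor α (st.root x) (st.root y) ↔ a.Anc M (a.base x) (a.base y) := by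
  rw [r.ancestor_root_iff hM h hy]
  constructor
  · rintro ⟨z, hz, hx⟩
    rw [r.root_eq_iff hM h, hz.base_left h (h.base_base y)] at hx
    rwa [hx]
  · intro hx
    exact ⟨_, hx, (r.root_base hM h x).symm⟩

/-- Outer and inner nodes alternate along tree paths, so two steps down from an outer node lead to
an outer node. Conversely, two steps up from an outer node that is not free lower the rank. -/
theorem outer_iff {α x : V} : st.Outer α (st.root x) ↔ x ∈ a.own α ∧ x ∈ a.out := by
  constructor
  · rintro ⟨hα, hx⟩
    rw [r.verts] at hα
    have hf := (h.own_root hα).2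
    have hαo : α ∈ a.out := (h.own_mem hα).resolve_right fun hi => h.inn_cov hi hf
    have key : ∀ Y, Relation.ReflTransGen (fun A C => ∃ B, st.Parent α A B ∧ st.Parent α B C)
        (st.root α) Y → ∃ b, b ∈ a.own α ∧ b ∈ a.out ∧ a.base b = b ∧ Y = st.root b := by
      intro Y hY
      induction hY with
      | refl => exact ⟨α, hα, hαo, h.out_free hαo hf, rfl⟩
      | tail _ hp ih =>
        obtain ⟨b, hb, hbo, hbb, rfl⟩ := ih
        obtain ⟨Z, hZ1, hZ2⟩ := hp
        rw [r.parent_iff hM h] at hZ1 hZ2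
        obtain ⟨p, c, hpc, hc, h1, rfl⟩ := hZ1
        obtain ⟨q, d, hqd, hd, h2, rfl⟩ := hZ2
        rw [r.root_eq_iff hM h, hbb, hpc.base_left h] at h1
        rw [r.root_eq_iff hM h, hpc.1, hqd.base_left h] at h2
        subst h1 h2
        have hci : c ∈ a.inn := by
          rcases hpc.cases h with ⟨-, -, -, h3⟩ | ⟨h3, -⟩
          · exact absurd hbo (h.inn_not h3)
          · exact h3
        rcases hqd.cases h with ⟨h3, -⟩ | ⟨-, -, h3⟩
        · exact ⟨d, hd, h3, hqd.1, rfl⟩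
        · exact absurd h3 (h.inn_not hci)
    obtain ⟨b, hb, hbo, hbb, hxb⟩ := key _ hx
    rw [r.root_eq_iff hM h, hbb] at hxb
    exact ⟨own_of_base h (hxb.symm ▸ hb), base_mem_out h (hxb.symm ▸ hbo)⟩
  · rintro ⟨hx, hxo⟩
    have hα := h.own_root hx
    refine ⟨by rw [r.verts]; exact hα.1, ?_⟩
    have key : ∀ n, ∀ b, a.rank M b ≤ n → b ∈ a.own α → b ∈ a.out → a.base b = b →
        Relation.ReflTransGen (fun A C => ∃ B, st.Parent α A B ∧ st.Parent α B C)
        (st.root α) (st.root b) := by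
      intro n
      induction n using Nat.strong_induction_on with
      | _ n ih =>
        intro b hn hb hbo hbb
        by_cases hf : Free M b
        · rw [h.own_free hb hf]
        · have hm := h.base_mate hbo hf hbb
          have h1 := child_mate hM h hm
          rw [hM.mate_mate] at h1
          have h2 := child_par h hm
          have hmo := (h1.own hM h).2 hb
          have hpo := (h2.own hM h).2 hmo
          have h3 := h1.rank_lt hM h
          have h4 := h2.rank_lt hM h
          refine Relation.ReflTransGen.tail (ih (a.rank M (a.base (a.par (mate M b)))) (by omega)
            _ le_rfl hpo (h.base_out (h.par_out hm)) (h.base_base _))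
            ⟨st.root (mate M b), ?_, ?_⟩
          · exact (r.parent_iff hM h).2 ⟨_, _, h2, hmo, rfl, rfl⟩
          · exact (r.parent_iff hM h).2 ⟨_, _, h1, hb, rfl, rfl⟩
    rw [← r.root_base hM h x]
    exact key _ _ le_rfl (h.own_base hx) (h.base_out hxo) (h.base_base x)

/-- A matched edge that leaves an outer blossom can only do so at the base, so the entering matched
arc is unique. -/
theorem distance_iff {u : V} {d : ℕ} (hu : u ∈ a.out) :
    st.Distance M u d ↔ d = a.D M (a.base u) := by
  have hbo := h.base_out hu
  have hfree : (∃ γ ∈ st.root u, Free M γ) ↔ Free M (a.base u) := by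
    rw [r.root hM h]
    constructor
    · rintro ⟨γ, hγ, hf⟩
      have hγ' : a.base γ = a.base u := hγ
      have hγo : γ ∈ a.out := base_mem_out h (hγ'.symm ▸ hbo)
      rwa [← hγ', h.out_free hγo hf]
    · intro hf
      exact ⟨_, h.base_base u, hf⟩
  unfold State.Distance
  rw [hfree]
  by_cases hf : Free M (a.base u)
  · rw [D_free hbo hf]
    simp [hf]
  · rw [D_out hbo hf]
    simp only [hf, false_and, not_false_eq_true, true_and, false_or]
    constructor
    · rintro ⟨x, y, hxy, h1, h2, rfl⟩
      rw [ne_eq, r.root_eq_iff hM h] at h1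
      rw [r.root_eq_iff hM h] at h2
      have hyo : y ∈ a.out := base_mem_out h (h2.symm ▸ hbo)
      have hmy := hM.mate_eq' hxy
      have hyb : a.base y = y := by
        by_contra hne
        have := h.out_mate hyo (not_free_right hxy) hne
        rw [hmy, h2] at this
        exact h1 this
      rw [← h2, hyb, hmy, r.label]
    · rintro rfl
      refine ⟨mate M (a.base u), a.base u, ?_, ?_, r.root_base hM h u, by rw [r.label]⟩
      · rw [Sym2.eq_swap]; exact mate_mem hf
      · rw [ne_eq, r.root_eq_iff hM h]
        have h1 := h.base_mate hbo hf (h.base_base u)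
        rw [h.base_not (h.inn_not h1)]
        intro h2
        rw [h2] at h1
        exact h.inn_not h1 hbo

theorem not_matched_of_out {u v : V} (hu : u ∈ a.out) (hv : v ∈ a.out)
    (hne : a.base u ≠ a.base v) : s(u, v) ∉ M := by
  intro huv
  have hm := hM.mate_eq huv
  have hf := not_free_left huv
  by_cases hb : a.base u = u
  · have := h.base_mate hu hf hb
    rw [hm] at this
    exact h.inn_not this hv
  · have := h.out_mate hu hf hb
    rw [hm] at this
    exact hne this.symm

/-- The tree path between two outer vertices lifts to an even path. -/
theorem evenPath_tree {α b : V} (hbo : b ∈ a.out) (n : ℕ) : ∀ {x}, a.rank M (a.base x) ≤ n →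
    x ∈ a.own α → x ∈ a.out → a.Anc M b (a.base x) →
    EvenPath G M (st.expand α {X | ∃ z, X = st.root z ∧ a.Anc M b z ∧ a.Anc M z (a.base x)})
      {y | a.Anc M b (a.base y) ∧ a.Anc M (a.base y) (a.base x)} b x := by
  induction n using Nat.strong_induction_on with
  | _ n ih =>
    intro x hn hx hxo hbx
    obtain ⟨B, hB, hBv, hBp⟩ := r.blossom_out hx hxo
    -- The last stretch runs inside the root blossom of `x`, from its base to `x`; everything before
    -- it is obtained from the node two levels up.
    have hblossom : EvenPath G M
        (st.expand α {X | ∃ z, X = st.root z ∧ a.Anc M b z ∧ a.Anc M z (a.base x)})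
        {y | a.base y = a.base x} (a.base x) x := by
      refine (hBp x (by rw [hBv]; rfl)).mono ?_ (by rw [hBv])
      intro e he
      refine Or.inl ⟨B, Or.inl ⟨α, hB⟩, ⟨a.base x, ?_, hbx, Relation.ReflTransGen.refl⟩, he⟩
      rw [hBv, r.root hM h, h.base_base]
    rcases hbx.tail_cases with hbx' | ⟨p, hbp, hp⟩
    · rw [hbx'] at hblossom ⊢
      refine hblossom.mono le_rfl ?_
      intro y hy
      have hy' : a.base y = a.base x := hy
      change a.Anc M _ (a.base y) ∧ a.Anc M (a.base y) _
      rw [hy']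
      exact ⟨Relation.ReflTransGen.refl, Relation.ReflTransGen.refl⟩
    · rcases hp.cases h with ⟨-, hf, rfl, hi⟩ | ⟨h1, -, -⟩
      swap
      · exact absurd (h.base_out hxo) (h.inn_not h1)
      set m := mate M (a.base x) with hm
      have hmm : mate M m = a.base x := hM.mate_mate _
      have hmb : a.base m = m := hp.base_left h
      have hbm : b ≠ m := fun h' => h.inn_not hi (h' ▸ hbo)
      have hq := child_par h hi
      have hbq : a.Anc M b (a.base (a.par m)) := hbp.of_child h hbm hq
      have hmo : m ∈ a.own α := (hp.own hM h).2 (h.own_base hx)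
      have hpo := h.own_par hi hmo
      have hr1 := hp.rank_lt hM h
      have hr2 := hq.rank_lt hM h
      have hqx : a.Anc M (a.base (a.par m)) (a.base x) :=
        (Relation.ReflTransGen.single hq).tail hp
      have hP := ih (a.rank M (a.base (a.par m))) (by omega) le_rfl hpo (h.par_out hi) hbq
      -- Were this edge matched, the parent of `m` would be its child `base x`, against the ranks.
      have hunm : s(a.par m, m) ∉ M := by
        intro h1
        have h2 := hM.mate_eq' h1
        rw [hmm] at h2
        rw [← h2, h.base_base] at hr2
        omega
      have hmat : s(m, a.base x) ∈ M := by rw [Sym2.eq_swap]; exact mate_mem hf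
      refine (hP.extend hblossom (h.par_adj hi) (hM.adj hmat) hunm hmat ?_ ?_ ?_).mono ?_ ?_
      · rintro ⟨-, h2⟩
        rw [hmb] at h2
        rcases h2.rank_lt hM h with h3 | h3
        · rw [← h3] at hr2; omega
        · omega
      · intro h2
        change a.base m = a.base x at h2
        rw [hmb] at h2
        rw [← h2] at hr1; omega
      · rw [Set.disjoint_left]
        rintro y ⟨-, h2⟩ h3
        change a.base y = a.base x at h3
        rw [h3] at h2
        rcases h2.rank_lt hM h with h4 | h4
        · rw [h4] at hr1; omega
        · omega
      · have hin1 : st.root (a.par m) ∈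
            {X | ∃ z, X = st.root z ∧ a.Anc M b z ∧ a.Anc M z (a.base x)} :=
          ⟨_, (r.root_base hM h _).symm, hbq, hqx⟩
        have hin2 : st.root m ∈
            {X | ∃ z, X = st.root z ∧ a.Anc M b z ∧ a.Anc M z (a.base x)} :=
          ⟨_, rfl, hbp, Relation.ReflTransGen.single hp⟩
        have hin3 : st.root (a.base x) ∈
            {X | ∃ z, X = st.root z ∧ a.Anc M b z ∧ a.Anc M z (a.base x)} :=
          ⟨_, rfl, hbx, Relation.ReflTransGen.refl⟩
        rintro e ((he | he) | (rfl | rfl))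
        · rcases he with ⟨B', h1, ⟨z, h2, h3, h4⟩, h5⟩ | ⟨y, z, h1, h2, h3, h4, h5⟩
          · exact Or.inl ⟨B', h1, ⟨z, h2, h3, h4.trans hqx⟩, h5⟩
          · refine Or.inr ⟨y, z, h1, h2, h3, ?_, ?_⟩
            · obtain ⟨w, e1, e2, e3⟩ := h4
              exact ⟨w, e1, e2, e3.trans hqx⟩
            · obtain ⟨w, e1, e2, e3⟩ := h5
              exact ⟨w, e1, e2, e3.trans hqx⟩
        · exact he
        · have hne : a.base (a.par m) ≠ a.base m := by
            rw [hmb]; intro h1; rw [h1] at hr2; omega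
          refine Or.inr ⟨_, _, ?_, rfl, mt (r.root_eq_iff hM h).1 hne, hin1, hin2⟩
          rw [r.arcs α _ _ hne]
          exact ⟨hpo, hmo, Or.inl ⟨hi, rfl⟩⟩
        · have hne : a.base m ≠ a.base (a.base x) := by
            rw [hmb, h.base_base]; intro h1; rw [h1] at hr1; omega
          refine Or.inr ⟨_, _, ?_, rfl, mt (r.root_eq_iff hM h).1 hne, hin2, hin3⟩
          rw [r.arcs α _ _ hne]
          exact ⟨hmo, h.own_base hx, Or.inr ⟨hi, hmm.symm⟩⟩
      · rintro y (rfl | ⟨h1, h2⟩ | h1)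
        · change a.Anc M b (a.base m) ∧ a.Anc M (a.base m) (a.base x)
          rw [hmb]
          exact ⟨hbp, Relation.ReflTransGen.single hp⟩
        · exact ⟨h1, h2.trans hqx⟩
        · change a.base y = a.base x at h1
          change a.Anc M b (a.base y) ∧ a.Anc M (a.base y) (a.base x)
          rw [h1]
          exact ⟨hbx, Relation.ReflTransGen.refl⟩

end Rep

end ScaledMatching

namespace ScaledMatching

variable {V : Type*}

namespace Rep

open AState

variable {G : SimpleGraph V} {M : Set (Sym2 V)} {st : State V} {a : AState V} {l : ℕ}

theorem expand_mem (r : Rep G M st a) {α : V} {N : Set (Set V)} {e : Sym2 V} {y : V}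
    (he : e ∈ st.expand α N) (hy : y ∈ e) :
    (∃ B ∈ st.Omega, B.verts ∈ N ∧ y ∈ B.verts) ∨ (y ∈ a.own α ∧ st.root y ∈ N) := by
  rcases he with ⟨B, hB, hBN, he⟩ | ⟨x, z, hxz, rfl, -, h1, h2⟩
  · left
    refine ⟨B, hB, hBN, ?_⟩
    rcases hB with ⟨γ, hB⟩ | ⟨w, rfl⟩
    · exact r.blossom_edges hB he hy
    · exact absurd he (Set.notMem_empty e)
  · right
    have := r.arc_own hxz
    rcases Sym2.mem_iff.1 hy with rfl | rfl
    · exact ⟨this.1, h1⟩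
    · exact ⟨this.2.1, h2⟩

variable (hM : IsMatchingSet G M) (h : a.Valid M G l) (r : Rep G M st a)
include hM h r

theorem expand_root {α : V} {N : Set (Set V)} {e : Sym2 V} {y : V}
    (hN : ∀ X ∈ N, ∃ z, X = st.root z) (he : e ∈ st.expand α N) (hy : y ∈ e) :
    st.root y ∈ N := by
  rcases r.expand_mem he hy with ⟨B, -, hBN, hyB⟩ | h1
  · obtain ⟨z, hz⟩ := hN _ hBN
    rw [hz, r.root hM h] at hyB
    have : st.root y = st.root z := (r.root_eq_iff hM h).2 hyB
    rwa [this, ← hz]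
  · exact h1.2

/-! ### Lifted augmenting paths -/

theorem expand_ancestor_own {α u y : V} {e : Sym2 V} (hu : u ∈ a.own α)
    (he : e ∈ st.expand α {X | st.Ancestor α X (st.root u)}) (hy : y ∈ e) : y ∈ a.own α := by
  have h1 : ∀ X ∈ {X | st.Ancestor α X (st.root u)}, ∃ z, X = st.root z := by
    intro X hX
    obtain ⟨z, -, hz⟩ := (r.ancestor_root_iff hM h hu).1 hX
    exact ⟨z, hz⟩
  have h2 := r.expand_root hM h h1 he hy
  have h3 := (r.ancestor_iff hM h hu).1 h2
  exact own_of_base h ((h3.own hM h).2 (h.own_base hu))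

/-- This holds for whichever lifted path is chosen: every edge it may use has its ends in one of the
two structures, apart from the joining arc. It is the source of the disjointness of the recorded
paths. -/
theorem liftedPath_support {α β u v : V} (hu : u ∈ a.own α) (hv : v ∈ a.own β)
    {p : G.Walk α β} (hp : IsLiftedPath M st u v p) {y : V} (hy : y ∈ p.support) :
    y ∈ a.own α ∪ a.own β := by
  have hnil : ¬ p.Nil := fun hn => hp.1.2.1 hn.eq
  obtain ⟨e, he, hye⟩ := (SimpleGraph.Walk.mem_support_iff_exists_mem_edges_of_not_nil hnil).1 hy
  rcases hp.2 e he with rfl | h1 | h1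
  · rcases Sym2.mem_iff.1 hye with rfl | rfl
    · exact Or.inl hu
    · exact Or.inr hv
  · exact Or.inl (r.expand_ancestor_own hM h hu h1 hye)
  · exact Or.inr (r.expand_ancestor_own hM h hv h1 hye)

/-- Two even paths from the roots, each inside its own structure, are joined by the unmatched edge
between their outer ends. -/
theorem exists_liftedPath {α β u v : V} (hne : α ≠ β) (hu : u ∈ a.own α) (huo : u ∈ a.out)
    (hv : v ∈ a.own β) (hvo : v ∈ a.out) (huv : G.Adj u v) :
    ∃ p : G.Walk α β, IsLiftedPath M st u v p := by
  have hα := h.own_root hu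
  have hβ := h.own_root hv
  have hαo : α ∈ a.out := (h.own_mem hα.1).resolve_right fun hi => h.inn_cov hi hα.2
  have hβo : β ∈ a.out := (h.own_mem hβ.1).resolve_right fun hi => h.inn_cov hi hβ.2
  have hb : a.base u ≠ a.base v := by
    intro hb
    exact hne (h.own_disj (h.own_base hu) (hb ▸ h.own_base hv))
  have key : ∀ {γ x}, x ∈ a.own γ → x ∈ a.out → γ ∈ a.out →
      EvenPath G M (st.expand γ {X | st.Ancestor γ X (st.root x)}) (a.own γ) γ x := by
    intro γ x hx hxo hγ
    refine (r.evenPath_tree hM h hγ _ le_rfl hx hxo (root_anc hM h hx)).mono ?_ ?_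
    · have hN : ∀ X ∈ {X | ∃ z, X = st.root z ∧ a.Anc M γ z ∧ a.Anc M z (a.base x)},
          X ∈ {X | st.Ancestor γ X (st.root x)} := by
        rintro X ⟨z, rfl, -, hz⟩
        exact (r.ancestor_root_iff hM h hx).2 ⟨z, hz, rfl⟩
      rintro e (⟨B, h1, h2, h3⟩ | ⟨y, z, h1, h2, h3, h4, h5⟩)
      · exact Or.inl ⟨B, h1, hN _ h2, h3⟩
      · exact Or.inr ⟨y, z, h1, h2, h3, hN _ h4, hN _ h5⟩
    · rintro y ⟨-, hy⟩
      exact own_of_base h ((hy.own hM h).2 (h.own_base hx))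
  obtain ⟨p, h1, h2, -, h4, -⟩ := (key hu huo hαo).join (key hv hvo hβo) huv
    (r.not_matched_of_out hM h huo hvo hb)
    (Set.disjoint_left.2 fun y h1 h2 => hne (h.own_disj h1 h2))
  exact ⟨p, ⟨h1, hne, hα.2, hβ.2, h2.isChain⟩, h4⟩

/-! ### Augmenting -/

theorem augment (α β : V) (P : Set (Sym2 V)) :
    Rep G M (augment st α β P) (a.remove α β) := by
  classical
  have hst : ∀ γ, ((ScaledMatching.augment st α β P).struc γ) =
      if γ = α ∨ γ = β then Struc.empty V else st.struc γ := by
    intro γ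
    by_cases h1 : γ = α <;> by_cases h2 : γ = β <;>
      simp [ScaledMatching.augment, State.setStruc, h1, h2]
  have hcase : ∀ γ, (γ = α ∨ γ = β) ∧ (ScaledMatching.augment st α β P).struc γ = Struc.empty V ∧
      (a.remove α β).own γ = ∅ ∧ (a.remove α β).wk γ = none ∨
      ¬ (γ = α ∨ γ = β) ∧ (ScaledMatching.augment st α β P).struc γ = st.struc γ ∧
      (a.remove α β).own γ = a.own γ ∧ (a.remove α β).wk γ = a.wk γ := by
    intro γ
    by_cases hγ : γ = α ∨ γ = β
    · exact Or.inl ⟨hγ, by rw [hst, if_pos hγ], if_pos hγ, if_pos hγ⟩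
    · exact Or.inr ⟨hγ, by rw [hst, if_neg hγ], if_neg hγ, if_neg hγ⟩
  have hnot : ∀ {γ x}, ¬ (γ = α ∨ γ = β) → x ∈ a.own γ → x ∉ a.own α ∪ a.own β := by
    rintro γ x hγ hx (h1 | h1)
    · exact hγ (Or.inl (h.own_disj hx h1))
    · exact hγ (Or.inr (h.own_disj hx h1))
  have hset : ∀ {x}, x ∉ a.own α ∪ a.own β →
      {y | (a.remove α β).base y = (a.remove α β).base x} = {y | a.base y = a.base x} := by
    intro x hx
    ext y
    change (a.remove α β).base y = (a.remove α β).base x ↔ a.base y = a.base x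
    rw [remove_base_neg hx]
    by_cases hy : y ∈ a.own α ∪ a.own β
    · rw [remove_base_pos hy]
      constructor
      · intro he
        rw [he, mem_union_base hM h] at hy
        exact absurd hy hx
      · intro he
        rw [← mem_union_base hM h, he, mem_union_base hM h] at hy
        exact absurd hy hx
    · rw [remove_base_neg hy]
  refine
    { verts := ?_
      label := r.label
      removed := ?_
      onHold := r.onHold
      modified := ?_
      work := ?_
      arcs := ?_
      arc_own := ?_
      blossom_own := ?_
      blossom_base := ?_
      blossom_edges := ?_
      blossom_out := ?_ }
  · intro γ
    rcases hcase γ with ⟨-, h1, h2, -⟩ | ⟨-, h1, h2, -⟩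
    · rw [h1, h2]; rfl
    · rw [h1, h2]; exact r.verts γ
  · change st.removed ∪ (st.struc α).verts ∪ (st.struc β).verts = a.removed ∪ (a.own α ∪ a.own β)
    rw [r.removed, r.verts, r.verts, Set.union_assoc]
  · change st.modified ∪ _ = a.modified ∪ _
    rw [r.modified]
  · intro γ
    rcases hcase γ with ⟨-, h1, -, h2⟩ | ⟨hγ, h1, -, h2⟩
    · rw [h1, h2]; rfl
    · rw [h1, h2, r.work]
      cases hw : a.wk γ with
      | none => rfl
      | some w =>
        simp only [Option.map_some]
        rw [hset (hnot hγ (h.wk_own hw))]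
  · intro γ x y hne
    rcases hcase γ with ⟨-, h1, h2, -⟩ | ⟨hγ, h1, h2, -⟩
    · rw [h1, h2]
      simp [Struc.empty]
    · rw [h1, h2]
      by_cases hb : a.base x = a.base y
      · have hx : ¬ (x ∈ a.own γ ∧ y ∈ a.own γ) := by
          rintro ⟨hx, hy⟩
          rw [remove_base_neg (hnot hγ hx), remove_base_neg (hnot hγ hy)] at hne
          exact hne hb
        constructor
        · intro h3
          have := r.arc_own h3
          exact absurd ⟨this.1, this.2.1⟩ hx
        · intro h3
          exact absurd ⟨h3.1, h3.2.1⟩ hx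
      · rw [r.arcs γ x y hb]
        constructor
        · rintro ⟨hx, hy, h3⟩
          exact ⟨hx, hy, h3.imp (fun h4 => ⟨⟨h4.1, hnot hγ hy⟩, h4.2⟩)
            (fun h4 => ⟨⟨h4.1, hnot hγ hx⟩, h4.2⟩)⟩
        · rintro ⟨hx, hy, h3⟩
          exact ⟨hx, hy, h3.imp (fun h4 => ⟨h4.1.1, h4.2⟩) (fun h4 => ⟨h4.1.1, h4.2⟩)⟩
  · intro γ x y hxy
    rcases hcase γ with ⟨-, h1, h2, -⟩ | ⟨hγ, h1, h2, -⟩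
    · rw [h1] at hxy; exact absurd hxy (Set.notMem_empty _)
    · rw [h1] at hxy; rw [h2]; exact r.arc_own hxy
  · intro γ B x hB hx
    rcases hcase γ with ⟨-, h1, h2, -⟩ | ⟨hγ, h1, h2, -⟩
    · rw [h1] at hB; exact absurd hB (Set.notMem_empty _)
    · rw [h1] at hB; rw [h2]; exact r.blossom_own hB hx
  · intro γ B x y hB hx hy
    rcases hcase γ with ⟨-, h1, h2, -⟩ | ⟨hγ, h1, h2, -⟩
    · rw [h1] at hB; exact absurd hB (Set.notMem_empty _)
    · rw [h1] at hB
      rw [remove_base_neg (hnot hγ (r.blossom_own hB hx)),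
        remove_base_neg (hnot hγ (r.blossom_own hB hy))]
      exact r.blossom_base hB hx hy
  · intro γ B e x hB he hx
    rcases hcase γ with ⟨-, h1, h2, -⟩ | ⟨hγ, h1, h2, -⟩
    · rw [h1] at hB; exact absurd hB (Set.notMem_empty _)
    · rw [h1] at hB; exact r.blossom_edges hB he hx
  · intro γ x hx hxo
    rcases hcase γ with ⟨-, h1, h2, -⟩ | ⟨hγ, h1, h2, -⟩
    · rw [h2] at hx; exact absurd hx (Set.notMem_empty _)
    · rw [h2] at hx
      rw [h1, hset (hnot hγ hx), remove_base_neg (hnot hγ hx)]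
      exact r.blossom_out hx hxo.1

/-! ### Contracting -/

/-- The even path to an inner vertex of the cycle between `L` and `u`. -/
theorem evenPath_inner {α u v L : V} (hLo : L ∈ a.out) (hu : u ∈ a.own α)
    (hv : v ∈ a.own α) (huo : u ∈ a.out) (hvo : v ∈ a.out) (hne : a.base u ≠ a.base v)
    (hLv : a.Anc M L (a.base v))
    (hlow : ∀ Z, a.Anc M Z (a.base u) → a.Anc M Z (a.base v) → a.Anc M Z L)
    (huv : G.Adj u v) {x : V} (hxi : x ∈ a.inn) (hxα : x ∈ a.own α)
    (hLx : a.Anc M L x) (hxu : a.Anc M x (a.base u)) :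
    EvenPath G M (insert s(u, v) (st.expand α
        {X | ∃ z ∈ a.cyc M L (a.base u) (a.base v), X = st.root z}))
      {y | a.base y ∈ a.cyc M L (a.base u) (a.base v)} L x := by
  have hxb : a.base x = x := h.base_not (h.inn_not hxi)
  have hcx := child_mate hM h hxi
  have hbu : a.Anc M (mate M x) (a.base u) := hxu.mate_left hM h hxi
    fun h' => h.inn_not hxi (h' ▸ h.base_out huo)
  have hLb : a.Anc M L (mate M x) := Relation.ReflTransGen.tail hLx hcx
  have hLx' : L ≠ x := fun h' => h.inn_not hxi (h' ▸ hLo)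
  have hrLx : a.rank M L < a.rank M x := (hLx.rank_lt hM h).resolve_left hLx'
  have hrx := hcx.rank_lt hM h
  have hP := r.evenPath_tree hM h hLo _ le_rfl hv hvo hLv
  have hQ := r.evenPath_tree hM h (h.inn_mate hxi) _ le_rfl hu huo hbu
  have hmat : s(mate M x, x) ∈ M := by
    rw [Sym2.eq_swap]; exact mate_mem (h.inn_cov hxi)
  have hxK : x ∈ a.cyc M L (a.base u) (a.base v) := ⟨hLx, Or.inl hxu⟩
  have hmK := (⟨hLb, Or.inl hbu⟩ : mate M x ∈ a.cyc M L (a.base u) (a.base v))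
  -- A node below `x` and above both ends would be a common ancestor, and `x` would then lie above
  -- `L`. This keeps the two legs of the detour apart.
  have hno : ∀ {y}, a.Anc M x y → a.Anc M y (a.base u) → ¬ a.Anc M y (a.base v) := by
    intro y h1 h2 h3
    have h4 := h1.trans (hlow y h2 h3)
    rcases Anc.rank_lt hM h h4 with h5 | h5
    · exact hLx' h5.symm
    · omega
  -- The path descends from `L` to `v`, crosses to `u`, climbs to the partner of `x`, and enters `x`
  -- through the matched edge.
  refine (hP.detour hQ huv.symm ?_ (hM.adj hmat) hmat ?_ ?_ ?_).mono ?_ ?_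
  · exact r.not_matched_of_out hM h hvo huo hne.symm
  · rintro ⟨-, h2⟩
    rw [hxb] at h2
    exact hno Relation.ReflTransGen.refl hxu h2
  · rintro ⟨h1, -⟩
    rw [hxb] at h1
    rcases h1.rank_lt hM h with h2 | h2
    · rw [h2] at hrx; omega
    · omega
  · rw [Set.disjoint_left]
    rintro y ⟨-, h2⟩ ⟨h3, h4⟩
    exact hno ((Relation.ReflTransGen.single hcx).trans h3) h4 h2
  · have hN1 : ∀ X ∈ {X | ∃ z, X = st.root z ∧ a.Anc M L z ∧ a.Anc M z (a.base v)},
        X ∈ {X | ∃ z ∈ a.cyc M L (a.base u) (a.base v), X = st.root z} := by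
      rintro X ⟨z, h1, h2, h3⟩
      exact ⟨z, ⟨h2, Or.inr h3⟩, h1⟩
    have hN2 : ∀ X ∈ {X | ∃ z, X = st.root z ∧ a.Anc M (mate M x) z ∧ a.Anc M z (a.base u)},
        X ∈ {X | ∃ z ∈ a.cyc M L (a.base u) (a.base v), X = st.root z} := by
      rintro X ⟨z, h1, h2, h3⟩
      exact ⟨z, ⟨hLb.trans h2, Or.inl h3⟩, h1⟩
    rintro e ((he | he) | (rfl | rfl))
    · right
      rcases he with ⟨B, h1, h2, h3⟩ | ⟨y, z, h1, h2, h3, h4, h5⟩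
      · exact Or.inl ⟨B, h1, hN1 _ h2, h3⟩
      · exact Or.inr ⟨y, z, h1, h2, h3, hN1 _ h4, hN1 _ h5⟩
    · right
      rcases he with ⟨B, h1, h2, h3⟩ | ⟨y, z, h1, h2, h3, h4, h5⟩
      · exact Or.inl ⟨B, h1, hN2 _ h2, h3⟩
      · exact Or.inr ⟨y, z, h1, h2, h3, hN2 _ h4, hN2 _ h5⟩
    · exact Or.inl Sym2.eq_swap
    · right
      have hne : a.base x ≠ a.base (mate M x) := by
        rw [hxb, h.inn_mate_base hxi]
        exact (hM.mate_ne (h.inn_cov hxi)).symm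
      refine Or.inr ⟨x, mate M x, ?_, Sym2.eq_swap, mt (r.root_eq_iff hM h).1 hne,
        ⟨x, hxK, rfl⟩, ⟨_, hmK, rfl⟩⟩
      rw [r.arcs α _ _ hne]
      exact ⟨hxα, h.own_mate hxα (h.inn_cov hxi), Or.inr ⟨hxi, rfl⟩⟩
  · rintro y (rfl | ⟨h1, h2⟩ | ⟨h1, h2⟩)
    · change a.base y ∈ a.cyc M L (a.base u) (a.base v)
      rwa [hxb]
    · exact ⟨h1, Or.inr h2⟩
    · exact ⟨hLb.trans h1, Or.inl h2⟩

section Contract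

variable {α u v L : V} (c : a.ContractAt M α u v L)
include c

/-- Ancestors of either end are comparable with `L`. The condition on common ancestors discards
exactly those strictly above `L`. -/
theorem cycleNodes_eq : st.cycleNodes α (st.root u) (st.root v) =
    {X | ∃ z ∈ a.cyc M L (a.base u) (a.base v), X = st.root z} := by
  ext X
  constructor
  · rintro ⟨h1, h2⟩
    have hL1 := (r.ancestor_root_iff hM h c.u_own).2 ⟨L, c.anc_u, rfl⟩
    have hL2 := (r.ancestor_root_iff hM h c.v_own).2 ⟨L, c.anc_v, rfl⟩
    have hLo := c.K_own hM h (c.L_mem hM h)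
    have hLb := c.L_base hM h
    have key : ∀ z, X = st.root z → a.base z = z → a.Anc M z L ∨ a.Anc M L z → a.Anc M L z := by
      rintro z rfl hzb (h3 | h3)
      · have h4 := h2 _ hL1 hL2 ((r.ancestor_root_iff hM h hLo).2 ⟨z, by rwa [hLb], rfl⟩)
        rw [r.root_eq_iff hM h, hLb, hzb] at h4
        rw [h4]; exact Relation.ReflTransGen.refl
      · exact h3
    rcases h1 with h1 | h1
    · obtain ⟨z, hz, hX⟩ := (r.ancestor_root_iff hM h c.u_own).1 h1
      exact ⟨z, ⟨key z hX (hz.base_left h (h.base_base _)) (hz.total h c.anc_u), Or.inl hz⟩, hX⟩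
    · obtain ⟨z, hz, hX⟩ := (r.ancestor_root_iff hM h c.v_own).1 h1
      exact ⟨z, ⟨key z hX (hz.base_left h (h.base_base _)) (hz.total h c.anc_v), Or.inr hz⟩, hX⟩
  · rintro ⟨z, hz, rfl⟩
    refine ⟨hz.2.imp (fun h1 => (r.ancestor_root_iff hM h c.u_own).2 ⟨z, h1, rfl⟩)
      (fun h1 => (r.ancestor_root_iff hM h c.v_own).2 ⟨z, h1, rfl⟩), ?_⟩
    intro Z h1 h2 h3
    obtain ⟨w, hw, rfl⟩ := (r.ancestor_root_iff hM h c.u_own).1 h1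
    have hwb := hw.base_left h (h.base_base _)
    have hw2 := (r.ancestor_iff hM h c.v_own).1 h2
    rw [hwb] at hw2
    have hwo := (hw.own hM h).2 (h.own_base c.u_own)
    have h4 := (r.ancestor_iff hM h hwo).1 h3
    rw [hwb, c.K_base hM h hz] at h4
    have h5 := (c.lowest w hw hw2).trans hz.1
    rw [h4.antisymm hM h h5]

theorem newBlossom_verts : (newBlossom st α u v).verts =
    {x | a.base x ∈ a.cyc M L (a.base u) (a.base v)} := by
  ext x
  change x ∈ Set.sUnion (st.cycleNodes α (st.root u) (st.root v)) ↔ _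
  rw [r.cycleNodes_eq hM h c]
  constructor
  · rintro ⟨X, ⟨z, hz, rfl⟩, hx⟩
    rw [r.root hM h, c.K_base hM h hz] at hx
    change a.base x ∈ a.cyc M L (a.base u) (a.base v)
    have hx' : a.base x = z := hx
    rwa [hx']
  · intro hx
    refine ⟨_, ⟨_, hx, rfl⟩, ?_⟩
    rw [r.root hM h, h.base_base]
    rfl

omit hM h r c in
theorem _root_.ScaledMatching.AState.ContractAt.cyc_comm :
    a.cyc M L (a.base u) (a.base v) = a.cyc M L (a.base v) (a.base u) := by
  ext z
  simp only [cyc, Set.mem_ofPred_eq, or_comm]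

/-- Formerly outer vertices are reached straight down the tree from `L`. Inner ones are reached the
other way round the cycle, from whichever side they lie on. -/
theorem evenPath_newBlossom (huv : G.Adj u v) {x : V}
    (hx : a.base x ∈ a.cyc M L (a.base u) (a.base v)) :
    EvenPath G M (newBlossom st α u v).edges (newBlossom st α u v).verts L x := by
  rw [r.newBlossom_verts hM h c]
  change EvenPath G M (insert s(u, v) (st.expand α (st.cycleNodes α (st.root u) (st.root v)))) _ L x
  rw [r.cycleNodes_eq hM h c]
  have hxα := own_of_base h (c.K_own hM h hx)
  rcases h.own_mem hxα with ho | hi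
  · refine (r.evenPath_tree hM h (c.L_out hM h) _ le_rfl hxα ho hx.1).mono ?_ ?_
    · have hN : ∀ X ∈ {X | ∃ z, X = st.root z ∧ a.Anc M L z ∧ a.Anc M z (a.base x)},
          X ∈ {X | ∃ z ∈ a.cyc M L (a.base u) (a.base v), X = st.root z} := by
        rintro X ⟨z, h1, h2, h3⟩
        exact ⟨z, ⟨h2, hx.2.imp h3.trans h3.trans⟩, h1⟩
      rintro e (⟨B, h1, h2, h3⟩ | ⟨y, z, h1, h2, h3, h4, h5⟩)
      · exact Or.inr (Or.inl ⟨B, h1, hN _ h2, h3⟩)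
      · exact Or.inr (Or.inr ⟨y, z, h1, h2, h3, hN _ h4, hN _ h5⟩)
    · rintro y ⟨h1, h2⟩
      exact ⟨h1, hx.2.imp h2.trans h2.trans⟩
  · rw [h.base_not (h.inn_not hi)] at hx
    rcases hx.2 with h1 | h1
    · exact r.evenPath_inner hM h (c.L_out hM h) c.u_own c.v_own c.u_out c.v_out c.ne c.anc_v
        c.lowest huv hi hxα hx.1 h1
    · rw [AState.ContractAt.cyc_comm, Sym2.eq_swap]
      exact r.evenPath_inner hM h (c.L_out hM h) c.v_own c.u_own c.v_out c.u_out c.ne.symm c.anc_u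
        (fun Z h1 h2 => c.lowest Z h2 h1) huv.symm hi hxα hx.1 h1

theorem contract (huv : G.Adj u v) : Rep G M (contract M st α u v)
    (a.contract M α L (a.cyc M L (a.base u) (a.base v))) := by
  set K := a.cyc M L (a.base u) (a.base v) with hK
  have hB : (newBlossom st α u v).verts = {x | a.base x ∈ K} := r.newBlossom_verts hM h c
  have hKo : ∀ {x}, a.base x ∈ K → x ∈ a.own α := fun hx => own_of_base h (c.K_own hM h hx)
  have hbase : ∀ {x y}, a.base x = a.base y →
      (a.contract M α L K).base x = (a.contract M α L K).base y := by
    intro x y hxy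
    by_cases hx : a.base x ∈ K
    · rw [contract_base_pos hM h c hx, contract_base_pos hM h c (hxy ▸ hx)]
    · rw [contract_base_neg hM h c hx, contract_base_neg hM h c (hxy ▸ hx), hxy]
  have hpos : ∀ {x}, a.base x ∈ K →
      {y | (a.contract M α L K).base y = (a.contract M α L K).base x} = {y | a.base y ∈ K} := by
    intro x hx
    ext y
    change (a.contract M α L K).base y = (a.contract M α L K).base x ↔ a.base y ∈ K
    rw [contract_base_pos hM h c hx]
    by_cases hy : a.base y ∈ K
    · exact ⟨fun _ => hy, fun _ => contract_base_pos hM h c hy⟩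
    · rw [contract_base_neg hM h c hy]
      exact ⟨fun h' => h' ▸ c.L_mem hM h, fun h' => absurd h' hy⟩
  have hneg : ∀ {x}, a.base x ∉ K →
      {y | (a.contract M α L K).base y = (a.contract M α L K).base x} =
        {y | a.base y = a.base x} := by
    intro x hx
    ext y
    refine ⟨fun hy => ?_, fun hy => hbase hy⟩
    change (a.contract M α L K).base y = (a.contract M α L K).base x at hy
    change a.base y = a.base x
    rw [contract_base_neg hM h c hx] at hy
    by_cases hyK : a.base y ∈ K
    · rw [contract_base_pos hM h c hyK] at hy
      exact absurd (hy ▸ c.L_mem hM h) hx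
    · rwa [contract_base_neg hM h c hyK] at hy
  have hα : (ScaledMatching.contract M st α u v).struc α =
      ⟨(st.struc α).verts, insert (u, v) (st.struc α).arcs,
        insert (newBlossom st α u v) (st.struc α).blossoms,
        some (newBlossom st α u v).verts⟩ := by
    simp [ScaledMatching.contract, State.setStruc]
  have hγ : ∀ {γ}, γ ≠ α → (ScaledMatching.contract M st α u v).struc γ = st.struc γ := by
    intro γ hγ
    simp [ScaledMatching.contract, State.setStruc, hγ]
  have hedge : ∀ {e x}, e ∈ (newBlossom st α u v).edges → x ∈ e →
      x ∈ (newBlossom st α u v).verts := by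
    rintro e x (rfl | he) hx
    · rw [hB]
      rcases Sym2.mem_iff.1 hx with rfl | rfl
      · exact c.u_mem hM h
      · exact c.v_mem hM h
    · rw [r.cycleNodes_eq hM h c] at he
      obtain ⟨z, hz, hxz⟩ := r.expand_root hM h (fun X hX => by
        obtain ⟨z, -, hz⟩ := hX
        exact ⟨z, hz⟩) he hx
      rw [hB]
      rw [r.root_eq_iff hM h, c.K_base hM h hz] at hxz
      change a.base x ∈ K
      rwa [hxz]
  -- If the inner end of a tree arc is on the cycle then so is its other end, and the arc no longer
  -- joins different nodes.
  have harc : ∀ γ x y, (a.contract M α L K).base x ≠ (a.contract M α L K).base y →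
      ((x, y) ∈ (st.struc γ).arcs ↔ x ∈ a.own γ ∧ y ∈ a.own γ ∧
        ((y ∈ (a.contract M α L K).inn ∧ x = a.par y) ∨
          (x ∈ (a.contract M α L K).inn ∧ y = mate M x))) := by
    intro γ x y hne
    rw [r.arcs γ x y fun h' => hne (hbase h')]
    have hnot : ¬ (a.base x ∈ K ∧ a.base y ∈ K) := by
      rintro ⟨h1, h2⟩
      rw [contract_base_pos hM h c h1, contract_base_pos hM h c h2] at hne
      exact hne rfl
    constructor
    · rintro ⟨h1, h2, ⟨h3, rfl⟩ | ⟨h3, rfl⟩⟩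
      · refine ⟨h1, h2, Or.inl ⟨⟨h3, fun h4 => hnot ?_⟩, rfl⟩⟩
        refine ⟨c.K_parent hM h h4 (fun h5 => h.inn_not h3 (h5 ▸ c.L_out hM h))
          (child_par h h3), ?_⟩
        rwa [h.base_not (h.inn_not h3)]
      · refine ⟨h1, h2, Or.inr ⟨⟨h3, fun h4 => hnot ?_⟩, rfl⟩⟩
        rw [h.base_not (h.inn_not h3), h.inn_mate_base h3]
        exact ⟨h4, c.K_inn_mate hM h h4 h3⟩
    · rintro ⟨h1, h2, h3⟩
      exact ⟨h1, h2, h3.imp (fun h4 => ⟨h4.1.1, h4.2⟩) (fun h4 => ⟨h4.1.1, h4.2⟩)⟩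
  refine
    { verts := ?_
      label := ?_
      removed := r.removed
      onHold := r.onHold
      modified := ?_
      work := ?_
      arcs := ?_
      arc_own := ?_
      blossom_own := ?_
      blossom_base := ?_
      blossom_edges := ?_
      blossom_out := ?_ }
  · intro γ
    by_cases hg : γ = α
    · subst hg; rw [hα]; exact r.verts γ
    · rw [hγ hg]; exact r.verts γ
  · funext e
    have : ∀ x, x ∈ (newBlossom st α u v).verts ↔ a.base x ∈ K := fun x => by rw [hB]; rfl
    simp only [ScaledMatching.contract, AState.contract, r.label]
    split_ifs with h1 h2 h2
    · rfl
    · exact absurd ⟨h1.1, (this _).1 h1.2.1, (this _).1 h1.2.2⟩ h2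
    · exact absurd ⟨h2.1, (this _).2 h2.2.1, (this _).2 h2.2.2⟩ h1
    · rfl
  · change insert α st.modified = insert α a.modified
    rw [r.modified]
  · intro γ
    by_cases hg : γ = α
    · subst hg
      rw [hα, contract_wk_self hM h c]
      simp only [Option.map_some]
      rw [hpos (by rw [c.L_base hM h]; exact c.L_mem hM h), hB]
    · rw [hγ hg, contract_wk_ne hM h c hg, r.work]
      cases hw : a.wk γ with
      | none => rfl
      | some w =>
        simp only [Option.map_some]
        rw [hneg fun h' => hg (h.own_disj (h.wk_own hw) (hKo h'))]
  · intro γ x y hne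
    by_cases hg : γ = α
    · subst hg
      rw [hα]
      have hxy : (x, y) ≠ (u, v) := by
        rintro h'
        obtain ⟨rfl, rfl⟩ := Prod.mk.inj h'
        rw [contract_base_pos hM h c (c.u_mem hM h), contract_base_pos hM h c (c.v_mem hM h)]
          at hne
        exact hne rfl
      rw [Set.mem_insert_iff, or_iff_right hxy]
      exact harc γ x y hne
    · rw [hγ hg]
      exact harc γ x y hne
  · intro γ x y hxy
    by_cases hg : γ = α
    · subst hg
      rw [hα] at hxy
      rcases hxy with h1 | h1
      · obtain ⟨rfl, rfl⟩ := Prod.mk.inj h1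
        exact ⟨c.u_own, c.v_own, huv⟩
      · exact r.arc_own h1
    · rw [hγ hg] at hxy; exact r.arc_own hxy
  · intro γ B x hBm hx
    by_cases hg : γ = α
    · subst hg
      rw [hα] at hBm
      rcases hBm with rfl | h1
      · rw [hB] at hx; exact hKo hx
      · exact r.blossom_own h1 hx
    · rw [hγ hg] at hBm; exact r.blossom_own hBm hx
  · intro γ B x y hBm hx hy
    by_cases hg : γ = α
    · subst hg
      rw [hα] at hBm
      rcases hBm with rfl | h1
      · rw [hB] at hx hy
        rw [contract_base_pos hM h c hx, contract_base_pos hM h c hy]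
      · exact hbase (r.blossom_base h1 hx hy)
    · rw [hγ hg] at hBm; exact hbase (r.blossom_base hBm hx hy)
  · intro γ B e x hBm he hx
    by_cases hg : γ = α
    · subst hg
      rw [hα] at hBm
      rcases hBm with rfl | h1
      · exact hedge he hx
      · exact r.blossom_edges h1 he hx
    · rw [hγ hg] at hBm; exact r.blossom_edges hBm he hx
  · intro γ x hx hxo
    change x ∈ a.own γ at hx
    by_cases hxK : a.base x ∈ K
    · obtain rfl := h.own_disj hx (hKo hxK)
      refine ⟨newBlossom st γ u v, by rw [hα]; exact Or.inl rfl, by rw [hpos hxK, hB], ?_⟩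
      intro y hy
      rw [contract_base_pos hM h c hxK]
      rw [hB] at hy
      exact r.evenPath_newBlossom hM h c huv hy
    · obtain ⟨B, h1, h2, h3⟩ := r.blossom_out hx (hxo.resolve_right hxK)
      refine ⟨B, ?_, by rw [hneg hxK, h2], by rwa [contract_base_neg hM h c hxK]⟩
      by_cases hg : γ = α
      · subst hg; rw [hα]; exact Or.inr h1
      · rw [hγ hg]; exact h1

end Contract

end Rep

end ScaledMatching

namespace ScaledMatching

variable {V : Type*}

namespace Rep

open AState

variable {G : SimpleGraph V} {M : Set (Sym2 V)} {st : State V} {a : AState V} {l : ℕ}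
variable (hM : IsMatchingSet G M) (h : a.Valid M G l) (r : Rep G M st a)
  {α u v t : V} {k : ℕ} (c : a.OvertakeAt M G α u v t)
include hM h r c

/-! ### Overtaking -/

/-- Overtaking only asks for some unmatched arc into `v`. Since `v` forms a node by itself, that arc
joins different nodes and must be the tree arc from its parent. -/
theorem parent_eq {β p : V} (hp : (p, v) ∈ (st.struc β).arcs) (hpM : s(p, v) ∉ M) :
    v ∈ a.inn ∧ p = a.par v := by
  have h1 := r.arc_own hp
  have hne : a.base p ≠ a.base v := by
    rw [c.base_v h]
    intro h2
    exact h1.2.2.ne (c.base_eq_v hM h h2)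
  rw [r.arcs β p v hne] at hp
  obtain ⟨-, -, h2 | ⟨h2, h3⟩⟩ := hp
  · exact h2
  · exact absurd (h3 ▸ mate_mem (h.inn_cov h2)) hpM

theorem mate_arc_iff {β : V} : (v, t) ∈ (st.struc β).arcs ↔ v ∈ a.own β := by
  refine ⟨fun h1 => (r.arc_own h1).1, fun h1 => ?_⟩
  have hne : a.base v ≠ a.base t := by
    rw [c.base_v h, c.base_t hM h]; exact c.v_ne_t hM h
  rw [r.arcs β v t hne]
  exact ⟨h1, c.mate ▸ h.own_mate h1 c.v_cov,
    Or.inr ⟨(h.own_mem h1).resolve_left c.v_out, c.mate.symm⟩⟩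

omit h r in
theorem overtake_edge_iff {wk' : V → Option V} (x y : V) :
    ((y ∈ (a.overtake M α u v t k wk').inn ∧ x = (a.overtake M α u v t k wk').par y) ∨
      (x ∈ (a.overtake M α u v t k wk').inn ∧ y = mate M x)) ↔
    (y ≠ v ∧ y ∈ a.inn ∧ x = a.par y) ∨ (x ∈ a.inn ∧ y = mate M x) ∨ (x = u ∧ y = v) ∨
      (x = v ∧ y = t) := by
  simp only [mem_overtake_inn]
  by_cases hy : y = v
  · subst hy
    rw [overtake_par_self]
    by_cases hx : x = y
    · subst hx; rw [c.mate]; tauto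
    · tauto
  · rw [overtake_par_ne hy]
    by_cases hx : x = v
    · subst hx; rw [c.mate]; tauto
    · tauto

/-- The common part of the three cases. Arcs and blossoms of the new state are old ones, the arcs
`(u, v)`, `(v, t)`, or trivial blossoms, so adjacency and the even paths carry over; each case only
has to sort out which structure holds what. -/
theorem overtake_of {st' : State V} {wk' : V → Option V}
    (hlabel : st'.label = (st.setLabel (v, t) k).label) (hrem : st'.removed = st.removed)
    (hhold : st'.onHold = st.onHold)
    (hmod : st'.modified = a.modified ∪ {α} ∪ {γ | v ∈ a.own γ})
    (hverts : ∀ γ, (st'.struc γ).verts = (a.overtake M α u v t k wk').own γ)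
    (hwork : ∀ γ, (st'.struc γ).work = (wk' γ).map fun w => {x | a.base x = a.base w})
    (harcs : ∀ γ x y, a.base x ≠ a.base y → ((x, y) ∈ (st'.struc γ).arcs ↔
      x ∈ (a.overtake M α u v t k wk').own γ ∧ y ∈ (a.overtake M α u v t k wk').own γ ∧
        ((y ≠ v ∧ y ∈ a.inn ∧ x = a.par y) ∨ (x ∈ a.inn ∧ y = mate M x) ∨ (x = u ∧ y = v) ∨
          (x = v ∧ y = t))))
    (harc : ∀ {γ x y}, (x, y) ∈ (st'.struc γ).arcs → x ∈ (a.overtake M α u v t k wk').own γ ∧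
      y ∈ (a.overtake M α u v t k wk').own γ ∧
      ((∃ β, (x, y) ∈ (st.struc β).arcs) ∨ (x = u ∧ y = v) ∨ (x = v ∧ y = t)))
    (hblossom : ∀ {γ B}, B ∈ (st'.struc γ).blossoms →
      (∀ x ∈ B.verts, x ∈ (a.overtake M α u v t k wk').own γ) ∧
        ((∃ β, B ∈ (st.struc β).blossoms) ∨ ∃ w, B = Blossom.triv w))
    (hout : ∀ {γ x}, x ∈ (a.overtake M α u v t k wk').own γ →
      x ∈ (a.overtake M α u v t k wk').out → ∃ B ∈ (st'.struc γ).blossoms,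
        B.verts = {y | a.base y = a.base x} ∧
          ((∃ β, x ∈ a.own β ∧ x ∈ a.out ∧ B ∈ (st.struc β).blossoms ∧
            ∀ y ∈ B.verts, EvenPath G M B.edges B.verts (a.base x) y) ∨
            (x = t ∧ B = Blossom.triv t))) :
    Rep G M st' (a.overtake M α u v t k wk') where
  verts := hverts
  label := by
    rw [hlabel]
    simp only [State.setLabel, AState.overtake, r.label]
  removed := hrem.trans r.removed
  onHold := hhold.trans r.onHold
  modified := hmod
  work := hwork
  arcs := by
    intro γ x y hne
    rw [overtake_edge_iff hM c]
    exact harcs γ x y hne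
  arc_own := by
    intro γ x y hxy
    obtain ⟨h1, h2, ⟨β, h3⟩ | ⟨rfl, rfl⟩ | ⟨rfl, rfl⟩⟩ := harc hxy
    · exact ⟨h1, h2, (r.arc_own h3).2.2⟩
    · exact ⟨h1, h2, c.adj⟩
    · exact ⟨h1, h2, hM.adj (c.mate ▸ mate_mem c.v_cov)⟩
  blossom_own := fun hB hx => (hblossom hB).1 _ hx
  blossom_base := by
    intro γ B x y hB hx hy
    rcases (hblossom hB).2 with ⟨β, h1⟩ | ⟨w, rfl⟩
    · exact r.blossom_base h1 hx hy
    · have hx' : x = w := hx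
      have hy' : y = w := hy
      rw [hx', hy']
  blossom_edges := by
    intro γ B e x hB he hx
    rcases (hblossom hB).2 with ⟨β, h1⟩ | ⟨w, rfl⟩
    · exact r.blossom_edges h1 he hx
    · exact absurd he (Set.notMem_empty e)
  blossom_out := by
    intro γ x hx hxo
    obtain ⟨B, h1, h2, ⟨β, -, -, -, h3⟩ | ⟨rfl, rfl⟩⟩ := hout hx hxo
    · exact ⟨B, h1, h2, h3⟩
    · refine ⟨_, h1, h2, ?_⟩
      intro y hy
      have hy' : y = x := hy
      change EvenPath G M _ _ (a.base x) y
      rw [hy', c.base_t hM h]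
      exact EvenPath.single rfl

open Classical in
theorem overtakeNew (hv : v ∉ a.inn) : Rep G M (overtakeNew st α u v t k)
    (a.overtake M α u v t k (Function.update a.wk α (some t))) := by
  have hto : t ∉ a.out := fun h1 => hv ((c.t_out_iff hM h).1 h1)
  have hvo : ∀ γ, v ∉ a.own γ := fun γ h1 => (h.own_mem h1).elim c.v_out hv
  have hto' : ∀ γ, t ∉ a.own γ := fun γ h1 => (h.own_mem h1).elim hto (c.t_inn hM h)
  have hbase : ∀ x, a.base x = t → x = t := by
    intro x hx
    by_cases hxo : x ∈ a.out
    · exact absurd (hx ▸ h.base_out hxo) hto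
    · rwa [h.base_not hxo] at hx
  -- Outside all trees nothing hangs below the arc, so only its two ends are added.
  have hbel : ∀ x, a.Below M v t (a.base x) ↔ x = v ∨ x = t := by
    intro x
    constructor
    · rintro (h1 | h1 | h1)
      · exact Or.inl (c.base_eq_v hM h h1)
      · exact Or.inr (hbase x h1)
      · rcases Relation.ReflTransGen.cases_head h1 with h2 | ⟨d, hd, -⟩
        · exact Or.inl (c.base_eq_v hM h h2.symm)
        · exact absurd (hd.left_mem h) (not_or.2 ⟨c.v_out, hv⟩)
    · rintro (rfl | rfl)
      · exact Or.inl (c.base_v h)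
      · exact Or.inr (Or.inl (c.base_t hM h))
  have hself : ∀ x, x ∈ (a.overtake M α u v t k (Function.update a.wk α (some t))).own α ↔
      x ∈ a.own α ∨ x = v ∨ x = t := by
    intro x; rw [mem_overtake_own_self, hbel]
  have hother : ∀ γ, γ ≠ α → ∀ x,
      x ∈ (a.overtake M α u v t k (Function.update a.wk α (some t))).own γ ↔ x ∈ a.own γ := by
    intro γ hγ x
    rw [mem_overtake_own_ne hγ, hbel]
    refine and_iff_left_of_imp fun h1 => ?_
    rintro (rfl | rfl)
    · exact hvo γ h1
    · exact hto' γ h1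
  have hα : (ScaledMatching.overtakeNew st α u v t k).struc α =
      ⟨(st.struc α).verts ∪ {v, t}, (st.struc α).arcs ∪ {(u, v), (v, t)},
        (st.struc α).blossoms ∪ {Blossom.triv v, Blossom.triv t}, some (st.root t)⟩ := by
    simp [ScaledMatching.overtakeNew, State.setStruc, State.setLabel]
  have hγ : ∀ {γ}, γ ≠ α →
      (ScaledMatching.overtakeNew st α u v t k).struc γ = st.struc γ := by
    intro γ hγ
    simp [ScaledMatching.overtakeNew, State.setStruc, State.setLabel, hγ]
  refine r.overtake_of hM h c rfl rfl rfl ?_ ?_ ?_ ?_ ?_ ?_ ?_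
  · change insert α st.modified = _
    rw [r.modified]
    ext γ
    simp [hvo γ, or_comm]
  · intro γ
    ext x
    by_cases hg : γ = α
    · subst hg
      rw [hself, hα, r.verts]; rfl
    · rw [hother γ hg, hγ hg, r.verts]
  · intro γ
    by_cases hg : γ = α
    · subst hg
      rw [hα, Function.update_self, r.root hM h]; rfl
    · rw [hγ hg, Function.update_of_ne hg, r.work]
  · intro γ x y hne
    by_cases hg : γ = α
    · subst hg
      rw [hself, hself, hα]
      change ((x, y) ∈ (st.struc γ).arcs ∨ (x, y) = (u, v) ∨ (x, y) = (v, t)) ↔ _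
      rw [r.arcs γ x y hne, Prod.mk.injEq, Prod.mk.injEq]
      constructor
      · rintro (⟨h1, h2, h3⟩ | ⟨rfl, rfl⟩ | ⟨rfl, rfl⟩)
        · refine ⟨Or.inl h1, Or.inl h2, ?_⟩
          rcases h3 with h3 | h3
          · exact Or.inl ⟨fun h4 => hv (h4 ▸ h3.1), h3⟩
          · exact Or.inr (Or.inl h3)
        · exact ⟨Or.inl c.u_own, Or.inr (Or.inl rfl), Or.inr (Or.inr (Or.inl ⟨rfl, rfl⟩))⟩
        · exact ⟨Or.inr (Or.inl rfl), Or.inr (Or.inr rfl), Or.inr (Or.inr (Or.inr ⟨rfl, rfl⟩))⟩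
      · rintro ⟨h1, h2, ⟨h3, h4, h5⟩ | ⟨h3, h4⟩ | h3 | h3⟩
        · have hy : y ∈ a.own γ := by
            rcases h2 with h2 | rfl | rfl
            · exact h2
            · exact absurd rfl h3
            · exact absurd h4 (c.t_inn hM h)
          exact Or.inl ⟨h5 ▸ h.own_par h4 hy, hy, Or.inl ⟨h4, h5⟩⟩
        · have hx : x ∈ a.own γ := by
            rcases h1 with h1 | rfl | rfl
            · exact h1
            · exact absurd h3 hv
            · exact absurd h3 (c.t_inn hM h)
          exact Or.inl ⟨hx, h4 ▸ h.own_mate hx (h.inn_cov h3), Or.inr ⟨h3, h4⟩⟩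
        · exact Or.inr (Or.inl h3)
        · exact Or.inr (Or.inr h3)
    · rw [hother γ hg, hother γ hg, hγ hg, r.arcs γ x y hne]
      constructor
      · rintro ⟨h1, h2, h3 | h3⟩
        · exact ⟨h1, h2, Or.inl ⟨fun h4 => hv (h4 ▸ h3.1), h3⟩⟩
        · exact ⟨h1, h2, Or.inr (Or.inl h3)⟩
      · rintro ⟨h1, h2, h3 | h3 | ⟨-, rfl⟩ | ⟨rfl, -⟩⟩
        · exact ⟨h1, h2, Or.inl h3.2⟩
        · exact ⟨h1, h2, Or.inr h3⟩
        · exact absurd h2 (hvo γ)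
        · exact absurd h1 (hvo γ)
  · intro γ x y hxy
    by_cases hg : γ = α
    · subst hg
      rw [hα] at hxy
      rw [hself, hself]
      change ((x, y) ∈ (st.struc γ).arcs ∨ (x, y) = (u, v) ∨ (x, y) = (v, t)) at hxy
      rw [Prod.mk.injEq, Prod.mk.injEq] at hxy
      rcases hxy with h1 | ⟨rfl, rfl⟩ | ⟨rfl, rfl⟩
      · have := r.arc_own h1
        exact ⟨Or.inl this.1, Or.inl this.2.1, Or.inl ⟨γ, h1⟩⟩
      · exact ⟨Or.inl c.u_own, Or.inr (Or.inl rfl), Or.inr (Or.inl ⟨rfl, rfl⟩)⟩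
      · exact ⟨Or.inr (Or.inl rfl), Or.inr (Or.inr rfl), Or.inr (Or.inr ⟨rfl, rfl⟩)⟩
    · rw [hγ hg] at hxy
      rw [hother γ hg, hother γ hg]
      have := r.arc_own hxy
      exact ⟨this.1, this.2.1, Or.inl ⟨γ, hxy⟩⟩
  · intro γ B hB
    by_cases hg : γ = α
    · subst hg
      rw [hα] at hB
      rcases hB with hB | rfl | rfl
      · exact ⟨fun x hx => (hself x).2 (Or.inl (r.blossom_own hB hx)), Or.inl ⟨γ, hB⟩⟩
      · exact ⟨fun x hx => (hself x).2 (Or.inr (Or.inl hx)), Or.inr ⟨_, rfl⟩⟩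
      · exact ⟨fun x hx => (hself x).2 (Or.inr (Or.inr hx)), Or.inr ⟨_, rfl⟩⟩
    · rw [hγ hg] at hB
      exact ⟨fun x hx => (hother γ hg x).2 (r.blossom_own hB hx), Or.inl ⟨γ, hB⟩⟩
  · intro γ x hx hxo
    have hold : x ∈ a.own γ → x ∈ a.out → ∃ B ∈ (st.struc γ).blossoms,
        B.verts = {y | a.base y = a.base x} ∧ ∃ β, x ∈ a.own β ∧ x ∈ a.out ∧
        B ∈ (st.struc β).blossoms ∧ ∀ y ∈ B.verts, EvenPath G M B.edges B.verts (a.base x) y := by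
      intro h1 h2
      obtain ⟨B, h3, h4, h5⟩ := r.blossom_out h1 h2
      exact ⟨B, h3, h4, γ, h1, h2, h3, h5⟩
    by_cases hg : γ = α
    · subst hg
      rw [hself] at hx
      rw [hα]
      rcases hx with hx | rfl | rfl
      · have hxo' : x ∈ a.out := hxo.resolve_right fun h' => hto' γ (by rwa [← h'])
        obtain ⟨B, h3, h4, h5⟩ := hold hx hxo'
        exact ⟨B, Or.inl h3, h4, Or.inl h5⟩
      · exact absurd (hxo.resolve_right (c.v_ne_t hM h)) c.v_out
      · refine ⟨Blossom.triv x, Or.inr (Or.inr rfl), ?_, Or.inr ⟨rfl, rfl⟩⟩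
        ext y
        change y = x ↔ a.base y = a.base x
        rw [c.base_t hM h]
        exact ⟨fun h' => by rw [h']; exact c.base_t hM h, hbase y⟩
    · rw [hother γ hg] at hx
      rw [hγ hg]
      have hxo' : x ∈ a.out := hxo.resolve_right fun h' => hto' γ (by rwa [← h'])
      obtain ⟨B, h3, h4, h5⟩ := hold hx hxo'
      exact ⟨B, h3, h4, Or.inl h5⟩

open Classical in
theorem overtakeSame (hv : v ∈ a.own α) : Rep G M (overtakeSame st α u v t (a.par v) k)
    (a.overtake M α u v t k (Function.update a.wk α (some t))) := by
  have hvi : v ∈ a.inn := (h.own_mem hv).resolve_left c.v_out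
  have hto : t ∈ a.out := (c.t_out_iff hM h).2 hvi
  have hbel : ∀ {x}, a.Below M v t (a.base x) → x ∈ a.own α := by
    intro x hx
    have hx' : x ∈ a.out ∨ x ∈ a.inn := by
      rcases c.below_mem hM h hx with rfl | rfl | h1
      · exact Or.inr hvi
      · exact Or.inl hto
      · exact h1
    obtain ⟨γ, hγ⟩ := h.mem_own hx'
    rwa [h.own_disj hv (c.below_own hM h hx hγ)]
  have hown : ∀ γ, ∀ x,
      x ∈ (a.overtake M α u v t k (Function.update a.wk α (some t))).own γ ↔ x ∈ a.own γ := by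
    intro γ x
    by_cases hg : γ = α
    · subst hg
      rw [mem_overtake_own_self]
      exact or_iff_left_of_imp hbel
    · rw [mem_overtake_own_ne hg]
      exact and_iff_left_of_imp fun h1 h2 => hg (h.own_disj h1 (hbel h2))
  have hα : (ScaledMatching.overtakeSame st α u v t (a.par v) k).struc α =
      ⟨(st.struc α).verts, ((st.struc α).arcs \ {(a.par v, v)}) ∪ {(u, v)},
        (st.struc α).blossoms, some (st.root t)⟩ := by
    simp [ScaledMatching.overtakeSame, State.setStruc, State.setLabel]
  have hγ : ∀ {γ}, γ ≠ α →
      (ScaledMatching.overtakeSame st α u v t (a.par v) k).struc γ = st.struc γ := by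
    intro γ hγ
    simp [ScaledMatching.overtakeSame, State.setStruc, State.setLabel, hγ]
  have hblossoms : ∀ γ, ((ScaledMatching.overtakeSame st α u v t (a.par v) k).struc γ).blossoms =
      (st.struc γ).blossoms := by
    intro γ
    by_cases hg : γ = α
    · subst hg; rw [hα]
    · rw [hγ hg]
  have hvt : v ∉ a.out ∧ t ∉ a.inn := ⟨c.v_out, c.t_inn hM h⟩
  refine r.overtake_of hM h c rfl rfl rfl ?_ ?_ ?_ ?_ ?_ ?_ ?_
  · change insert α st.modified = _
    rw [r.modified]
    ext γ
    have : v ∈ a.own γ → γ = α := fun h1 => h.own_disj h1 hv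
    simp only [Set.mem_insert_iff, Set.mem_union, Set.mem_singleton_iff, Set.mem_ofPred_eq]
    tauto
  · intro γ
    ext x
    rw [hown]
    by_cases hg : γ = α
    · subst hg; rw [hα, r.verts]
    · rw [hγ hg, r.verts]
  · intro γ
    by_cases hg : γ = α
    · subst hg
      rw [hα, Function.update_self, r.root hM h]; rfl
    · rw [hγ hg, Function.update_of_ne hg, r.work]
  · intro γ x y hne
    rw [hown, hown]
    by_cases hg : γ = α
    · subst hg
      rw [hα]
      change (((x, y) ∈ (st.struc γ).arcs ∧ ¬ (x, y) = (a.par v, v)) ∨ (x, y) = (u, v)) ↔ _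
      rw [r.arcs γ x y hne, Prod.mk.injEq, Prod.mk.injEq]
      constructor
      · rintro (⟨⟨h1, h2, h3⟩, h4⟩ | ⟨rfl, rfl⟩)
        · refine ⟨h1, h2, ?_⟩
          rcases h3 with h3 | h3
          · exact Or.inl ⟨fun h5 => h4 ⟨by rw [h3.2, h5], h5⟩, h3⟩
          · exact Or.inr (Or.inl h3)
        · exact ⟨c.u_own, hv, Or.inr (Or.inr (Or.inl ⟨rfl, rfl⟩))⟩
      · rintro ⟨h1, h2, ⟨h3, h4, h5⟩ | ⟨h3, h4⟩ | h3 | ⟨rfl, rfl⟩⟩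
        · exact Or.inl ⟨⟨h1, h2, Or.inl ⟨h4, h5⟩⟩, fun h6 => h3 h6.2⟩
        · refine Or.inl ⟨⟨h1, h2, Or.inr ⟨h3, h4⟩⟩, fun h6 => hvt.2 ?_⟩
          rw [h6.2] at h4
          rwa [← c.mate, h4, hM.mate_mate]
        · exact Or.inr h3
        · refine Or.inl ⟨⟨h1, h2, Or.inr ⟨hvi, c.mate.symm⟩⟩, fun h6 => c.v_ne_t hM h h6.2.symm⟩
    · rw [hγ hg, r.arcs γ x y hne]
      constructor
      · rintro ⟨h1, h2, h3 | h3⟩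
        · exact ⟨h1, h2, Or.inl ⟨fun h4 => hg (h.own_disj (h4 ▸ h2) hv), h3⟩⟩
        · exact ⟨h1, h2, Or.inr (Or.inl h3)⟩
      · rintro ⟨h1, h2, h3 | h3 | ⟨-, rfl⟩ | ⟨rfl, -⟩⟩
        · exact ⟨h1, h2, Or.inl h3.2⟩
        · exact ⟨h1, h2, Or.inr h3⟩
        · exact absurd (h.own_disj h2 hv) hg
        · exact absurd (h.own_disj h1 hv) hg
  · intro γ x y hxy
    rw [hown, hown]
    by_cases hg : γ = α
    · subst hg
      rw [hα] at hxy
      rcases hxy with ⟨h1, -⟩ | h1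
      · have := r.arc_own h1
        exact ⟨this.1, this.2.1, Or.inl ⟨γ, h1⟩⟩
      · obtain ⟨rfl, rfl⟩ := Prod.mk.inj h1
        exact ⟨c.u_own, hv, Or.inr (Or.inl ⟨rfl, rfl⟩)⟩
    · rw [hγ hg] at hxy
      have := r.arc_own hxy
      exact ⟨this.1, this.2.1, Or.inl ⟨γ, hxy⟩⟩
  · intro γ B hB
    rw [hblossoms] at hB
    exact ⟨fun x hx => (hown γ x).2 (r.blossom_own hB hx), Or.inl ⟨γ, hB⟩⟩
  · intro γ x hx hxo
    rw [hown] at hx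
    have hxo' : x ∈ a.out := hxo.elim id fun h' => by rw [h']; exact hto
    obtain ⟨B, h3, h4, h5⟩ := r.blossom_out hx hxo'
    exact ⟨B, by rwa [hblossoms], h4, Or.inl ⟨γ, hx, hxo', h3, h5⟩⟩

end Rep

end ScaledMatching

namespace ScaledMatching

variable {V : Type*}

namespace Rep

open AState

variable {G : SimpleGraph V} {M : Set (Sym2 V)} {st : State V} {a : AState V} {l : ℕ}
variable (hM : IsMatchingSet G M) (h : a.Valid M G l) (r : Rep G M st a)
  {α u v t : V} {k : ℕ} (c : a.OvertakeAt M G α u v t)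
include hM h r c

/-- The moved set is a union of classes of equal base, so every blossom of `S_β` goes over entirely
or stays entirely. -/
theorem overtakeOther {β : V} (hv : v ∈ a.own β) (hβ : β ≠ α) {wk' : V → Option V}
    (hw : ((∃ w, a.wk β = some w ∧ a.Anc M t w) ∧ wk' α = a.wk β ∧
        wk' β = some (a.base (a.par v)) ∧ ∀ γ ≠ α, γ ≠ β → wk' γ = a.wk γ) ∨
      ((¬ ∃ w, a.wk β = some w ∧ a.Anc M t w) ∧ wk' α = some t ∧ ∀ γ ≠ α, wk' γ = a.wk γ)) :
    Rep G M (overtakeOther st α β u v t (a.par v) k) (a.overtake M α u v t k wk') := by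
  classical
  have hvi : v ∈ a.inn := (h.own_mem hv).resolve_left c.v_out
  have hto : t ∈ a.out := (c.t_out_iff hM h).2 hvi
  have htβ : t ∈ a.own β := c.mate ▸ h.own_mate hv c.v_cov
  have hvt := c.v_ne_t hM h
  set X : Set V := {x | a.Below M v t (a.base x)} with hX
  have hXβ : ∀ {x}, x ∈ X → x ∈ a.own β := by
    intro x hx
    have hx' : x ∈ a.out ∨ x ∈ a.inn := by
      rcases c.below_mem hM h hx with rfl | rfl | h1
      · exact Or.inr hvi
      · exact Or.inl hto
      · exact h1
    obtain ⟨γ, hγ⟩ := h.mem_own hx'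
    rwa [h.own_disj hv (c.below_own hM h hx hγ)]
  have hvX : v ∈ X := Or.inl (c.base_v h)
  have htX : t ∈ X := Or.inr (Or.inl (c.base_t hM h))
  have hXeq : {x | x ∈ (st.struc β).verts ∧ st.Ancestor β (st.root v) (st.root x)} = X := by
    ext x
    have hanc : ∀ y, a.Below M v t y ↔ a.Anc M v y := by
      intro y
      refine ⟨?_, fun h1 => Or.inr (Or.inr h1)⟩
      rintro (rfl | rfl | h1)
      · exact Relation.ReflTransGen.refl
      · have := child_mate hM h hvi
        rw [c.mate] at this
        exact Relation.ReflTransGen.single this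
      · exact h1
    change x ∈ (st.struc β).verts ∧ st.Ancestor β (st.root v) (st.root x) ↔ a.Below M v t (a.base x)
    rw [r.verts, hanc]
    constructor
    · rintro ⟨h1, h2⟩
      rwa [r.ancestor_iff hM h h1, c.base_v h] at h2
    · intro h1
      have h2 : x ∈ a.own β := hXβ (Or.inr (Or.inr h1))
      refine ⟨h2, ?_⟩
      rwa [r.ancestor_iff hM h h2, c.base_v h]
  have hXbase : ∀ {x y}, x ∈ X → a.base x = a.base y → y ∈ X := by
    intro x y hx hxy
    change a.Below M v t (a.base y)
    rw [← hxy]; exact hx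
  -- the edges of the forest do not leave the subtree, except for the one that is replaced
  have hpar : ∀ {y}, y ≠ v → y ∈ a.inn → (a.par y ∈ X ↔ y ∈ X) := by
    intro y hy hyi
    have h1 := child_par h hyi
    have hyb := h.base_not (h.inn_not hyi)
    constructor
    · intro h2
      have := c.below_child hM h h1 h2
      change a.Below M v t (a.base y)
      rwa [hyb]
    · intro h2
      change a.Below M v t (a.base y) at h2
      rw [hyb] at h2
      exact c.below_parent hM h h1 h2 hy
  have hmate : ∀ {x}, mate M x ∈ X ↔ x ∈ X := fun {x} => c.below_mate_iff hM h
  have hparv : a.par v ∉ X := by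
    intro h1
    rcases h1 with h1 | h1 | h1
    · exact c.v_out (h1 ▸ h.base_out (h.par_out hvi))
    · refine c.not_anc_par hM h hvi ?_
      rw [h1]
      have := child_mate hM h hvi
      rw [c.mate] at this
      exact Relation.ReflTransGen.single this
    · exact c.not_anc_par hM h hvi h1
  have hself : ∀ x, x ∈ (a.overtake M α u v t k wk').own α ↔ x ∈ a.own α ∨ x ∈ X :=
    fun x => mem_overtake_own_self
  have hne' : ∀ {γ}, γ ≠ α → ∀ x, x ∈ (a.overtake M α u v t k wk').own γ ↔
      x ∈ a.own γ ∧ x ∉ X := fun hγ x => mem_overtake_own_ne hγ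
  have hother : ∀ {γ}, γ ≠ α → γ ≠ β → ∀ x, x ∈ (a.overtake M α u v t k wk').own γ ↔
      x ∈ a.own γ := by
    intro γ h1 h2 x
    rw [hne' h1]
    exact and_iff_left_of_imp fun h3 h4 => h2 (h.own_disj h3 (hXβ h4))
  have hαX : ∀ {x}, x ∈ a.own α → x ∉ X := fun h1 h2 => hβ (h.own_disj (hXβ h2) h1)
  have hcond : (∃ W, (st.struc β).work = some W ∧ st.Ancestor β (st.root t) W) ↔
      ∃ w, a.wk β = some w ∧ a.Anc M t w := by
    rw [r.work]
    constructor
    · rintro ⟨W, h1, h2⟩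
      obtain ⟨w, h3, rfl⟩ := Option.map_eq_some_iff.1 h1
      refine ⟨w, h3, ?_⟩
      rwa [← r.root hM h, r.ancestor_iff hM h (h.wk_own h3), c.base_t hM h, h.wk_base h3] at h2
    · rintro ⟨w, h1, h2⟩
      refine ⟨st.root w, by rw [h1, r.root hM h]; rfl, ?_⟩
      rwa [r.ancestor_iff hM h (h.wk_own h1), c.base_t hM h, h.wk_base h1]
  set A : Set (V × V) := {e | e ∈ (st.struc β).arcs ∧ e.1 ∈ X ∧ e.2 ∈ X} with hA
  set Q : Set (Blossom V) := {B | B ∈ (st.struc β).blossoms ∧ B.verts ⊆ X} with hQ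
  have hstβ : (ScaledMatching.overtakeOther st α β u v t (a.par v) k).struc β =
      ⟨(st.struc β).verts \ X, ((st.struc β).arcs \ {(a.par v, v)}) \ A,
        (st.struc β).blossoms \ Q,
        if (∃ W, (st.struc β).work = some W ∧ st.Ancestor β (st.root t) W) then
          some (st.root (a.par v)) else (st.struc β).work⟩ := by
    rw [hQ, hA, ← hXeq]
    simp [ScaledMatching.overtakeOther, State.setStruc, State.setLabel]
  have hstα : (ScaledMatching.overtakeOther st α β u v t (a.par v) k).struc α =
      ⟨(st.struc α).verts ∪ X, (st.struc α).arcs ∪ {(u, v)} ∪ A, (st.struc α).blossoms ∪ Q,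
        if (∃ W, (st.struc β).work = some W ∧ st.Ancestor β (st.root t) W) then
          (st.struc β).work else some (st.root t)⟩ := by
    rw [hQ, hA, ← hXeq]
    simp [ScaledMatching.overtakeOther, State.setStruc, State.setLabel, hβ.symm]
  have hstγ : ∀ {γ}, γ ≠ α → γ ≠ β →
      (ScaledMatching.overtakeOther st α β u v t (a.par v) k).struc γ = st.struc γ := by
    intro γ h1 h2
    simp [ScaledMatching.overtakeOther, State.setStruc, State.setLabel, h1, h2]
  refine r.overtake_of hM h c rfl rfl rfl ?_ ?_ ?_ ?_ ?_ ?_ ?_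
  · change st.modified ∪ {α, β} = _
    rw [r.modified]
    ext γ
    have : v ∈ a.own γ ↔ γ = β := ⟨fun h1 => h.own_disj h1 hv, fun h1 => h1 ▸ hv⟩
    simp only [Set.mem_insert_iff, Set.mem_union, Set.mem_singleton_iff, Set.mem_ofPred_eq, this]
    tauto
  · intro γ
    ext x
    by_cases hg : γ = α
    · subst hg; rw [hself, hstα, r.verts]; rfl
    by_cases hg' : γ = β
    · subst hg'; rw [hne' hg, hstβ, r.verts]; rfl
    · rw [hother hg hg', hstγ hg hg', r.verts]
  · intro γ
    rcases hw with ⟨hc, h1, h2, h3⟩ | ⟨hc, h1, h2⟩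
    · by_cases hg : γ = α
      · subst hg; rw [hstα, h1, ← r.work]; exact if_pos (hcond.2 hc)
      by_cases hg' : γ = β
      · subst hg'; rw [hstβ, h2]
        refine (if_pos (hcond.2 hc)).trans ?_
        rw [r.root hM h]
        simp only [Option.map_some, h.base_base]
      · rw [hstγ hg hg', h3 γ hg hg', r.work]
    · by_cases hg : γ = α
      · subst hg; rw [hstα, h1]
        refine (if_neg (mt hcond.1 hc)).trans ?_
        rw [r.root hM h]; rfl
      rw [h2 γ hg, ← r.work]
      by_cases hg' : γ = β
      · subst hg'; rw [hstβ]; exact if_neg (mt hcond.1 hc)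
      · rw [hstγ hg hg']
  · intro γ x y hne
    have hold : ∀ {γ}, (x, y) ∈ (st.struc γ).arcs ↔ x ∈ a.own γ ∧ y ∈ a.own γ ∧
        ((y ∈ a.inn ∧ x = a.par y) ∨ (x ∈ a.inn ∧ y = mate M x)) := r.arcs _ x y hne
    by_cases hg : γ = α
    · subst hg
      rw [hstα, hself, hself]
      change (((x, y) ∈ (st.struc γ).arcs ∨ (x, y) = (u, v)) ∨
        ((x, y) ∈ (st.struc β).arcs ∧ x ∈ X ∧ y ∈ X)) ↔ _
      rw [Prod.mk.injEq]
      constructor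
      · rintro ((h1 | ⟨rfl, rfl⟩) | ⟨h1, h2, h3⟩)
        · obtain ⟨h1, h2, h3⟩ := hold.1 h1
          refine ⟨Or.inl h1, Or.inl h2, h3.imp (fun h4 => ⟨?_, h4⟩) Or.inl⟩
          rintro rfl
          exact hαX h2 hvX
        · exact ⟨Or.inl c.u_own, Or.inr hvX, Or.inr (Or.inr (Or.inl ⟨rfl, rfl⟩))⟩
        · obtain ⟨-, -, h4⟩ := hold.1 h1
          refine ⟨Or.inr h2, Or.inr h3, h4.imp (fun h4 => ⟨?_, h4⟩) Or.inl⟩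
          rintro rfl
          exact hparv (h4.2 ▸ h2)
      · rintro ⟨h1, h2, ⟨h3, h4, h5⟩ | ⟨h3, h4⟩ | h3 | ⟨h3, h4⟩⟩
        · rcases h2 with h2 | h2
          · exact Or.inl (Or.inl (hold.2 ⟨h5 ▸ h.own_par h4 h2, h2, Or.inl ⟨h4, h5⟩⟩))
          · exact Or.inr ⟨hold.2 ⟨h5 ▸ h.own_par h4 (hXβ h2), hXβ h2, Or.inl ⟨h4, h5⟩⟩,
              h5 ▸ (hpar h3 h4).2 h2, h2⟩
        · rcases h1 with h1 | h1
          · exact Or.inl (Or.inl (hold.2 ⟨h1, h4 ▸ h.own_mate h1 (h.inn_cov h3),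
              Or.inr ⟨h3, h4⟩⟩))
          · exact Or.inr ⟨hold.2 ⟨hXβ h1, h4 ▸ h.own_mate (hXβ h1) (h.inn_cov h3),
              Or.inr ⟨h3, h4⟩⟩, h1, h4 ▸ hmate.2 h1⟩
        · exact Or.inl (Or.inr h3)
        · rw [h3, h4]
          rw [h3, h4] at hold
          exact Or.inr ⟨hold.2 ⟨hv, htβ, Or.inr ⟨hvi, c.mate.symm⟩⟩, hvX, htX⟩
    by_cases hg' : γ = β
    · subst hg'
      rw [hstβ, hne' hg, hne' hg]
      change (((x, y) ∈ (st.struc γ).arcs ∧ ¬ (x, y) = (a.par v, v)) ∧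
        ¬ ((x, y) ∈ (st.struc γ).arcs ∧ x ∈ X ∧ y ∈ X)) ↔ _
      rw [Prod.mk.injEq]
      constructor
      · rintro ⟨⟨h1, h2⟩, h3⟩
        have h4 : ¬ (x ∈ X ∧ y ∈ X) := fun h4 => h3 ⟨h1, h4⟩
        obtain ⟨h5, h6, ⟨h7, h8⟩ | ⟨h7, h8⟩⟩ := hold.1 h1
        · have hyv : y ≠ v := fun h9 => h2 ⟨by rw [h8, h9], h9⟩
          have h9 := hpar hyv h7
          rw [← h8] at h9
          exact ⟨⟨h5, fun hx => h4 ⟨hx, h9.1 hx⟩⟩, ⟨h6, fun hy => h4 ⟨h9.2 hy, hy⟩⟩,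
            Or.inl ⟨hyv, h7, h8⟩⟩
        · have h9 := hmate (x := x)
          rw [← h8] at h9
          exact ⟨⟨h5, fun hx => h4 ⟨hx, h9.2 hx⟩⟩, ⟨h6, fun hy => h4 ⟨h9.1 hy, hy⟩⟩,
            Or.inr (Or.inl ⟨h7, h8⟩)⟩
      · rintro ⟨⟨h1, h2⟩, ⟨h3, h4⟩, h5⟩
        have hyv : y ≠ v := fun h' => h4 (h' ▸ hvX)
        refine ⟨⟨hold.2 ⟨h1, h3, ?_⟩, fun h6 => hyv h6.2⟩, fun h6 => h4 h6.2.2⟩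
        rcases h5 with h5 | h5 | h5 | h5
        · exact Or.inl h5.2
        · exact Or.inr h5
        · exact absurd h5.2 hyv
        · exact absurd (h5.1 ▸ hvX) h2
    · rw [hstγ hg hg', hother hg hg', hother hg hg', hold]
      have hγv : v ∉ a.own γ := fun h1 => hg' (h.own_disj h1 hv)
      constructor
      · rintro ⟨h1, h2, h3 | h3⟩
        · exact ⟨h1, h2, Or.inl ⟨fun h4 => hγv (h4 ▸ h2), h3⟩⟩
        · exact ⟨h1, h2, Or.inr (Or.inl h3)⟩
      · rintro ⟨h1, h2, h3 | h3 | ⟨-, rfl⟩ | ⟨rfl, -⟩⟩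
        · exact ⟨h1, h2, Or.inl h3.2⟩
        · exact ⟨h1, h2, Or.inr h3⟩
        · exact absurd h2 hγv
        · exact absurd h1 hγv
  · intro γ x y hxy
    by_cases hg : γ = α
    · subst hg
      rw [hstα] at hxy
      rw [hself, hself]
      rcases hxy with (h1 | h1) | ⟨h1, h2, h3⟩
      · have := r.arc_own h1
        exact ⟨Or.inl this.1, Or.inl this.2.1, Or.inl ⟨γ, h1⟩⟩
      · obtain ⟨rfl, rfl⟩ := Prod.mk.inj h1
        exact ⟨Or.inl c.u_own, Or.inr hvX, Or.inr (Or.inl ⟨rfl, rfl⟩)⟩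
      · exact ⟨Or.inr h2, Or.inr h3, Or.inl ⟨β, h1⟩⟩
    by_cases hg' : γ = β
    · subst hg'
      rw [hstβ] at hxy
      obtain ⟨⟨h1, h2⟩, h3⟩ := hxy
      have h2' : ¬ (x = a.par v ∧ y = v) := fun h' => h2 (by rw [h'.1, h'.2]; rfl)
      have h3' : ¬ (x ∈ X ∧ y ∈ X) := fun h' => h3 ⟨h1, h'⟩
      have h4 := r.arc_own h1
      refine ⟨?_, ?_, Or.inl ⟨γ, h1⟩⟩ <;> rw [hne' hg]
      all_goals
        by_cases hb : a.base x = a.base y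
        · first
            | exact ⟨h4.1, fun h5 => h3' ⟨h5, hXbase h5 hb⟩⟩
            | exact ⟨h4.2.1, fun h5 => h3' ⟨hXbase h5 hb.symm, h5⟩⟩
        · obtain ⟨-, -, ⟨h7, h8⟩ | ⟨h7, h8⟩⟩ := (r.arcs γ x y hb).1 h1
          · have hyv : y ≠ v := fun h9 => h2' ⟨by rw [h8, h9], h9⟩
            have h9 := hpar hyv h7
            rw [← h8] at h9
            first
              | exact ⟨h4.1, fun hx => h3' ⟨hx, h9.1 hx⟩⟩
              | exact ⟨h4.2.1, fun hy => h3' ⟨h9.2 hy, hy⟩⟩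
          · have h9 := hmate (x := x)
            rw [← h8] at h9
            first
              | exact ⟨h4.1, fun hx => h3' ⟨hx, h9.2 hx⟩⟩
              | exact ⟨h4.2.1, fun hy => h3' ⟨h9.1 hy, hy⟩⟩
    · rw [hstγ hg hg'] at hxy
      rw [hother hg hg', hother hg hg']
      have := r.arc_own hxy
      exact ⟨this.1, this.2.1, Or.inl ⟨γ, hxy⟩⟩
  · intro γ B hB
    by_cases hg : γ = α
    · subst hg
      rw [hstα] at hB
      rcases hB with hB | hB
      · exact ⟨fun x hx => (hself x).2 (Or.inl (r.blossom_own hB hx)), Or.inl ⟨γ, hB⟩⟩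
      · exact ⟨fun x hx => (hself x).2 (Or.inr (hB.2 hx)), Or.inl ⟨β, hB.1⟩⟩
    by_cases hg' : γ = β
    · subst hg'
      rw [hstβ] at hB
      refine ⟨fun x hx => (hne' hg x).2 ⟨r.blossom_own hB.1 hx, fun h1 => hB.2 ⟨hB.1, ?_⟩⟩,
        Or.inl ⟨γ, hB.1⟩⟩
      intro y hy
      exact hXbase h1 (r.blossom_base hB.1 hx hy)
    · rw [hstγ hg hg'] at hB
      exact ⟨fun x hx => (hother hg hg' x).2 (r.blossom_own hB hx), Or.inl ⟨γ, hB⟩⟩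
  · intro γ x hx hxo
    have hxo' : x ∈ a.out := hxo.elim id fun h' => by rw [h']; exact hto
    by_cases hg : γ = α
    · subst hg
      rw [hself] at hx
      rw [hstα]
      rcases hx with hx | hx
      · obtain ⟨B, h3, h4, h5⟩ := r.blossom_out hx hxo'
        exact ⟨B, Or.inl h3, h4, Or.inl ⟨γ, hx, hxo', h3, h5⟩⟩
      · obtain ⟨B, h3, h4, h5⟩ := r.blossom_out (hXβ hx) hxo'
        refine ⟨B, Or.inr ⟨h3, ?_⟩, h4, Or.inl ⟨β, hXβ hx, hxo', h3, h5⟩⟩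
        intro y hy
        rw [h4] at hy
        exact hXbase hx hy.symm
    by_cases hg' : γ = β
    · subst hg'
      rw [hne' hg] at hx
      rw [hstβ]
      obtain ⟨B, h3, h4, h5⟩ := r.blossom_out hx.1 hxo'
      refine ⟨B, ⟨h3, fun h6 => hx.2 (h6.2 ?_)⟩, h4, Or.inl ⟨γ, hx.1, hxo', h3, h5⟩⟩
      rw [h4]; rfl
    · rw [hother hg hg'] at hx
      rw [hstγ hg hg']
      obtain ⟨B, h3, h4, h5⟩ := r.blossom_out hx hxo'
      exact ⟨B, h3, h4, Or.inl ⟨γ, hx, hxo', h3, h5⟩⟩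

/-- Every outcome of `Overtake` is described by `AState.overtake`. -/
theorem overtake {st' : State V} (hst : Overtake M st α u v t k st') :
    ∃ wk', a.OvertakeWork M α v t wk' ∧ Rep G M st' (a.overtake M α u v t k wk') := by
  classical
  have hanc : ∀ {γ w}, a.wk γ = some w → a.Anc M t w → v ∈ a.own γ := by
    intro γ w h1 h2
    have h3 := (h2.own hM h).2 (h.wk_own h1)
    rw [← c.mate] at h3
    exact own_of_mate hM h h3
  have hupd : (∀ γ ≠ α, ∀ w, a.wk γ = some w → ¬ a.Anc M t w) →
      a.OvertakeWork M α v t (Function.update a.wk α (some t)) := by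
    intro h1
    exact Or.inl ⟨Function.update_self .., fun γ hγ => ⟨Function.update_of_ne hγ .., h1 γ hγ⟩⟩
  cases hst with
  | new h1 =>
    have hv : v ∉ a.inn := by
      intro h2
      obtain ⟨β, hβ⟩ := h.mem_own (Or.inr h2)
      exact h1 β ((r.mate_arc_iff hM h c).2 hβ)
    refine ⟨_, hupd ?_, r.overtakeNew hM h c hv⟩
    intro γ _ w h3 h4
    exact (h.own_mem (hanc h3 h4)).elim c.v_out hv
  | same p h1 hp =>
    obtain ⟨-, rfl⟩ := r.parent_eq hM h c hp.1 hp.2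
    have hv := (r.mate_arc_iff hM h c).1 h1
    refine ⟨_, hupd ?_, r.overtakeSame hM h c hv⟩
    intro γ hγ w h3 h4
    exact hγ (h.own_disj (hanc h3 h4) hv)
  | other β p hβ h1 hp =>
    obtain ⟨hvi, rfl⟩ := r.parent_eq hM h c hp.1 hp.2
    have hv := (r.mate_arc_iff hM h c).1 h1
    by_cases hc : ∃ w, a.wk β = some w ∧ a.Anc M t w
    · obtain ⟨w, h3, h4⟩ := hc
      refine ⟨Function.update (Function.update a.wk β (some (a.base (a.par v)))) α (some w),
        Or.inr ⟨β, w, hβ, h3, h4, hvi, Function.update_self .., ?_, ?_⟩,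
        r.overtakeOther hM h c hv hβ (Or.inl ⟨⟨w, h3, h4⟩, ?_, ?_, ?_⟩)⟩
      · rw [Function.update_of_ne hβ, Function.update_self]
      · intro γ h5 h6
        rw [Function.update_of_ne h5, Function.update_of_ne h6]
      · rw [Function.update_self, h3]
      · rw [Function.update_of_ne hβ, Function.update_self]
      · intro γ h5 h6
        rw [Function.update_of_ne h5, Function.update_of_ne h6]
    · refine ⟨_, hupd ?_, r.overtakeOther hM h c hv hβ (Or.inr ⟨hc, Function.update_self ..,
        fun γ hγ => Function.update_of_ne hγ ..⟩)⟩
      intro γ hγ w h3 h4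
      obtain rfl := h.own_disj (hanc h3 h4) hv
      exact hc ⟨w, h3, h4⟩

/-- If some structure contains `v`, then `v` is inner there, and its tree arc is unmatched because
its partner `t` lies below it. -/
theorem exists_overtake : ∃ st', Overtake M st α u v t k st' := by
  by_cases hv : ∃ β, v ∈ a.own β
  · obtain ⟨β, hβ⟩ := hv
    have hvi : v ∈ a.inn := (h.own_mem hβ).resolve_left c.v_out
    have hne : a.base (a.par v) ≠ a.base v := by
      rw [c.base_v h]
      intro h1
      exact c.v_out (h1 ▸ h.base_out (h.par_out hvi))
    have hp : (a.par v, v) ∈ (st.struc β).arcs ∧ s(a.par v, v) ∉ M := by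
      constructor
      · rw [r.arcs β _ _ hne]
        exact ⟨h.own_par hvi hβ, hβ, Or.inl ⟨hvi, rfl⟩⟩
      · intro h1
        have h2 := hM.mate_eq' h1
        rw [c.mate] at h2
        refine c.not_anc_par hM h hvi ?_
        rw [← h2, c.base_t hM h]
        have := child_mate hM h hvi
        rw [c.mate] at this
        exact Relation.ReflTransGen.single this
    have ha := (r.mate_arc_iff hM h c).2 hβ
    by_cases hg : β = α
    · subst hg
      exact ⟨_, Overtake.same _ ha hp⟩
    · exact ⟨_, Overtake.other β _ hg ha hp⟩
  · exact ⟨_, Overtake.new fun β hβ => hv ⟨β, (r.mate_arc_iff hM h c).1 hβ⟩⟩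

end Rep

end ScaledMatching

namespace ScaledMatching

variable {V : Type*}

open AState

/-! ### The effect of a step on a state and its description -/

/-- The paths found so far augment the matching `n` times, and at most `d * n` vertices have been
removed. -/
def Augments (G : SimpleGraph V) (M : Set (Sym2 V)) (st : State V) (R : Set V) (d n : ℕ) : Prop :=
  IsMatchingSet G (symmDiff M (Set.sUnion st.paths)) ∧
    covered M ⊆ covered (symmDiff M (Set.sUnion st.paths)) ∧
    (covered (symmDiff M (Set.sUnion st.paths))).ncard = (covered M).ncard + 2 * n ∧
    R.ncard ≤ d * n ∧ ∀ e ∈ Set.sUnion st.paths, ∀ x ∈ e, x ∈ R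

/-- The invariants of a phase that every step preserves. -/
structure Good (G : SimpleGraph V) (M : Set (Sym2 V)) (E H : ℕ) (st : State V) (a : AState V) :
    Prop where
  rep : Rep G M st a
  valid : a.Valid M G (3 * E)
  sized : a.Sized M (3 * E) H
  augments : ∃ n, Augments G M st a.removed (2 * (18 * H * E + 2)) n

/-- Structures that are neither on hold nor modified are small. -/
def AState.Light (a : AState V) (H : ℕ) : Prop :=
  ∀ γ, γ ∉ a.modified → γ ∉ a.onHold → (a.own γ).ncard ≤ 6 * H

/-- The arc `(u, v)` from an outer vertex `u` does not call for an operation. -/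
def AState.Settled (M : Set (Sym2 V)) (a : AState V) (u v : V) : Prop :=
  v ∈ a.removed ∨ v ∈ a.out ∨ a.lab (v, mate M v) ≤ a.D M (a.base u) + 1

variable [Fintype V] {G : SimpleGraph V} {M : Set (Sym2 V)} {E H : ℕ} {st : State V} {a : AState V}
variable (hM : IsMatchingSet G M)
include hM

/-- A structure is the subtree of its root, which has distance zero. -/
theorem own_ncard_le {l : ℕ} (h : a.Valid M G l) (hs : a.Sized M l H) (α : V) :
    (a.own α).ncard ≤ 6 * H * l + 2 := by
  by_cases hα : ∃ x, x ∈ a.own α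
  · obtain ⟨x, hx⟩ := hα
    obtain ⟨h1, h2⟩ := h.own_root hx
    have hαo : α ∈ a.out := (h.own_mem h1).resolve_right fun hi => h.inn_cov hi h2
    have h3 := hs α (Or.inl hαo) (h.out_free hαo h2)
    rw [D_free hαo h2, Nat.sub_zero] at h3
    refine (Set.ncard_le_ncard (fun y hy => ?_) (Set.toFinite _)).trans h3
    exact root_anc hM h hy
  · rw [Set.eq_empty_of_forall_notMem (not_exists.1 hα), Set.ncard_empty]
    exact Nat.zero_le _

namespace Good

variable (g : Good G M E H st a)
include g

/-- Earlier paths live on removed vertices and the new path on the two structures, hence they are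
disjoint. The new path is therefore still augmenting after the earlier ones have been applied, and
it adds two covered vertices against two removed structures. -/
theorem augment {α β u v : V} (hu : u ∈ a.own α) (hv : v ∈ a.own β) {p : G.Walk α β}
    (hp : IsLiftedPath M st u v p) :
    Good G M E H (ScaledMatching.augment st α β {e | e ∈ p.edges}) (a.remove α β) := by
  refine ⟨g.rep.augment hM g.valid α β _, remove_valid hM g.valid, remove_sized hM g.valid g.sized,
    ?_⟩
  obtain ⟨n, h1, h2, h3, h4, h5⟩ := g.augments
  set F := Set.sUnion st.paths with hF
  set P : Set (Sym2 V) := {e | e ∈ p.edges} with hP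
  have hsupp : ∀ {y}, y ∈ p.support → y ∉ a.removed := by
    intro y hy hr
    rcases g.rep.liftedPath_support hM g.valid hu hv hp hy with h6 | h6
    · exact g.valid.removed_own hr h6
    · exact g.valid.removed_own hr h6
  have hPF : ∀ e ∈ P, e ∉ F := by
    intro e he heF
    induction e with
    | _ x y =>
      exact hsupp (p.fst_mem_support_of_mem_edges he) (h5 _ heF x (Sym2.mem_mk_left x y))
  have hfree : ∀ {x}, x ∉ a.removed → Free M x → Free (symmDiff M F) x := by
    intro x hx hf e he hxe
    rcases he with he | he
    · exact hf e he.1 hxe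
    · exact hx (h5 e he.1 x hxe)
  have hα := hfree (hsupp p.start_mem_support) hp.1.2.2.1
  have hβ := hfree (hsupp p.end_mem_support) hp.1.2.2.2.1
  have halt : AltWalk (symmDiff M F) false p := by
    refine hp.1.altWalk.congr p fun e he => ?_
    have := hPF e he
    rw [Set.mem_symmDiff]
    tauto
  obtain ⟨h6, h7⟩ := h1.symmDiff_path p.length p le_rfl hp.1.1 hp.1.2.1 hα hβ halt
  have heq : symmDiff M (Set.sUnion (ScaledMatching.augment st α β P).paths) =
      symmDiff (symmDiff M F) P := by
    have : Set.sUnion (ScaledMatching.augment st α β P).paths = P ∪ F := Set.sUnion_insert _ _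
    rw [this]
    ext e
    have := hPF e
    simp only [Set.mem_symmDiff, Set.mem_union]
    tauto
  refine ⟨n + 1, ?_, ?_, ?_, ?_, ?_⟩
  · rw [heq]; exact h6
  · rw [heq, h7]; exact h2.trans Set.subset_union_left
  · rw [heq, h7, Set.ncard_union_eq ?_ (Set.toFinite _) (Set.toFinite _),
      Set.ncard_pair hp.1.2.1, h3]
    · ring
    · rw [Set.disjoint_left]
      rintro x hx (rfl | rfl)
      · exact hx hα
      · exact hx hβ
  · change (a.removed ∪ (a.own α ∪ a.own β)).ncard ≤ _
    have e1 := Set.ncard_union_le a.removed (a.own α ∪ a.own β)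
    have e2 := Set.ncard_union_le (a.own α) (a.own β)
    have e3 := own_ncard_le hM g.valid g.sized α
    have e4 := own_ncard_le hM g.valid g.sized β
    have e5 : 6 * H * (3 * E) = 18 * H * E := by ring
    rw [e5] at e3 e4
    rw [mul_add, mul_one]
    omega
  · intro e he x hx
    have he' : e ∈ P ∪ F := by
      have : Set.sUnion (ScaledMatching.augment st α β P).paths = P ∪ F := Set.sUnion_insert _ _
      rwa [this] at he
    rcases he' with he' | he'
    · refine Or.inr (g.rep.liftedPath_support hM g.valid hu hv hp ?_)
      exact p.mem_support_of_mem_edges he' hx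
    · exact Or.inl (h5 e he' x hx)

theorem contract {α u v : V} (hu : u ∈ a.own α) (hv : v ∈ a.own α) (hvo : v ∈ a.out)
    (hne : a.base u ≠ a.base v) (hw : a.wk α = some (a.base u)) (huv : G.Adj u v) :
    ∃ a', Good G M E H (ScaledMatching.contract M st α u v) a' ∧ a.Adv M a' ∧
      a'.phi M + 1 ≤ a.phi M ∧ α ∈ a'.modified := by
  obtain ⟨L, h1, h2, h3⟩ := exists_lowest hM g.valid hu hv
  have c : a.ContractAt M α u v L := ⟨hu, hv, base_mem_out g.valid (g.valid.wk_out hw), hvo, hne,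
    hw, h1, h2, h3⟩
  exact ⟨_, ⟨g.rep.contract hM g.valid c huv, contract_valid hM g.valid c,
    contract_sized hM g.valid c g.sized, g.augments⟩, contract_adv hM g.valid c,
    contract_phi hM g.valid c, Or.inl rfl⟩

theorem overtake {α u v t : V} {d : ℕ} {st' : State V} (c : a.OvertakeAt M G α u v t)
    (hd : d = a.D M (a.base u)) (hα : α ∉ a.modified) (hsm : (a.own α).ncard ≤ 6 * H)
    (hst : Overtake M st α u v t (d + 1) st') :
    ∃ a', Good G M E H st' a' ∧ a.Adv M a' ∧ α ∈ a'.modified := by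
  obtain ⟨wk', h1, h2⟩ := g.rep.overtake hM g.valid c hst
  have hk : d + 1 = a.D M (a.base u) + 1 := by rw [hd]
  refine ⟨_, ⟨h2, overtake_valid hM g.valid c hk h1, overtake_sized hM g.valid c g.sized hsm hk,
    ?_⟩, overtake_adv hM g.valid c hk h1 hα, Or.inl (Or.inr rfl)⟩
  obtain ⟨n, h3⟩ := g.augments
  have h4 : st'.paths = st.paths := by cases hst <;> rfl
  refine ⟨n, ?_⟩
  rw [Augments, h4]
  exact h3

theorem considered_iff {α u v : V} : Considered M st u v α ↔
    v ∉ a.removed ∧ a.base u ≠ a.base v ∧ s(u, v) ∉ M ∧ u ∈ a.own α ∧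
      a.wk α = some (a.base u) ∧ α ∉ a.modified ∧ α ∉ a.onHold := by
  rw [Considered, g.rep.removed, ne_eq, g.rep.root_eq_iff hM g.valid, g.rep.verts,
    g.rep.work_iff hM g.valid, g.rep.modified, g.rep.onHold]
  constructor
  · rintro ⟨-, h⟩; exact h
  · intro h; exact ⟨fun hr => g.valid.removed_own hr h.2.2.2.1, h⟩

omit g in
theorem outer_iff_out (g : Good G M E H st a) {v : V} :
    (∀ β, ¬ st.Outer β (st.root v)) ↔ v ∉ a.out := by
  constructor
  · intro h1 h2
    obtain ⟨β, hβ⟩ := g.valid.mem_own (Or.inl h2)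
    exact h1 β ((g.rep.outer_iff hM g.valid).2 ⟨hβ, h2⟩)
  · intro h1 β h2
    exact h1 ((g.rep.outer_iff hM g.valid).1 h2).2

theorem not_free_of_not_out {v : V} (hv : v ∉ a.out) (hr : v ∉ a.removed) : ¬ Free M v := by
  intro hf
  exact (g.valid.own_mem (g.valid.free_own hf hr)).elim hv fun hi => g.valid.inn_cov hi hf

theorem exists_extendStep {u v : V} (huv : G.Adj u v) : ∃ st', ExtendStep G M st (u, v) st' := by
  by_cases hc : ∃ α, Considered M st u v α
  swap
  · exact ⟨_, ExtendStep.skip u v (not_exists.1 hc)⟩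
  obtain ⟨α, hα⟩ := hc
  obtain ⟨h1, h2, h3, h4, h5, h6, h7⟩ := (g.considered_iff hM).1 hα
  have huo : u ∈ a.out := base_mem_out g.valid (g.valid.wk_out h5)
  by_cases hvo : v ∈ a.out
  · obtain ⟨β, hβ⟩ := g.valid.mem_own (Or.inl hvo)
    have ho := (g.rep.outer_iff hM g.valid).2 ⟨hβ, hvo⟩
    have hv : v ∈ (st.struc β).verts := by rwa [g.rep.verts]
    by_cases hne : β = α
    · subst hne
      exact ⟨_, ExtendStep.contract u v β hα hv ho⟩
    · obtain ⟨p, hp⟩ := g.rep.exists_liftedPath hM g.valid (Ne.symm hne) h4 huo hβ hvo huv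
      exact ⟨_, ExtendStep.augment u v α β hα hne hv ho p hp⟩
  · have ho := (g.outer_iff_out hM).2 hvo
    have hvc := g.not_free_of_not_out hM hvo h1
    have hd := (g.rep.distance_iff hM g.valid huo).2 rfl
    by_cases hl : a.D M (a.base u) + 1 < st.label (v, mate M v)
    · have c : a.OvertakeAt M G α u v (mate M v) :=
        ⟨h4, huo, h5, hvo, hvc, rfl, h1, huv, by rwa [g.rep.label] at hl⟩
      obtain ⟨st', hst⟩ := g.rep.exists_overtake hM g.valid c
      exact ⟨_, ExtendStep.overtake u v α _ _ st' hα ho (mate_mem hvc) hd hl hst⟩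
    · exact ⟨_, ExtendStep.ignore u v α _ _ hα ho (mate_mem hvc) hd hl⟩

/-- If an operation was performed, the structure that holds `u` is modified or gone and the last
claim is empty. Otherwise the failed test shows why the arc called for nothing. -/
theorem extendStep (hl : a.Light H) {u v : V} (huv : G.Adj u v) {st' : State V}
    (hst : ExtendStep G M st (u, v) st') : ∃ a', Good G M E H st' a' ∧ a.Adv M a' ∧
      ∀ γ, γ ∉ a'.modified → γ ∉ a'.onHold → a'.wk γ = some (a'.base u) → a'.Settled M u v := by
  cases hst with
  | skip _ _ hs =>
    refine ⟨a, g, Adv.refl, fun γ h1 h2 h3 => ?_⟩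
    have huo : u ∈ a.out := base_mem_out g.valid (g.valid.wk_out h3)
    by_cases hr : v ∈ a.removed
    · exact Or.inl hr
    by_cases hb : a.base u = a.base v
    · exact Or.inr (Or.inl (base_mem_out g.valid (hb ▸ g.valid.wk_out h3)))
    by_cases huM : s(u, v) ∈ M
    -- A matched arc out of an outer vertex to one that is not outer leads from the base to its
    -- inner partner, and both have the same distance.
    · by_cases hvo : v ∈ a.out
      · exact Or.inr (Or.inl hvo)
      have h4 := hM.mate_eq huM
      have h5 := mate_out_of_out g.valid huo (by rwa [h4])
      refine Or.inr (Or.inr ?_)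
      rw [h5.1, D_out huo (not_free_left huM), h4, hM.mate_eq' huM]
      exact Nat.le_succ _
    · exact absurd ((g.considered_iff hM).2 ⟨hr, hb, huM,
        own_of_base g.valid (g.valid.wk_own h3), h3, h1, h2⟩) (hs γ)
  | contract _ _ α h hv ho =>
    obtain ⟨h1, h2, h3, h4, h5, h6, h7⟩ := (g.considered_iff hM).1 h
    rw [g.rep.outer_iff hM g.valid] at ho
    obtain ⟨a', e1, e2, -, e3⟩ := g.contract hM h4 ho.1 ho.2 h2 h5 huv
    refine ⟨a', e1, e2, fun γ f1 f2 f3 => ?_⟩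
    have f4 := e1.valid.wk_own f3
    rw [e2.own_eq f1] at f4
    rw [e2.wk_eq f1] at f3
    have f5 : u ∈ a.own γ := by
      rw [← e2.own_eq f1]
      exact own_of_base e1.valid (by rwa [e2.own_eq f1])
    exact absurd (g.valid.own_disj h4 f5 ▸ e3) f1
  | augment _ _ α β h hβ hv ho p hp =>
    obtain ⟨h1, h2, h3, h4, h5, h6, h7⟩ := (g.considered_iff hM).1 h
    rw [g.rep.outer_iff hM g.valid] at ho
    refine ⟨_, g.augment hM h4 ho.1 hp, remove_adv hM g.valid, fun γ f1 f2 f3 => ?_⟩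
    have f4 := own_of_base (remove_valid hM g.valid) ((remove_valid hM g.valid).wk_own f3)
    exact absurd (Or.inl h4) (remove_own_not hM g.valid f4).2
  | overtake _ _ α t d _ h ho ht hd hlt hst =>
    obtain ⟨h1, h2, h3, h4, h5, h6, h7⟩ := (g.considered_iff hM).1 h
    have hvo := (g.outer_iff_out hM).1 ho
    have huo : u ∈ a.out := base_mem_out g.valid (g.valid.wk_out h5)
    have hd' := (g.rep.distance_iff hM g.valid huo).1 hd
    have c : a.OvertakeAt M G α u v t :=
      ⟨h4, huo, h5, hvo, not_free_left ht, hM.mate_eq ht, h1, huv, by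
        rwa [g.rep.label, hd'] at hlt⟩
    obtain ⟨a', e1, e2, e3⟩ := g.overtake hM c hd' h6 (hl α h6 h7) hst
    refine ⟨a', e1, e2, fun γ f1 f2 f3 => ?_⟩
    have f5 : u ∈ a.own γ := by
      rw [← e2.own_eq f1]
      exact own_of_base e1.valid (e1.valid.wk_own f3)
    exact absurd (g.valid.own_disj h4 f5 ▸ e3) f1
  | ignore _ _ α t d h ho ht hd hlt =>
    obtain ⟨h1, h2, h3, h4, h5, h6, h7⟩ := (g.considered_iff hM).1 h
    refine ⟨a, g, Adv.refl, fun γ f1 f2 f3 => Or.inr (Or.inr ?_)⟩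
    have huo : u ∈ a.out := base_mem_out g.valid (g.valid.wk_out h5)
    have hd' := (g.rep.distance_iff hM g.valid huo).1 hd
    rw [g.rep.label, hd'] at hlt
    rw [hM.mate_eq ht]
    omega

theorem contractStep_iff {st' : State V} : ContractStep G M st st' ↔
    ∃ α u v, G.Adj u v ∧ u ∈ a.own α ∧ v ∈ a.own α ∧ a.wk α = some (a.base u) ∧
      a.base v ≠ a.base u ∧ v ∈ a.out ∧ st' = ScaledMatching.contract M st α u v := by
  unfold ContractStep
  simp only [g.rep.verts, g.rep.work_iff hM g.valid, ne_eq, g.rep.root_eq_iff hM g.valid,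
    g.rep.outer_iff hM g.valid]
  constructor
  · rintro ⟨α, u, v, h1, h2, h3, h4, h5, h6, h7⟩
    exact ⟨α, u, v, h1, h2, h3, h4, h5, h6.2, h7⟩
  · rintro ⟨α, u, v, h1, h2, h3, h4, h5, h6, h7⟩
    exact ⟨α, u, v, h1, h2, h3, h4, h5, ⟨h3, h6⟩, h7⟩

theorem contractStep {st' : State V} (hst : ContractStep G M st st') :
    ∃ a', Good G M E H st' a' ∧ a.Adv M a' ∧ a'.phi M + 1 ≤ a.phi M := by
  obtain ⟨α, u, v, h1, h2, h3, h4, h5, h6, rfl⟩ := (g.contractStep_iff hM).1 hst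
  obtain ⟨a', e1, e2, e3, -⟩ := g.contract hM h2 h3 h6 h5.symm h4 h1
  exact ⟨a', e1, e2, e3⟩

omit g in
-- The label sum drops with every contraction, so the loop stops.
theorem exists_contractAll (n : ℕ) : ∀ {st : State V} {a : AState V}, Good G M E H st a →
    a.phi M ≤ n → ∃ st', ContractAll G M st st' := by
  induction n with
  | zero =>
    intro st a g hn
    refine ⟨st, Relation.ReflTransGen.refl, fun st'' hst => ?_⟩
    obtain ⟨a', -, -, h⟩ := g.contractStep hM hst
    omega
  | succ n ih =>
    intro st a g hn
    by_cases hs : ∃ st'', ContractStep G M st st''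
    · obtain ⟨st'', hst⟩ := hs
      obtain ⟨a', g', -, h⟩ := g.contractStep hM hst
      obtain ⟨st', h1, h2⟩ := ih g' (by omega)
      exact ⟨st', Relation.ReflTransGen.head hst h1, h2⟩
    · exact ⟨st, Relation.ReflTransGen.refl, not_exists.1 hs⟩

omit g in
theorem contractAll_aux {st st' : State V} {a : AState V} (g : Good G M E H st a)
    (hst : Relation.ReflTransGen (ContractStep G M) st st') :
    ∃ a', Good G M E H st' a' ∧ a.Adv M a' := by
  induction hst with
  | refl => exact ⟨a, g, Adv.refl⟩
  | tail _ h ih =>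
    obtain ⟨b, g1, h1⟩ := ih
    obtain ⟨c, g2, h2, -⟩ := g1.contractStep hM h
    exact ⟨c, g2, h1.trans g2.valid h2⟩

/-- After the contractions, no arc joins the working vertex of a structure to another outer vertex
of the same structure. -/
theorem contractAll {st' : State V} (hst : ContractAll G M st st') :
    ∃ a', Good G M E H st' a' ∧ a.Adv M a' ∧ ∀ α u v, G.Adj u v → u ∈ a'.own α → v ∈ a'.own α →
      a'.wk α = some (a'.base u) → v ∈ a'.out → a'.base u = a'.base v := by
  obtain ⟨a', g', h⟩ := g.contractAll_aux hM hst.1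
  refine ⟨a', g', h, fun α u v h1 h2 h3 h4 h5 => ?_⟩
  by_contra hne
  exact hst.2 _ ((g'.contractStep_iff hM).2 ⟨α, u, v, h1, h2, h3, h4, Ne.symm hne, h5, rfl⟩)

theorem joins_iff {u v α β : V} : Joins st u v α β ↔
    α ≠ β ∧ u ∈ a.own α ∧ u ∈ a.out ∧ v ∈ a.own β ∧ v ∈ a.out := by
  simp only [Joins, g.rep.verts, g.rep.outer_iff hM g.valid]
  tauto

theorem exists_augmentStep {u v : V} (huv : G.Adj u v) :
    ∃ st', AugmentStep G M st (u, v) st' := by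
  by_cases hc : ∃ α β, Joins st u v α β
  · obtain ⟨α, β, hj⟩ := hc
    obtain ⟨h1, h2, h3, h4, h5⟩ := (g.joins_iff hM).1 hj
    obtain ⟨p, hp⟩ := g.rep.exists_liftedPath hM g.valid h1 h2 h3 h4 h5 huv
    exact ⟨_, AugmentStep.augment u v α β hj p hp⟩
  · exact ⟨_, AugmentStep.skip u v fun α β h => hc ⟨α, β, h⟩⟩

/-- During this pass the outer set only shrinks and its blossoms do not change, so an arc that
caused no conflict when read causes none later. -/
theorem augmentStep {u v : V} {st' : State V} (hst : AugmentStep G M st (u, v) st') :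
    ∃ a', Good G M E H st' a' ∧ a.Adv M a' ∧
      (∀ x α, x ∈ a'.out → x ∈ a'.own α → x ∈ a.out ∧ x ∈ a.own α ∧ a'.base x = a.base x) ∧
      ∀ α β, u ∈ a'.out → v ∈ a'.out → u ∈ a'.own α → v ∈ a'.own β → α = β := by
  cases hst with
  | skip _ _ hs =>
    refine ⟨a, g, Adv.refl, fun x α h1 h2 => ⟨h1, h2, rfl⟩, fun α β h1 h2 h3 h4 => ?_⟩
    by_contra hne
    exact hs α β ((g.joins_iff hM).2 ⟨hne, h3, h1, h4, h2⟩)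
  | augment _ _ α β h p hp =>
    obtain ⟨h1, h2, h3, h4, h5⟩ := (g.joins_iff hM).1 h
    refine ⟨_, g.augment hM h2 h4 hp, remove_adv hM g.valid, ?_, ?_⟩
    · intro x γ f1 f2
      exact ⟨f1.1, (mem_remove_own.1 f2).1, remove_base_neg f1.2⟩
    · intro γ δ f1
      exact absurd (Or.inl h2) f1.2

end Good

end ScaledMatching

namespace ScaledMatching

variable {V : Type*}

open AState

/-! ### Iterated steps -/

/-- Existence of a run and the invariant along all runs are proved together, since the next step is
possible only from states that satisfy the invariant. The prefix condition lets a step know its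
position in the list. -/
theorem iterate_of_prefix {σ A : Type*} {step : σ → A → σ → Prop} (I : List A → σ → Prop)
    (full : List A) (h : ∀ pre x s, pre ++ [x] <+: full → I pre s → (∃ s', step s x s') ∧
      ∀ s', step s x s' → I (pre ++ [x]) s') (l : List A) : ∀ (pre : List A) (s : σ),
      pre ++ l = full → I pre s →
      (∃ s', Iterate step l s s') ∧ ∀ s', Iterate step l s s' → I full s' := by
  induction l with
  | nil =>
    intro pre s hl hs
    refine ⟨⟨s, rfl⟩, ?_⟩
    rintro s' rfl
    rwa [← hl, List.append_nil]
  | cons x l ih =>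
    intro pre s hl hs
    have hl' : (pre ++ [x]) ++ l = full := by rw [← hl, List.append_assoc]; rfl
    obtain ⟨⟨m, hm⟩, h2⟩ := h pre x s ⟨l, hl'⟩ hs
    refine ⟨?_, ?_⟩
    · obtain ⟨⟨s', hs'⟩, -⟩ := ih _ m hl' (h2 m hm)
      exact ⟨s', m, hm, hs'⟩
    · rintro s' ⟨m, hm, hs'⟩
      exact (ih _ m hl' (h2 m hm)).2 s' hs'

/-- An invariant that depends on the items read so far. -/
theorem iterate_spec {σ A : Type*} {step : σ → A → σ → Prop} (I : List A → σ → Prop)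
    (l : List A) (h : ∀ pre x s, x ∈ l → I pre s → (∃ s', step s x s') ∧
      ∀ s', step s x s' → I (pre ++ [x]) s') (s : σ) (hs : I [] s) :
    (∃ s', Iterate step l s s') ∧ ∀ s', Iterate step l s s' → I l s' :=
  iterate_of_prefix I l (fun pre x s hx => h pre x s (hx.subset (by simp))) l [] s rfl hs

namespace AState

/-- The description with other working vertices and other marks. -/
def marked (a : AState V) (wk' : V → Option V) (hold mod : Set V) : AState V :=
  { a with wk := wk', onHold := hold, modified := mod }

variable {G : SimpleGraph V} {M : Set (Sym2 V)} {a : AState V} {l : ℕ}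

theorem marked_valid (h : a.Valid M G l) {wk' : V → Option V} {hold mod : Set V}
    (hw : ∀ {α w}, wk' α = some w → w ∈ a.own α ∧ w ∈ a.out ∧ a.base w = w) :
    (a.marked wk' hold mod).Valid M G l where
  base_base := h.base_base
  base_out := h.base_out
  base_not := h.base_not
  inn_not := h.inn_not
  inn_cov := h.inn_cov
  inn_mate := h.inn_mate
  inn_mate_base := h.inn_mate_base
  out_free := h.out_free
  out_mate := h.out_mate
  base_mate := h.base_mate
  par_out := h.par_out
  par_adj := h.par_adj
  par_lt := h.par_lt
  lab_le := h.lab_le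
  lab_top := h.lab_top
  own_disj := h.own_disj
  own_mem := h.own_mem
  mem_own := h.mem_own
  own_base := h.own_base
  own_mate := h.own_mate
  own_par := h.own_par
  own_free := h.own_free
  own_root := h.own_root
  free_own := h.free_own
  removed_own := h.removed_own
  removed_mate := h.removed_mate
  wk_own := fun h' => (hw h').1
  wk_out := fun h' => (hw h').2.1
  wk_base := fun h' => (hw h').2.2

theorem marked_rep {st : State V} (r : Rep G M st a) {wk' : V → Option V} {hold mod : Set V}
    {w : V → Option (Set V)} (hw : ∀ α, w α = (wk' α).map fun w => {x | a.base x = a.base w}) :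
    Rep G M { st with
      struc := fun α => { st.struc α with work := w α }
      onHold := hold
      modified := mod } (a.marked wk' hold mod) where
  verts := r.verts
  label := r.label
  removed := r.removed
  onHold := rfl
  modified := rfl
  work := hw
  arcs := r.arcs
  arc_own := r.arc_own
  blossom_own := r.blossom_own
  blossom_base := r.blossom_base
  blossom_edges := r.blossom_edges
  blossom_out := r.blossom_out

/-! ### Backtracking -/

variable (M a) in
open Classical in
/-- The working vertices after `Backtrack`. -/
noncomputable def backWk (γ : V) : Option V :=
  if γ ∈ a.onHold ∨ γ ∈ a.modified then a.wk γ else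
    (a.wk γ).bind fun w => if Free M w then none else some (a.base (a.par (mate M w)))

variable (M a) in
/-- The description after `Backtrack`. -/
noncomputable def back : AState V := a.marked (a.backWk M) a.onHold a.modified

variable (M a) in
/-- The active structures that backtrack. -/
def stuck : Set V := {γ | γ ∈ a.active ∧ γ ∉ a.onHold ∧ γ ∉ a.modified}

theorem backWk_eq_some {γ w' : V} : a.backWk M γ = some w' ↔
    ((γ ∈ a.onHold ∨ γ ∈ a.modified) ∧ a.wk γ = some w') ∨
      (¬ (γ ∈ a.onHold ∨ γ ∈ a.modified) ∧ ∃ w, a.wk γ = some w ∧ ¬ Free M w ∧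
        w' = a.base (a.par (mate M w))) := by
  by_cases hγ : γ ∈ a.onHold ∨ γ ∈ a.modified
  · simp [backWk, hγ]
  · rw [backWk, if_neg hγ, Option.bind_eq_some_iff]
    simp only [hγ, false_and, false_or, not_false_eq_true, true_and]
    refine exists_congr fun w => and_congr_right fun _ => ?_
    by_cases hf : Free M w
    · simp [hf]
    · simp [hf, eq_comm]

variable (hM : IsMatchingSet G M) (h : a.Valid M G l)
include hM h

/-- The working vertex moves two steps up. -/
theorem child_child_wk {γ w : V} (hw : a.wk γ = some w) (hf : ¬ Free M w) :
    a.Child M (mate M w) w ∧ a.Child M (a.base (a.par (mate M w))) (mate M w) ∧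
      mate M w ∈ a.inn := by
  have h1 := h.base_mate (h.wk_out hw) hf (h.wk_base hw)
  refine ⟨?_, child_par h h1, h1⟩
  have := child_mate hM h h1
  rwa [hM.mate_mate] at this

theorem back_wk_prop {γ w' : V} (hw : a.backWk M γ = some w') :
    ∃ w, a.wk γ = some w ∧ a.Anc M w' w ∧ w' ∈ a.own γ ∧ w' ∈ a.out ∧ a.base w' = w' := by
  rcases backWk_eq_some.1 hw with ⟨-, h1⟩ | ⟨-, w, h1, h2, rfl⟩
  · exact ⟨w', h1, Relation.ReflTransGen.refl, h.wk_own h1, h.wk_out h1, h.wk_base h1⟩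
  · obtain ⟨e1, e2, e3⟩ := child_child_wk hM h h1 h2
    have e4 : a.Anc M (a.base (a.par (mate M w))) w := (Relation.ReflTransGen.single e2).tail e1
    exact ⟨w, h1, e4, (e4.own hM h).2 (h.wk_own h1), h.base_out (h.par_out e3), h.base_base _⟩

theorem back_valid : (a.back M).Valid M G l :=
  marked_valid h fun hw => by
    obtain ⟨w, -, -, h1⟩ := back_wk_prop hM h hw
    exact h1

theorem back_active : (a.back M).active ⊆ a.active := by
  rintro γ ⟨w', hw⟩
  obtain ⟨w, h1, -⟩ := back_wk_prop hM h hw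
  exact ⟨w, h1⟩

theorem back_act : (a.back M).Act M ⊆ a.Act M := by
  rintro b ⟨h1, h2, γ, w', h3, h4⟩
  obtain ⟨w, h5, h6, -⟩ := back_wk_prop hM h h3
  exact ⟨h1, h2, γ, w, h5, Relation.ReflTransGen.trans h4 h6⟩

/-- Only old working vertices leave the active paths. -/
theorem back_act_of {b : V} (hb : b ∈ a.Act M) (hn : b ∉ (a.back M).Act M) :
    ∃ γ, γ ∉ a.modified ∧ γ ∉ a.onHold ∧ a.wk γ = some b := by
  obtain ⟨h1, h2, γ, w, h3, h4⟩ := hb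
  by_cases hγ : γ ∈ a.onHold ∨ γ ∈ a.modified
  · exact absurd ⟨h1, h2, γ, w, backWk_eq_some.2 (Or.inl ⟨hγ, h3⟩), h4⟩ hn
  by_cases hbw : b = w
  · exact ⟨γ, fun h' => hγ (Or.inr h'), fun h' => hγ (Or.inl h'), hbw ▸ h3⟩
  by_cases hf : Free M w
  · rcases h4.tail_cases with h5 | ⟨p, -, hp⟩
    · exact absurd h5 hbw
    · exact absurd hf (hp.not_free h)
  · obtain ⟨e1, e2, e3⟩ := child_child_wk hM h h3 hf
    have h5 : a.Anc M b (mate M w) := h4.of_child h hbw e1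
    have h6 := h5.of_child h (fun h' => h.inn_not e3 (h' ▸ h1)) e2
    exact absurd ⟨h1, h2, γ, _, backWk_eq_some.2 (Or.inr ⟨hγ, w, h3, hf, rfl⟩), h6⟩ hn

/-- A structure that backtracks either has its root as working vertex and becomes inactive, or its
working vertex leaves the active paths. Working vertices of different structures are distinct, so
these losses add up. -/
theorem back_count [Fintype V] :
    (a.back M).active.ncard + ((a.back M).ActN M).ncard + a.stuck.ncard ≤
      a.active.ncard + (a.ActN M).ncard := by
  classical
  set R : Set V := {γ ∈ a.stuck | ∃ w, a.wk γ = some w ∧ Free M w} with hR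
  set N : Set V := {γ ∈ a.stuck | ∃ w, a.wk γ = some w ∧ ¬ Free M w} with hN
  have h1 : a.stuck ⊆ R ∪ N := by
    intro γ hγ
    obtain ⟨w, hw⟩ := hγ.1
    by_cases hf : Free M w
    · exact Or.inl ⟨hγ, w, hw, hf⟩
    · exact Or.inr ⟨hγ, w, hw, hf⟩
  have h2 : (a.back M).active.ncard + R.ncard ≤ a.active.ncard := by
    rw [← Set.ncard_union_eq ?_ (Set.toFinite _) (Set.toFinite _)]
    · refine Set.ncard_le_ncard ?_ (Set.toFinite _)
      rintro γ (hγ | hγ)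
      · exact back_active hM h hγ
      · exact hγ.1.1
    · rw [Set.disjoint_left]
      rintro γ ⟨w', hw'⟩ ⟨⟨-, h3, h4⟩, w, hw, hf⟩
      rcases backWk_eq_some.1 hw' with ⟨h5, -⟩ | ⟨-, w₁, h5, h6, -⟩
      · exact h5.elim h3 h4
      · rw [hw] at h5
        exact h6 (Option.some.inj h5 ▸ hf)
  have h3 : ((a.back M).ActN M).ncard + N.ncard ≤ (a.ActN M).ncard := by
    have h4 : N.ncard ≤ (a.ActN M \ (a.back M).ActN M).ncard := by
      -- Each member of `N` is sent to its working vertex; the default value never occurs.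
      refine Set.ncard_le_ncard_of_injOn (fun γ => (a.wk γ).getD γ) ?_ ?_ (Set.toFinite _)
      · rintro γ ⟨⟨-, e1, e2⟩, w, hw, hf⟩
        simp only [hw, Option.getD_some]
        refine ⟨⟨⟨h.wk_out hw, h.wk_base hw, γ, w, hw, Relation.ReflTransGen.refl⟩, hf⟩, ?_⟩
        rintro ⟨⟨-, -, δ, w', hw', e3⟩, -⟩
        have e4 : a.Anc M w w' := e3
        obtain ⟨-, -, -, e5, -⟩ := back_wk_prop hM h hw'
        obtain rfl := h.own_disj (h.wk_own hw) ((e4.own hM h).2 e5)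
        rcases backWk_eq_some.1 hw' with ⟨e6, -⟩ | ⟨-, w₁, e6, e7, rfl⟩
        · exact e6.elim e1 e2
        · rw [hw] at e6
          obtain rfl := Option.some.inj e6
          obtain ⟨f1, f2, -⟩ := child_child_wk hM h hw hf
          have f3 := f1.rank_lt hM h
          have f4 := f2.rank_lt hM h
          rcases e4.rank_lt hM h with f5 | f5
          · rw [← f5] at f4; omega
          · omega
      · rintro γ ⟨-, w, hw, -⟩ δ ⟨-, w', hw', -⟩ he
        simp only [hw, hw', Option.getD_some] at he
        exact h.own_disj (h.wk_own hw) (he ▸ h.wk_own hw')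
    have h5 : (a.back M).ActN M ⊆ a.ActN M := fun x hx => ⟨back_act hM h hx.1, hx.2⟩
    have h6 := Set.ncard_sdiff_add_ncard_of_subset h5 (Set.toFinite _)
    omega
  have h4 := (Set.ncard_le_ncard h1 (Set.toFinite _)).trans (Set.ncard_union_le _ _)
  omega

/-- Parents are unique, so the relation has exactly one outcome; this gives existence as well. -/
theorem backtracksTo_iff {st : State V} (r : Rep G M st a) (α : V) (w : Option (Set V)) :
    BacktracksTo st α w ↔ w = (a.backWk M α).map fun w => {x | a.base x = a.base w} := by
  unfold BacktracksTo
  rw [r.onHold, r.modified, r.work]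
  by_cases hα : α ∈ a.onHold ∨ α ∈ a.modified
  · rw [backWk, if_pos hα]
    tauto
  have hα' : α ∉ a.onHold ∧ α ∉ a.modified := not_or.1 hα
  rw [backWk, if_neg hα]
  cases hw : a.wk α with
  | none => simp
  | some w₀ =>
    have hwo := h.wk_own hw
    have hwb := h.wk_base hw
    have hroot : {x | a.base x = a.base w₀} = st.root w₀ := (r.root hM h w₀).symm
    have hαo := h.own_root hwo
    have hαb : a.base α = α := by
      rcases h.own_mem hαo.1 with h1 | h1
      · exact h.out_free h1 hαo.2
      · exact absurd hαo.2 (h.inn_cov h1)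
    have hWα : st.root w₀ = st.root α ↔ Free M w₀ := by
      rw [r.root_eq_iff hM h, hwb, hαb]
      exact ⟨fun h' => h' ▸ hαo.2, h.own_free hwo⟩
    simp only [Option.map_some, hα'.1, hα'.2, Option.bind_some, reduceCtorEq, or_false, false_and,
      false_or, not_false_eq_true, true_and, Option.some.injEq, exists_eq_left', hroot, ne_eq, hWα]
    by_cases hf : Free M w₀
    · simp [hf]
    · obtain ⟨e1, e2, e3⟩ := child_child_wk hM h hw hf
      have hmo : mate M w₀ ∈ a.own α := h.own_mate hwo hf
      simp only [hf, false_and, false_or, not_false_eq_true, true_and, if_false, Option.map_some]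
      constructor
      · rintro ⟨Y, Z, h1, h2, rfl⟩
        obtain ⟨p, hp, rfl⟩ := (r.parent_root_iff hM h hwo hwb).1 h1
        obtain rfl := hp.unique h e1
        obtain ⟨q, hq, rfl⟩ := (r.parent_root_iff hM h hmo e2.1).1 h2
        obtain rfl := hq.unique h e2
        rw [r.root hM h]
      · intro h1
        refine ⟨_, _, (r.parent_root_iff hM h hwo hwb).2 ⟨_, e1, rfl⟩,
          (r.parent_root_iff hM h hmo e2.1).2 ⟨_, e2, rfl⟩, ?_⟩
        rw [r.root hM h, h1]

theorem back_rep {st st' : State V} (r : Rep G M st a) : Backtrack st st' ↔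
    st' = { st with struc := fun α => { st.struc α with
      work := (a.backWk M α).map fun w => {x | a.base x = a.base w} } } := by
  unfold Backtrack
  simp only [backtracksTo_iff hM h r]
  constructor
  · rintro ⟨w, h1, rfl⟩
    obtain rfl : w = _ := funext h1
    rfl
  · rintro rfl
    exact ⟨_, fun _ => rfl, rfl⟩

end AState

end ScaledMatching

namespace ScaledMatching

variable {V : Type*}

open AState

/-! ### Pass-bundles -/

namespace AState

/-- Adjacent outer vertices lie in the same blossom. -/
def Separated (G : SimpleGraph V) (a : AState V) : Prop :=
  ∀ {u v}, G.Adj u v → u ∈ a.out → v ∈ a.out → a.base u = a.base v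

/-- Arcs from outer vertices that are not active are settled. -/
def Explored (G : SimpleGraph V) (M : Set (Sym2 V)) (a : AState V) : Prop :=
  ∀ {u v}, G.Adj u v → u ∈ a.out → a.base u ∉ a.Act M → a.Settled M u v

/-- The structures that are put on hold. -/
def heavy (H : ℕ) (a : AState V) : Set V := {α | 6 * H + 1 ≤ (a.own α).ncard}

variable {G : SimpleGraph V} {M : Set (Sym2 V)} {l : ℕ} {a b : AState V} {H : ℕ}

theorem Settled.mono {x y : V} (hs : a.Settled M x y) (hr : a.removed ⊆ b.removed)
    (ho : ∀ {u}, u ∈ a.out → u ∈ b.out ∨ u ∈ b.removed) (hl : ∀ e, b.lab e ≤ a.lab e)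
    (hD : b.D M (b.base x) = a.D M (a.base x)) : b.Settled M x y := by
  rcases hs with h1 | h1 | h1
  · exact Or.inl (hr h1)
  · rcases ho h1 with h2 | h2
    · exact Or.inr (Or.inl h2)
    · exact Or.inl h2
  · exact Or.inr (Or.inr ((hl _).trans (hD ▸ h1)))

variable [Fintype V]

theorem Adv.light (hab : a.Adv M b) (h : a.Light H) : b.Light H := by
  intro γ h1 h2
  rw [hab.own_eq h1]
  exact h γ (fun h' => h1 (hab.modified h')) (hab.onHold ▸ h2)

/-- A structure still unmodified has not changed since the arc was read, while labels elsewhere only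
fell and outer vertices stayed outer or were removed. -/
theorem Adv.scanned (hab : a.Adv M b) (hb : b.Valid M G l) {x y γ : V}
    (hs : γ ∉ a.modified → γ ∉ a.onHold → a.wk γ = some (a.base x) → a.Settled M x y)
    (h1 : γ ∉ b.modified) (h2 : γ ∉ b.onHold) (h3 : b.wk γ = some (b.base x)) :
    b.Settled M x y := by
  have hx : x ∈ a.own γ := by
    rw [← hab.own_eq h1]; exact own_of_base hb (hb.wk_own h3)
  obtain ⟨-, e1, e2⟩ := hab.vert_eq h1 hx
  refine Settled.mono (hs (fun h' => h1 (hab.modified h')) (hab.onHold ▸ h2) ?_) hab.removed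
    hab.out hab.lab_le ?_
  · rw [← hab.wk_eq h1, h3, e1]
  · rw [e1, e2]

/-- The structures are disjoint, and all vertices but the root of each are covered. -/
theorem heavy_ncard_le (h : a.Valid M G l) :
    6 * H * (a.heavy H).ncard ≤ (covered M).ncard := by
  classical
  have h1 : ∀ α ∈ (a.heavy H).toFinset, 6 * H ≤ (a.own α \ {α}).toFinset.card := by
    intro α hα
    rw [Set.mem_toFinset] at hα
    have h2 : 6 * H + 1 ≤ (a.own α).ncard := hα
    rw [← Set.ncard_eq_toFinset_card']
    have h3 := Set.ncard_le_ncard_sdiff_add_ncard (a.own α) {α} (Set.toFinite _)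
    rw [Set.ncard_singleton] at h3
    omega
  have h2 := Finset.card_nsmul_le_sum _ _ _ h1
  rw [← Finset.card_biUnion, ← Set.ncard_eq_toFinset_card', smul_eq_mul, mul_comm] at h2
  · refine h2.trans ?_
    rw [Set.ncard_eq_toFinset_card']
    refine Finset.card_le_card fun x hx => ?_
    rw [Finset.mem_biUnion] at hx
    obtain ⟨α, -, hx⟩ := hx
    rw [Set.mem_toFinset] at hx ⊢
    exact fun hf => hx.2 (h.own_free hx.1 hf)
  · intro α _ β _ hne
    rw [Function.onFun, Finset.disjoint_left]
    intro x hx hx'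
    rw [Set.mem_toFinset] at hx hx'
    exact hne (h.own_disj hx.1 hx'.1)

end AState

variable [Fintype V] {G : SimpleGraph V} {M : Set (Sym2 V)} {E H : ℕ} {st : State V} {a : AState V}
variable (hM : IsMatchingSet G M)
include hM

namespace Good

theorem mark (g : Good G M E H st a) : Good G M E H (mark H st) (a.marked a.wk (a.heavy H) ∅) where
  rep := by
    have : {α | 6 * H + 1 ≤ (st.struc α).verts.ncard} = a.heavy H := by
      ext α
      change 6 * H + 1 ≤ (st.struc α).verts.ncard ↔ 6 * H + 1 ≤ (a.own α).ncard
      rw [g.rep.verts]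
    unfold ScaledMatching.mark
    rw [this]
    exact marked_rep g.rep g.rep.work
  valid := marked_valid g.valid fun hw => ⟨g.valid.wk_own hw, g.valid.wk_out hw, g.valid.wk_base hw⟩
  sized := g.sized
  augments := g.augments

theorem back (g : Good G M E H st a) {st' : State V} (hst : Backtrack st st') :
    Good G M E H st' (a.back M) := by
  rw [back_rep hM g.valid g.rep] at hst
  subst hst
  refine ⟨?_, back_valid hM g.valid, g.sized, g.augments⟩
  have := marked_rep (hold := a.onHold) (mod := a.modified) g.rep (wk' := a.backWk M)
    (fun α => rfl)
  rw [← g.rep.onHold, ← g.rep.modified] at this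
  rw [AState.back, ← g.rep.onHold, ← g.rep.modified]
  exact this

/-- The last bound is the potential inequality; adding `a'.active ⊆ a.active` to it gives the one
before, which can be summed over pass-bundles. The last one alone has no active structures on its
right side and is needed for the first pass-bundle. -/
theorem bundle (g : Good G M E H st a) (hsep : a.Separated G) (hexp : a.Explored G M)
    {l₁ l₂ : List (V × V)} (h₁ : IsStream G l₁) (h₂ : IsStream G l₂) :
    (∃ st', PassBundle G M H l₁ l₂ st st') ∧ ∀ st', PassBundle G M H l₁ l₂ st st' →
      ∃ a', Good G M E H st' a' ∧ a'.Separated G ∧ a'.Explored G M ∧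
        a'.phi M ≤ a.phi M ∧ a'.active ⊆ a.active ∧
        a'.active.ncard + (a'.active.ncard + (a'.ActN M).ncard) + 3 * a'.phi M ≤
          a.active.ncard + (a.ActN M).ncard + (a.heavy H).ncard + 3 * a.phi M ∧
        a'.active.ncard + (a'.ActN M).ncard + 3 * a'.phi M ≤
          (a.ActN M).ncard + (a.heavy H).ncard + 3 * a.phi M := by
  set a₀ := a.marked a.wk (a.heavy H) ∅ with ha₀
  have g₀ : Good G M E H (ScaledMatching.mark H st) a₀ := g.mark hM
  have hlight : a₀.Light H := fun γ _ hγ => Nat.le_of_lt_succ (not_le.1 hγ)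
  -- the first pass
  obtain ⟨hex1, hI1⟩ := iterate_spec (step := ExtendStep G M)
    (fun pre s => ∃ b, Good G M E H s b ∧ a₀.Adv M b ∧ ∀ e ∈ pre, ∀ γ, γ ∉ b.modified →
      γ ∉ b.onHold → b.wk γ = some (b.base e.1) → b.Settled M e.1 e.2) l₁ (by
      rintro pre ⟨x, y⟩ s hx ⟨b, gb, hb, hpre⟩
      have hxy := (h₁.2 x y).1 hx
      refine ⟨gb.exists_extendStep hM hxy, fun s' hs' => ?_⟩
      obtain ⟨c, gc, hc, hnew⟩ := gb.extendStep hM (hb.light hlight) hxy hs'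
      refine ⟨c, gc, hb.trans gc.valid hc, fun e he γ e1 e2 e3 => ?_⟩
      rw [List.mem_append, List.mem_singleton] at he
      rcases he with he | rfl
      · exact hc.scanned gc.valid (hpre e he γ) e1 e2 e3
      · exact hnew γ e1 e2 e3) _ ⟨a₀, g₀, Adv.refl, fun e he => by simp at he⟩
  -- the second pass
  have hI3 : ∀ {s₂ : State V} {a₂ : AState V}, Good G M E H s₂ a₂ →
      (∀ {α u v}, G.Adj u v → u ∈ a₂.own α → v ∈ a₂.own α → u ∈ a₂.out → v ∈ a₂.out →
        a₂.base u = a₂.base v) →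
      (∃ s₃, Iterate (AugmentStep G M) l₂ s₂ s₃) ∧ ∀ s₃, Iterate (AugmentStep G M) l₂ s₂ s₃ →
        ∃ a₃, Good G M E H s₃ a₃ ∧ a₂.Adv M a₃ ∧ a₃.Separated G := by
    intro s₂ a₂ g₂ hsame
    obtain ⟨hex, hI⟩ := iterate_spec (step := AugmentStep G M)
      (fun pre s => ∃ b, Good G M E H s b ∧ a₂.Adv M b ∧
        (∀ {α u v}, G.Adj u v → u ∈ b.own α → v ∈ b.own α → u ∈ b.out → v ∈ b.out →
          b.base u = b.base v) ∧
        ∀ e ∈ pre, ∀ α β, e.1 ∈ b.out → e.2 ∈ b.out → e.1 ∈ b.own α → e.2 ∈ b.own β → α = β) l₂ (by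
        rintro pre ⟨x, y⟩ s hx ⟨b, gb, hb, hbs, hpre⟩
        have hxy := (h₂.2 x y).1 hx
        refine ⟨gb.exists_augmentStep hM hxy, fun s' hs' => ?_⟩
        obtain ⟨c, gc, hc, hsub, hnew⟩ := gb.augmentStep hM hs'
        refine ⟨c, gc, hb.trans gc.valid hc, ?_, ?_⟩
        · intro α u v e1 e2 e3 e4 e5
          obtain ⟨f1, f2, f3⟩ := hsub u α e4 e2
          obtain ⟨f4, f5, f6⟩ := hsub v α e5 e3
          rw [f3, f6]
          exact hbs e1 f2 f5 f1 f4
        · intro e he α β e1 e2 e3 e4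
          rw [List.mem_append, List.mem_singleton] at he
          rcases he with he | rfl
          · obtain ⟨f1, f2, -⟩ := hsub _ _ e1 e3
            obtain ⟨f3, f4, -⟩ := hsub _ _ e2 e4
            exact hpre e he α β f1 f3 f2 f4
          · exact hnew α β e1 e2 e3 e4) _ ⟨a₂, g₂, Adv.refl, hsame, fun e he => by simp at he⟩
    refine ⟨hex, fun s₃ hs₃ => ?_⟩
    obtain ⟨a₃, g₃, h3, hs, hall⟩ := hI s₃ hs₃
    refine ⟨a₃, g₃, h3, ?_⟩
    intro u v huv hu hv
    obtain ⟨α, hα⟩ := g₃.valid.mem_own (Or.inl hu)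
    obtain ⟨β, hβ⟩ := g₃.valid.mem_own (Or.inl hv)
    obtain rfl := hall (u, v) (by simpa using (h₂.2 u v).2 huv) α β hu hv hα hβ
    exact hs huv hα hβ hu hv
  have hI2 : ∀ {s₁ s₂ : State V}, Iterate (ExtendStep G M) l₁ (ScaledMatching.mark H st) s₁ →
      ContractAll G M s₁ s₂ → ∃ a₂, Good G M E H s₂ a₂ ∧ a₀.Adv M a₂ ∧
      (∀ {α u v}, G.Adj u v → u ∈ a₂.own α → v ∈ a₂.own α → u ∈ a₂.out → v ∈ a₂.out →
        a₂.base u = a₂.base v) ∧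
      ∀ u v, G.Adj u v → ∀ γ, γ ∉ a₂.modified →
        γ ∉ a₂.onHold → a₂.wk γ = some (a₂.base u) → a₂.Settled M u v := by
    intro s₁ s₂ hs₁ hs₂
    obtain ⟨a₁, g₁, h01, hscan⟩ := hI1 s₁ hs₁
    obtain ⟨a₂, g₂, h12, hdone⟩ := g₁.contractAll hM hs₂
    have h02 := h01.trans g₂.valid h12
    refine ⟨a₂, g₂, h02, ?_, ?_⟩
    · intro α u v huv hu hv huo hvo
      -- Two vertices that were outer at the start already shared a blossom. A newly outer one lies
      -- in the working blossom, where no contraction is left to do.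
      by_cases hu₀ : u ∈ a₀.out
      · by_cases hv₀ : v ∈ a₀.out
        · exact h02.base hu₀ hv₀ huo hvo (hsep huv hu₀ hv₀)
        · obtain ⟨γ, -, hγ⟩ := h02.new hvo hv₀
          obtain rfl := g₂.valid.own_disj (own_of_base g₂.valid (g₂.valid.wk_own hγ)) hv
          exact (hdone _ v u huv.symm hv hu hγ huo).symm
      · obtain ⟨γ, -, hγ⟩ := h02.new huo hu₀
        obtain rfl := g₂.valid.own_disj (own_of_base g₂.valid (g₂.valid.wk_own hγ)) hu
        exact hdone _ u v huv hu hv hγ hvo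
    · intro u v huv γ e1 e2 e3
      exact h12.scanned g₂.valid
        (hscan (u, v) (by simpa using (h₁.2 u v).2 huv) γ) e1 e2 e3
  refine ⟨?_, ?_⟩
  · obtain ⟨s₁, hs₁⟩ := hex1
    obtain ⟨a₁, g₁, -⟩ := hI1 s₁ hs₁
    obtain ⟨s₂, hs₂⟩ := exists_contractAll hM _ g₁ le_rfl
    obtain ⟨a₂, g₂, -, h2, -⟩ := hI2 hs₁ hs₂
    obtain ⟨⟨s₃, hs₃⟩, h3⟩ := hI3 g₂ h2
    obtain ⟨a₃, g₃, -⟩ := h3 s₃ hs₃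
    exact ⟨_, s₁, s₂, s₃, hs₁, hs₂, hs₃, (back_rep hM g₃.valid g₃.rep).2 rfl⟩
  · rintro st' ⟨s₁, s₂, s₃, hs₁, hs₂, hs₃, hst'⟩
    obtain ⟨a₂, g₂, h02, hsame, hscan⟩ := hI2 hs₁ hs₂
    obtain ⟨a₃, g₃, h23, hsep₃⟩ := (hI3 g₂ hsame).2 s₃ hs₃
    have h03 := h02.trans g₃.valid h23
    have hact₃ : a₃.active ⊆ a.active := h03.active
    refine ⟨a₃.back M, g₃.back hM hst', hsep₃, ?_, h03.phi_le,
      (back_active hM g₃.valid).trans hact₃, ?_⟩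
    · intro u v huv hu hn
      change a₃.Settled M u v
      have hu' : u ∈ a₃.out := hu
      have hn' : a₃.base u ∉ (a₃.back M).Act M := hn
      -- Either `u` has just been left by a backtracking structure, all of whose arcs were read in
      -- vain, or it was off the active paths from the start and nothing about it changed.
      by_cases hb : a₃.base u ∈ a₃.Act M
      · obtain ⟨γ, e1, e2, e3⟩ := back_act_of hM g₃.valid hb hn'
        exact h23.scanned g₃.valid (hscan u v huv γ) e1 e2 e3
      · obtain ⟨e1, e2, e3⟩ := h03.act hu' hb
        have e4 : a.Settled M u v := hexp huv e1 e2
        exact Settled.mono e4 h03.removed h03.out h03.lab_le e3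
    · have c1 := back_count hM g₃.valid
      have c2 : a₃.active.ncard ≤ (a₃.modified ∩ a₃.active).ncard + (a.heavy H).ncard +
          (a₃.stuck).ncard := by
        -- Each active structure is paid for by labels, by its size, or by its own backtracking.
        have : a₃.active ⊆ (a₃.modified ∩ a₃.active ∪ a.heavy H) ∪ a₃.stuck := by
          intro γ hγ
          by_cases hm : γ ∈ a₃.modified
          · exact Or.inl (Or.inl ⟨hm, hγ⟩)
          by_cases hh : γ ∈ a₃.onHold
          · rw [h03.onHold] at hh
            exact Or.inl (Or.inr hh)
          · exact Or.inr ⟨hγ, hh, hm⟩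
        have e1 := (Set.ncard_le_ncard this (Set.toFinite _)).trans (Set.ncard_union_le _ _)
        have e2 := Set.ncard_union_le (a₃.modified ∩ a₃.active) (a.heavy H)
        omega
      have c3 : (a₃.modified ∩ a₃.active).ncard + 2 * a₃.phi M ≤ 2 * a.phi M := by
        have := h03.mod_le
        rw [show a₀.modified ∩ a₀.active = ∅ from Set.empty_inter _, Set.ncard_empty,
          zero_add] at this
        exact this
      have c4 : (a₃.ActN M).ncard + a₃.phi M ≤ (a.ActN M).ncard + a.phi M := h03.actN_le
      have c5 : a₃.active.ncard ≤ a.active.ncard := Set.ncard_le_ncard hact₃ (Set.toFinite _)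
      have c6 : (a₃.back M).active.ncard ≤ a₃.active.ncard :=
        Set.ncard_le_ncard (back_active hM g₃.valid) (Set.toFinite _)
      have c7 : (a₃.back M).phi M = a₃.phi M := rfl
      have c8 : a₃.phi M ≤ a.phi M := h03.phi_le
      omega

end Good

end ScaledMatching

namespace ScaledMatching

variable {V : Type*}

open AState

/-! ### The beginning of a phase -/

open Classical in
/-- The description of the state at the beginning of a phase. -/
noncomputable def AState.start (M : Set (Sym2 V)) (E : ℕ) : AState V where
  base := id
  par := id
  out := {v | Free M v}
  inn := ∅
  own := fun α => {x | x = α ∧ Free M α}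
  wk := fun α => if Free M α then some α else none
  lab := fun _ => 3 * E + 1
  removed := ∅
  onHold := ∅
  modified := ∅

section Start

variable {G : SimpleGraph V} {M : Set (Sym2 V)} {E : ℕ}

theorem start_wk_eq_some {α w : V} :
    (AState.start M E).wk α = some w ↔ Free M α ∧ w = α := by
  by_cases hα : Free M α
  · simp [AState.start, hα, eq_comm]
  · simp [AState.start, hα]

theorem start_valid : (AState.start M E).Valid M G (3 * E) where
  base_base _ := rfl
  base_out := id
  base_not _ := rfl
  inn_not h := absurd h (Set.notMem_empty _)
  inn_cov h := absurd h (Set.notMem_empty _)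
  inn_mate h := absurd h (Set.notMem_empty _)
  inn_mate_base h := absurd h (Set.notMem_empty _)
  out_free _ _ := rfl
  out_mate h1 h2 := absurd h1 h2
  base_mate h1 h2 := absurd h1 h2
  par_out h := absurd h (Set.notMem_empty _)
  par_adj h := absurd h (Set.notMem_empty _)
  par_lt h := absurd h (Set.notMem_empty _)
  lab_le h := absurd h (Set.notMem_empty _)
  lab_top _ _ _ := rfl
  own_disj h1 h2 := h1.1.symm.trans h2.1
  own_mem h := Or.inl (show Free M _ from h.1 ▸ h.2)
  mem_own h := h.elim (fun h' => ⟨_, rfl, h'⟩) fun h' => absurd h' (Set.notMem_empty _)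
  own_base := id
  own_mate h h' := absurd (h.1 ▸ h.2) h'
  own_par h := absurd h (Set.notMem_empty _)
  own_free h _ := h.1
  own_root h := ⟨⟨rfl, h.2⟩, h.2⟩
  free_own h _ := ⟨rfl, h⟩
  removed_own h := absurd h (Set.notMem_empty _)
  removed_mate h := absurd h (Set.notMem_empty _)
  wk_own h := ⟨(start_wk_eq_some.1 h).2, (start_wk_eq_some.1 h).1⟩
  wk_out h := by
    obtain ⟨h1, h2⟩ := start_wk_eq_some.1 h
    change Free M _
    rwa [h2]
  wk_base _ := rfl

theorem start_anc {b x : V} (h : (AState.start M E).Anc M b x) : b = x := by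
  rcases h.tail_cases with h | ⟨p, -, -, ⟨h1, h2, -⟩ | ⟨h1, -⟩⟩
  · exact h
  · exact absurd h1 h2
  · exact absurd h1 (Set.notMem_empty _)

theorem start_rep : Rep G M (init M E) (AState.start M E) := by
  have hfree : ∀ {α}, Free M α →
      (init M E).struc α = ⟨{α}, ∅, {Blossom.triv α}, some {α}⟩ := fun hα => if_pos hα
  have hcov : ∀ {α}, ¬ Free M α → (init M E).struc α = Struc.empty V := fun hα => if_neg hα
  have harcs : ∀ α, ((init M E).struc α).arcs = ∅ := by
    intro α
    by_cases hα : Free M α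
    · rw [hfree hα]
    · rw [hcov hα]; rfl
  have hblossom : ∀ {α B}, B ∈ ((init M E).struc α).blossoms → Free M α ∧ B = Blossom.triv α := by
    intro α B hB
    by_cases hα : Free M α
    · rw [hfree hα] at hB; exact ⟨hα, hB⟩
    · rw [hcov hα] at hB; exact absurd hB (Set.notMem_empty _)
  refine
    { verts := ?_
      label := rfl
      removed := rfl
      onHold := rfl
      modified := rfl
      work := ?_
      arcs := ?_
      arc_own := ?_
      blossom_own := ?_
      blossom_base := ?_
      blossom_edges := ?_
      blossom_out := ?_ }
  · intro α
    ext x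
    by_cases hα : Free M α
    · rw [hfree hα]
      exact ⟨fun h => ⟨h, hα⟩, fun h => h.1⟩
    · rw [hcov hα]
      exact ⟨fun h => absurd h (Set.notMem_empty _), fun h => absurd h.2 hα⟩
  · intro α
    by_cases hα : Free M α
    · rw [hfree hα, start_wk_eq_some.2 ⟨hα, rfl⟩]
      rfl
    · rw [hcov hα]
      simp [AState.start, hα, Struc.empty]
  · intro α x y _
    rw [harcs]
    constructor
    · intro h; exact absurd h (Set.notMem_empty _)
    · rintro ⟨-, -, h | h⟩
      · exact absurd h.1 (Set.notMem_empty _)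
      · exact absurd h.1 (Set.notMem_empty _)
  · intro α x y h
    rw [harcs] at h
    exact absurd h (Set.notMem_empty _)
  · intro α B x hB hx
    obtain ⟨h1, rfl⟩ := hblossom hB
    exact ⟨hx, h1⟩
  · intro α B x y hB hx hy
    obtain ⟨-, rfl⟩ := hblossom hB
    exact Eq.trans (show x = α from hx) (show y = α from hy).symm
  · intro α B e x hB he
    obtain ⟨-, rfl⟩ := hblossom hB
    exact absurd he (Set.notMem_empty _)
  · rintro α x ⟨rfl, hα⟩ -
    refine ⟨Blossom.triv x, by rw [hfree hα]; rfl, rfl, ?_⟩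
    intro y hy
    have hy' : y = x := hy
    rw [hy']
    exact EvenPath.single rfl

variable [Fintype V]

theorem start_good (hM : IsMatchingSet G M) (H : ℕ) :
    Good G M E H (init M E) (AState.start M E) := by
  refine ⟨start_rep, start_valid, ?_, 0, ?_⟩
  · intro b _ _
    have : {x | (AState.start M E).Anc M b ((AState.start M E).base x)} ⊆ {b} :=
      fun x hx => (start_anc hx).symm
    have h1 := Set.ncard_le_ncard this (Set.toFinite _)
    rw [Set.ncard_singleton] at h1
    omega
  · have h1 : symmDiff M (Set.sUnion (init M E).paths) = M := by
      change symmDiff M (Set.sUnion ∅) = M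
      rw [Set.sUnion_empty]
      exact symmDiff_bot M
    have h2 : (AState.start M E).removed.ncard = 0 := Set.ncard_empty V
    rw [Augments, h1, h2]
    refine ⟨hM, le_rfl, rfl, le_rfl, ?_⟩
    rintro e ⟨P, hP, -⟩
    exact absurd hP (Set.notMem_empty _)

theorem start_phi : (AState.start M E).phi M = (covered M).ncard * (3 * E + 1) := by
  classical
  rw [phi, Set.ncard_eq_toFinset_card', ← smul_eq_mul, ← Finset.sum_const]
  have : (covered M).toFinset = Finset.univ.filter fun v => ¬ Free M v := by
    ext v
    rw [Set.mem_toFinset, Finset.mem_filter]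
    exact ⟨fun hv => ⟨Finset.mem_univ v, hv⟩, fun hv => hv.2⟩
  rw [this, Finset.sum_filter]
  refine Finset.sum_congr rfl fun v _ => ?_
  by_cases hv : Free M v <;> simp [hv, AState.start]

theorem start_separated (hmax : ∀ u v, G.Adj u v → ¬ (Free M u ∧ Free M v)) :
    (AState.start M E).Separated G :=
  fun huv hu hv => absurd ⟨hu, hv⟩ (hmax _ _ huv)

/-- Initially every outer vertex is the working vertex of its own structure, hence on an active
path. -/
theorem start_explored : (AState.start M E).Explored G M :=
  fun {u _} _ hu hn => absurd ⟨hu, rfl, u, u, start_wk_eq_some.2 ⟨hu, rfl⟩,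
    Relation.ReflTransGen.refl⟩ hn

theorem start_actN : (AState.start M E).ActN M = ∅ :=
  Set.eq_empty_of_forall_notMem fun _ hx => hx.2 hx.1.1

theorem start_heavy {H : ℕ} (hH : 1 ≤ H) : (AState.start M E).heavy H = ∅ := by
  refine Set.eq_empty_of_forall_notMem fun α hα => ?_
  have h1 : 6 * H + 1 ≤ ((AState.start M E).own α).ncard := hα
  have h2 : (AState.start M E).own α ⊆ {α} := fun x hx => hx.1
  have h3 := Set.ncard_le_ncard h2 (Set.toFinite _)
  rw [Set.ncard_singleton] at h3
  omega

end Start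

/-! ### The end of a phase -/

section Finish

variable {G : SimpleGraph V} {M : Set (Sym2 V)} {l : ℕ} {a : AState V}
variable (hM : IsMatchingSet G M) (h : a.Valid M G l)
include hM h

theorem D_le {b : V} (hb : b ∈ a.out) (hbb : a.base b = b) : a.D M b ≤ l := by
  by_cases hf : Free M b
  · rw [D_free hb hf]; exact Nat.zero_le _
  · rw [D_out hb hf]
    have := h.lab_le (h.base_mate hb hf hbb)
    rwa [hM.mate_mate] at this

/-- Between two outer nodes of a path there is an unmatched tree arc, and it raises the distance. -/
theorem D_lt_of_anc {b c : V} (hbc : a.Anc M b c) (hne : b ≠ c) (hb : b ∈ a.out) (hc : c ∈ a.out) :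
    a.D M b < a.D M c := by
  rcases hbc.tail_cases with h1 | ⟨p, h1, hp⟩
  · exact absurd h1 hne
  rcases hp.cases h with ⟨-, hf, rfl, hi⟩ | ⟨h2, -, -⟩
  · have h2 := h1.of_child h (fun h' => h.inn_not hi (h' ▸ hb)) (child_par h hi)
    have h3 := h.par_lt hi
    rw [hM.mate_mate] at h3
    rw [D_out hc hf]
    exact (h2.D_le hM h).trans_lt h3
  · exact absurd hc (h.inn_not h2)

/-- The outer nodes of one active path form a chain with distinct distances in `0, …, l`. -/
theorem act_ncard_le [Fintype V] : (a.Act M).ncard ≤ a.active.ncard * (l + 1) := by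
  classical
  have h1 : ∀ b ∈ a.Act M, ∃ γ, γ ∈ a.active ∧ b ∈ a.own γ ∧ ∃ w, a.wk γ = some w ∧ a.Anc M b w := by
    rintro b ⟨-, -, γ, w, h2, h3⟩
    exact ⟨γ, ⟨w, h2⟩, (h3.own hM h).2 (h.wk_own h2), w, h2, h3⟩
  choose! f hf1 hf2 hf3 using h1
  have h2 : (a.Act M).ncard ≤ (a.active ×ˢ Set.Iio (l + 1)).ncard := by
    refine Set.ncard_le_ncard_of_injOn (fun b => (f b, a.D M b)) ?_ ?_ (Set.toFinite _)
    · intro b hb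
      exact ⟨hf1 b hb, Nat.lt_succ_of_le (D_le hM h hb.1 hb.2.1)⟩
    · intro b hb c hc he
      obtain ⟨e1, e2⟩ := Prod.mk.inj he
      obtain ⟨w, f1, f2⟩ := hf3 b hb
      obtain ⟨w', f3, f4⟩ := hf3 c hc
      rw [e1, f3] at f1
      obtain rfl := Option.some.inj f1
      by_contra hne
      rcases f2.total h f4 with f5 | f5
      · exact absurd e2 (D_lt_of_anc hM h f5 hne hb.1 hc.1).ne
      · exact absurd e2 (D_lt_of_anc hM h f5 (Ne.symm hne) hc.1 hb.1).ne'
  rwa [Set.ncard_prod, ← Finset.coe_Iio, Set.ncard_coe_finset, Nat.card_Iio] at h2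

/-- A vertex on the way of a free vertex through `N` and `M` is outer, as long as the way avoids
removed vertices and active paths. -/
theorem exists_traj (hsep : a.Separated G) (hexp : a.Explored G M) {N : Set (Sym2 V)}
    (hN : IsMatchingSet G N) {α : V} (hα : Free M α) (hαN : ¬ Free N α) :
    Runs M N α (l + 1) ∨ ∃ i, Runs M N α i ∧ ((Free N (traj M N α i) ∧ 0 < i) ∨
      traj M N α i ∈ a.Act M ∨ traj M N α i ∈ a.removed ∨
        mate N (traj M N α i) ∈ a.removed) := by
  by_contra hcon
  obtain ⟨hcon1, hcon2⟩ := not_or.1 hcon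
  have hbad : ∀ i, Runs M N α i → ¬ (Free N (traj M N α i) ∧ 0 < i) ∧
      traj M N α i ∉ a.Act M ∧ traj M N α i ∉ a.removed ∧ mate N (traj M N α i) ∉ a.removed := by
    intro i hi
    refine ⟨fun h1 => hcon2 ⟨i, hi, Or.inl h1⟩, fun h1 => hcon2 ⟨i, hi, Or.inr (Or.inl h1)⟩,
      fun h1 => hcon2 ⟨i, hi, Or.inr (Or.inr (Or.inl h1))⟩,
      fun h1 => hcon2 ⟨i, hi, Or.inr (Or.inr (Or.inr h1))⟩⟩
  -- That the base is itself an earlier even vertex serves twice: it puts the base off the active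
  -- paths, and it shows that an odd vertex in the same blossom is not the base.
  have key : ∀ i, i ≤ l + 1 → Runs M N α i ∧ (i ≤ l → traj M N α i ∈ a.out ∧
      a.D M (a.base (traj M N α i)) ≤ i ∧ ∃ s ≤ i, a.base (traj M N α i) = traj M N α s) := by
    intro i
    induction i with
    | zero =>
      intro _
      have hr : Runs M N α 0 := ⟨hα, fun j hj => absurd hj (Nat.not_lt_zero j)⟩
      refine ⟨hr, fun _ => ?_⟩
      have h1 : α ∉ a.removed := (hbad 0 hr).2.2.1
      have h2 : α ∈ a.out :=
        (h.own_mem (h.free_own hα h1)).resolve_right fun hi => h.inn_cov hi hα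
      have h3 := h.out_free h2 hα
      refine ⟨h2, ?_, 0, le_rfl, h3⟩
      change a.D M (a.base α) ≤ 0
      rw [h3, D_free h2 hα]
    | succ i ih =>
      intro hi
      obtain ⟨hr, h1⟩ := ih (by omega)
      obtain ⟨hxo, hD, s, hs, hxs⟩ := h1 (by omega)
      obtain ⟨b1, -, -, b4⟩ := hbad i hr
      set x := traj M N α i with hx
      have hxN : ¬ Free N x := by
        rcases Nat.eq_zero_or_pos i with h2 | h2
        · rw [hx, h2]; exact hαN
        · exact fun h3 => b1 ⟨h3, h2⟩
      set e := mate N x with he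
      have hadj : G.Adj x e := hN.adj (mate_mem hxN)
      have hact : a.base x ∉ a.Act M := by
        rw [hxs]; exact (hbad s (hr.mono hs)).2.1
      have hstep : traj M N α (i + 1) = mate M e := rfl
      have hnext : ¬ Free M e → Runs M N α (i + 1) := by
        intro hf
        refine ⟨hα, fun j hj => ?_⟩
        rcases Nat.lt_succ_iff_lt_or_eq.1 hj with h2 | h2
        · exact hr.2 j h2
        · rw [h2]; exact ⟨hxN, hf⟩
      by_cases heo : e ∈ a.out
      -- The walk stays inside one blossom: `e` is not its base, so its partner belongs to the
      -- blossom too and the distance does not change.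
      · have hb : a.base x = a.base e := hsep hadj hxo heo
        have hne : a.base e ≠ e := by
          rw [← hb, hxs]
          exact (mate_traj_ne hM hN (i - s) (by omega) hs hr hxN).symm
        have hf : ¬ Free M e := fun hf => hne (h.out_free heo hf)
        refine ⟨hnext hf, fun _ => ?_⟩
        have hm := h.out_mate heo hf hne
        rw [hstep, hm]
        refine ⟨base_mem_out h (hm ▸ h.base_out heo), ?_, s, by omega, by rw [← hb, hxs]⟩
        rw [← hb]
        omega
      · have hf : ¬ Free M e := by
          intro hf
          exact (h.own_mem (h.free_own hf b4)).elim heo fun h' => h.inn_cov h' hf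
        refine ⟨hnext hf, fun hi' => ?_⟩
        -- The arc into `e` is settled, so the label is at most `i + 1 ≤ l`. It is then not the
        -- initial label, and the partner of `e` must be an outer node.
        have hlab : a.lab (e, mate M e) ≤ a.D M (a.base x) + 1 := by
          rcases hexp hadj hxo hact with h2 | h2 | h2
          · exact absurd h2 b4
          · exact absurd h2 heo
          · exact h2
        have hmo : mate M e ∈ a.out := by
          by_contra hmo
          have := h.lab_top hf b4 hmo
          omega
        have hei := (mate_out_iff hM h heo hf).1 hmo
        rw [hstep, h.inn_mate_base hei]
        refine ⟨hmo, ?_, i + 1, le_rfl, rfl⟩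
        rw [D_out hmo (by rwa [free_mate_iff]), hM.mate_mate]
        omega
  exact hcon1 (key (l + 1) le_rfl).1

end Finish

/-! ### Phases -/

variable [Fintype V] {G : SimpleGraph V} {M : Set (Sym2 V)} {E H : ℕ}

/-- The bookkeeping of the number of active structures over the pass-bundles of a phase. -/
def Counted (M : Set (Sym2 V)) (E H n : ℕ) (a : AState V) : Prop :=
  (n = 0 ∧ a = AState.start M E) ∨ ∃ k, n = k + 1 ∧
    k * (6 * H * a.active.ncard) +
      6 * H * (a.active.ncard + (a.ActN M).ncard + 3 * a.phi M) ≤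
    k * (covered M).ncard + 18 * H * ((covered M).ncard * (3 * E + 1))

/-- Here `x` counts the long walks, `y` the outer nodes on active paths and `n` the augmentations.
The summed potential bounds the final number of active structures, because the active sets only
shrink from one pass-bundle to the next. -/
theorem phase_spec (hM : IsMatchingSet G M) (hmax : ∀ u v, G.Adj u v → ¬ (Free M u ∧ Free M v))
    (hE : 1 ≤ E) (hH : 1 ≤ H) {l₁ l₂ : ℕ → List (V × V)} (h₁ : ∀ τ, IsStream G (l₁ τ))
    (h₂ : ∀ τ, IsStream G (l₂ τ)) :
    (∃ M', Phase G E H l₁ l₂ M M') ∧ ∀ M', Phase G E H l₁ l₂ M M' →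
      IsMatchingSet G M' ∧ covered M ⊆ covered M' ∧ ∃ n,
        (covered M').ncard = (covered M).ncard + 2 * n ∧ ∀ N, IsMatchingSet G N →
        ∃ x y, x * (3 * E + 1) ≤ (covered M).ncard ∧
          2 * H * y ≤ (3 * E + 1) * (covered M).ncard ∧
          (covered N).ncard ≤ (covered M).ncard + x + y + 4 * (18 * H * E + 2) * n := by
  obtain ⟨hex, hI⟩ := iterate_spec
    (step := fun s τ s' => PassBundle G M H (l₁ τ) (l₂ τ) s s')
    (fun pre s => ∃ a, Good G M E H s a ∧ a.Separated G ∧ a.Explored G M ∧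
      Counted M E H pre.length a) (List.range (72 * H * E)) (by
      rintro pre τ s - ⟨a, g, h1, h2, h3⟩
      obtain ⟨e1, e2⟩ := g.bundle hM h1 h2 (h₁ τ) (h₂ τ)
      refine ⟨e1, fun s' hs' => ?_⟩
      obtain ⟨b, f1, f2, f3, f4, f5, f6, f7⟩ := e2 s' hs'
      refine ⟨b, f1, f2, f3, Or.inr ⟨pre.length, by simp, ?_⟩⟩
      rcases h3 with ⟨h3, rfl⟩ | ⟨k, h3, h4⟩
      -- The number of free vertices is not bounded in terms of `covered M`, so the first
      -- pass-bundle uses the inequality that drops the initially active structures. No structure is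
      -- on hold yet.
      · rw [h3]
        rw [start_actN, start_heavy hH, start_phi, Set.ncard_empty] at f7
        have := Nat.mul_le_mul_left (6 * H) f7
        linarith
      · rw [h3]
        have c1 := Nat.mul_le_mul_left (6 * H) f6
        have c2 := heavy_ncard_le (H := H) g.valid
        have c3 : k * (6 * H * b.active.ncard) ≤ k * (6 * H * a.active.ncard) :=
          Nat.mul_le_mul_left _ (Nat.mul_le_mul_left _
            (Set.ncard_le_ncard f5 (Set.toFinite _)))
        linarith) (init M E)
    ⟨_, start_good hM H, start_separated hmax, start_explored, Or.inl ⟨rfl, rfl⟩⟩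
  refine ⟨?_, ?_⟩
  · obtain ⟨st, hst⟩ := hex
    exact ⟨_, st, hst, rfl⟩
  · rintro M' ⟨st, hst, rfl⟩
    obtain ⟨a, g, hsep, hexp, hcount⟩ := hI st hst
    obtain ⟨n, k1, k2, k3, k4, -⟩ := g.augments
    refine ⟨k1, k2, n, k3, fun N hN => ?_⟩
    obtain ⟨x, hx, hle⟩ := covered_ncard_le hM hN (A := a.Act M) (R := a.removed) (l := 3 * E + 1)
      fun α hα hαN => exists_traj hM g.valid hsep hexp hN hα hαN
    refine ⟨x, (a.Act M).ncard, hx, ?_, ?_⟩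
    · have hT : 1 ≤ H * E := Nat.mul_pos hH hE
      rw [List.length_range] at hcount
      rcases hcount with ⟨h0, -⟩ | ⟨k, hk, hc⟩
      · have : 72 * H * E = 72 * (H * E) := by ring
        omega
      · have hk1 : 1 ≤ k := by
          have : 72 * H * E = 72 * (H * E) := by ring
          omega
        -- The number `72 * H * E` of pass-bundles is large enough to absorb the initial label sum,
        -- as `18 * (3 * E + 1) ≤ 72 * E`.
        have e1 : 18 * H * ((covered M).ncard * (3 * E + 1)) ≤ (k + 1) * (covered M).ncard := by
          have : 3 * E + 1 ≤ 4 * E := by omega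
          rw [← hk]
          calc 18 * H * ((covered M).ncard * (3 * E + 1)) ≤
              18 * H * ((covered M).ncard * (4 * E)) :=
                Nat.mul_le_mul_left _ (Nat.mul_le_mul_left _ this)
            _ = 72 * H * E * (covered M).ncard := by ring
        have e2 : k * (6 * H * a.active.ncard) ≤ k * (3 * (covered M).ncard) := by
          have : (covered M).ncard ≤ k * (covered M).ncard := Nat.le_mul_of_pos_left _ hk1
          nlinarith [Nat.zero_le (6 * H * (a.active.ncard + (a.ActN M).ncard + 3 * a.phi M))]
        have e3 := Nat.le_of_mul_le_mul_left e2 hk1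
        have e4 : 2 * H * a.active.ncard ≤ (covered M).ncard := by linarith
        calc 2 * H * (a.Act M).ncard ≤ 2 * H * (a.active.ncard * (3 * E + 1)) :=
              Nat.mul_le_mul_left _ (act_ncard_le hM g.valid)
          _ = (3 * E + 1) * (2 * H * a.active.ncard) := by ring
          _ ≤ (3 * E + 1) * (covered M).ncard := Nat.mul_le_mul_left _ e4
    · have : 2 * a.removed.ncard ≤ 4 * (18 * H * E + 2) * n := by linarith
      omega

end ScaledMatching

namespace ScaledMatching

variable {V : Type*}

/-! ### Scales -/

/-- The gap to a maximum matching over the phases of a scale: either it is small, or it has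
decreased in proportion to the number `t` of phases. -/
theorem gap_step {m m₀ n C p q s t : ℝ} (hn : 0 ≤ n) (hp : 0 ≤ p) (hq : 0 ≤ q)
    (hs : 0 < s) (hC : C ≤ m + m * (p / 3 + 2 * q) + 2 * s * n)
    (h : C ≤ (1 + (p / 2 + 5 * q)) * m ∨
      (m₀ ≤ m ∧ C ≤ m + (p / 2 + 10 * q) * m₀ - t * ((p / 6 + 3 * q) / s * m₀))) :
    C ≤ (1 + (p / 2 + 5 * q)) * (m + 2 * n) ∨
      (m₀ ≤ m + 2 * n ∧
        C ≤ m + 2 * n + (p / 2 + 10 * q) * m₀ - (t + 1) * ((p / 6 + 3 * q) / s * m₀)) := by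
  have hmono : (1 + (p / 2 + 5 * q)) * m ≤ (1 + (p / 2 + 5 * q)) * (m + 2 * n) :=
    mul_le_mul_of_nonneg_left (by linarith) (by positivity)
  rcases h with h | ⟨h1, h2⟩
  · exact Or.inl (h.trans hmono)
  by_cases h3 : C ≤ (1 + (p / 2 + 5 * q)) * m
  · exact Or.inl (h3.trans hmono)
  refine Or.inr ⟨by linarith, ?_⟩
  -- The target error `p / 2 + 5 * q` exceeds the error `p / 3 + 2 * q` of a phase by exactly this
  -- factor, so a missed target forces many augmentations.
  have h4 : (p / 6 + 3 * q) * m ≤ 2 * s * n := by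
    push Not at h3
    nlinarith
  have h5 : (p / 6 + 3 * q) / s * m₀ ≤ 2 * n := by
    rw [div_mul_eq_mul_div, div_le_iff₀ hs]
    have : (p / 6 + 3 * q) * m₀ ≤ (p / 6 + 3 * q) * m :=
      mul_le_mul_of_nonneg_left h1 (by positivity)
    linarith
  linarith

variable [Fintype V] {G : SimpleGraph V} {M : Set (Sym2 V)} {E H : ℕ}

/-- The sizes of the matchings of `G` exceed that of `M` at most by the factor `1 + r`. -/
def Approx (G : SimpleGraph V) (M : Set (Sym2 V)) (r : ℝ) : Prop :=
  ∀ N, IsMatchingSet G N → ((covered N).ncard : ℝ) ≤ (1 + r) * (covered M).ncard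

/-- The constants come from `3 * E + 1 ≥ 3 * E`, from `(3 * E + 1) / (2 * H) ≤ 2 * E / H`, and from
`4 * (18 * H * E + 2) ≤ 80 * H * E`. -/
theorem phase_bound {m x y n C : ℕ} (hE : 1 ≤ E) (hH : 1 ≤ H) (hx : x * (3 * E + 1) ≤ m)
    (hy : 2 * H * y ≤ (3 * E + 1) * m) (hC : C ≤ m + x + y + 4 * (18 * H * E + 2) * n) :
    (C : ℝ) ≤ m + m * ((E : ℝ)⁻¹ / 3 + 2 * ((E : ℝ) / H)) + 2 * (40 * H * E) * n := by
  have hE' : (1 : ℝ) ≤ E := by exact_mod_cast hE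
  have hH' : (1 : ℝ) ≤ H := by exact_mod_cast hH
  have hm : (0 : ℝ) ≤ m := Nat.cast_nonneg m
  have hn : (0 : ℝ) ≤ n := Nat.cast_nonneg n
  have hx' : (x : ℝ) * (3 * E + 1) ≤ m := by exact_mod_cast hx
  have hy' : 2 * (H : ℝ) * y ≤ (3 * E + 1) * m := by exact_mod_cast hy
  have hC' : (C : ℝ) ≤ m + x + y + 4 * (18 * H * E + 2) * n := by exact_mod_cast hC
  have h1 : (x : ℝ) ≤ m * ((E : ℝ)⁻¹ / 3) := by
    rw [inv_eq_one_div, div_div, mul_one_div, le_div_iff₀ (by positivity)]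
    nlinarith [Nat.cast_nonneg (α := ℝ) x]
  have h2 : (y : ℝ) ≤ m * (2 * ((E : ℝ) / H)) := by
    rw [← mul_div_assoc, ← mul_div_assoc, le_div_iff₀ (by positivity)]
    nlinarith
  have h3 : (1 : ℝ) ≤ H * E := by nlinarith
  have h4 : (4 * (18 * H * E + 2) * n : ℝ) ≤ 2 * (40 * H * E) * n :=
    mul_le_mul_of_nonneg_right (by nlinarith) hn
  linarith

/-- As long as the target is missed, every phase enlarges the covered set by a fixed fraction of its
size at the start of the scale. After all phases of the scale these gains exceed the initial gap. -/
theorem scale_spec (hM : IsMatchingSet G M) (hmax : ∀ u v, G.Adj u v → ¬ (Free M u ∧ Free M v))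
    (hE : 1 ≤ E) (hH : 1 ≤ H) {l₁ l₂ : ℕ → ℕ → List (V × V)} (h₁ : ∀ t τ, IsStream G (l₁ t τ))
    (h₂ : ∀ t τ, IsStream G (l₂ t τ))
    (hA : Approx G M ((E : ℝ)⁻¹ / 2 + 10 * ((E : ℝ) / H))) :
    (∃ M', Iterate (fun N₁ t N₂ => Phase G E H (l₁ t) (l₂ t) N₁ N₂)
      (List.range (144 * H * E)) M M') ∧
    ∀ M', Iterate (fun N₁ t N₂ => Phase G E H (l₁ t) (l₂ t) N₁ N₂)
      (List.range (144 * H * E)) M M' →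
      IsMatchingSet G M' ∧ (∀ u v, G.Adj u v → ¬ (Free M' u ∧ Free M' v)) ∧
        Approx G M' ((E : ℝ)⁻¹ / 2 + 5 * ((E : ℝ) / H)) := by
  have hE' : (0 : ℝ) < E := by exact_mod_cast hE
  have hH' : (0 : ℝ) < H := by exact_mod_cast hH
  obtain ⟨hex, hI⟩ := iterate_spec (step := fun N₁ t N₂ => Phase G E H (l₁ t) (l₂ t) N₁ N₂)
    (fun pre M' => IsMatchingSet G M' ∧ (∀ u v, G.Adj u v → ¬ (Free M' u ∧ Free M' v)) ∧
      ∀ N, IsMatchingSet G N →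
        ((covered N).ncard : ℝ) ≤
          (1 + ((E : ℝ)⁻¹ / 2 + 5 * ((E : ℝ) / H))) * ((covered M').ncard : ℝ) ∨
        (((covered M).ncard : ℝ) ≤ (covered M').ncard ∧ ((covered N).ncard : ℝ) ≤
          (covered M').ncard + ((E : ℝ)⁻¹ / 2 + 10 * ((E : ℝ) / H)) * (covered M).ncard -
            (pre.length : ℝ) * (((E : ℝ)⁻¹ / 6 + 3 * ((E : ℝ) / H)) / (40 * H * E) *
              (covered M).ncard))) (List.range (144 * H * E)) (by
      rintro pre t M₁ - ⟨e1, e2, e3⟩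
      obtain ⟨f1, f2⟩ := phase_spec e1 e2 hE hH (h₁ t) (h₂ t)
      refine ⟨f1, fun M₂ hM₂ => ?_⟩
      obtain ⟨g1, g2, n, g3, g4⟩ := f2 M₂ hM₂
      refine ⟨g1, fun u v huv hf => e2 u v huv ?_, fun N hN => ?_⟩
      · exact ⟨not_not.1 fun h => g2 h hf.1, not_not.1 fun h => g2 h hf.2⟩
      · obtain ⟨x, y, hx, hy, hC⟩ := g4 N hN
        have := gap_step (Nat.cast_nonneg n) (by positivity) (by positivity)
          (by positivity) (phase_bound hE hH hx hy hC) (e3 N hN)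
        rw [g3, List.length_append, List.length_singleton]
        push_cast
        exact this) M
    ⟨hM, hmax, fun N hN => Or.inr ⟨le_rfl, by
      have := hA N hN
      simp only [List.length_nil, Nat.cast_zero, zero_mul, sub_zero]
      linarith⟩⟩
  refine ⟨hex, fun M' hM' => ?_⟩
  obtain ⟨e1, e2, e3⟩ := hI M' hM'
  refine ⟨e1, e2, fun N hN => ?_⟩
  rcases e3 N hN with h | ⟨h1, h2⟩
  · exact h
  · rw [List.length_range] at h2
    -- The ratio `144 / 40` turns `1 / 6` and `3` into `3 / 5` and `54 / 5`, more than the `1 / 2`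
    -- and `10` of the initial gap.
    have h3 : ((144 * H * E : ℕ) : ℝ) * (((E : ℝ)⁻¹ / 6 + 3 * ((E : ℝ) / H)) / (40 * H * E) *
        (covered M).ncard) =
        144 / 40 * ((E : ℝ)⁻¹ / 6 + 3 * ((E : ℝ) / H)) * (covered M).ncard := by
      push_cast
      field_simp
    rw [h3] at h2
    have h4 : (0 : ℝ) ≤ (E : ℝ)⁻¹ := by positivity
    have h5 : (0 : ℝ) ≤ (E : ℝ) / H := by positivity
    have h6 : (0 : ℝ) ≤ (covered M).ncard := Nat.cast_nonneg _
    have h7 : (0 : ℝ) ≤ (covered M').ncard := Nat.cast_nonneg _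
    have h8 : (0 : ℝ) ≤ (E : ℝ)⁻¹ * (covered M).ncard := by positivity
    have h9 : (0 : ℝ) ≤ (E : ℝ) / H * (covered M).ncard := by positivity
    have h10 : (0 : ℝ) ≤ ((E : ℝ)⁻¹ / 2 + 5 * ((E : ℝ) / H)) * (covered M').ncard := by
      positivity
    nlinarith

/-- The error guaranteed after one scale is the one required before the next, since `E / H` halves
from scale to scale. -/
theorem outputs_spec (k : ℕ) {σ : Streams V} (hσ : σ.Valid G) :
    (∃ M, Outputs G (2 ^ k) σ M) ∧ ∀ M, Outputs G (2 ^ k) σ M →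
      IsMatchingSet G M ∧ Approx G M ((2 ^ k : ℝ)⁻¹) := by
  have hE : 1 ≤ 2 ^ k := Nat.one_le_two_pow
  have hE' : (1 : ℝ) ≤ 2 ^ k := one_le_pow₀ one_le_two
  have hg := greedy_spec (G := G) σ.initial fun a ha => (hσ.1.2 a.1 a.2).1 ha
  have hmax : ∀ u v, G.Adj u v → ¬ (Free (greedy σ.initial) u ∧ Free (greedy σ.initial) v) :=
    fun u v huv => hg.2 (u, v) ((hσ.1.2 u v).2 huv)
  have hlog : Nat.log 2 (64 * (2 ^ k) ^ 2) = 6 + 2 * k := by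
    rw [show 64 * (2 ^ k) ^ 2 = 2 ^ (6 + 2 * k) by rw [← pow_mul, pow_add, mul_comm k 2]; norm_num]
    exact Nat.log_pow one_lt_two _
  obtain ⟨hex, hI⟩ := iterate_of_prefix (step := fun M₁ H M₂ =>
      Iterate (fun N₁ t N₂ => Phase G (2 ^ k) H (σ.extend H t) (σ.augment H t) N₁ N₂)
        (List.range (144 * H * 2 ^ k)) M₁ M₂)
    (fun pre M' => IsMatchingSet G M' ∧ (∀ u v, G.Adj u v → ¬ (Free M' u ∧ Free M' v)) ∧
      Approx G M' ((2 ^ k : ℝ)⁻¹ / 2 + 5 * (2 ^ k / 2 ^ pre.length))) (scales (2 ^ k)) (by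
      rintro pre H M₁ hpre ⟨e1, e2, e3⟩
      -- The number of completed scales determines the next one, so the invariant can be stated
      -- through the length of the prefix.
      obtain rfl : H = 2 ^ (pre.length + 1) := by
        obtain ⟨post, hpost⟩ := hpre
        have h1 : (scales (2 ^ k))[pre.length]? = some H := by
          rw [← hpost]; simp
        simp only [scales, List.getElem?_map, Option.map_eq_some_iff] at h1
        obtain ⟨j, hj, rfl⟩ := h1
        rw [List.getElem?_eq_some_iff] at hj
        obtain ⟨hj, rfl⟩ := hj
        rw [List.getElem_range]
      have e4 : Approx G M₁ ((((2 ^ k : ℕ) : ℝ))⁻¹ / 2 +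
          10 * (((2 ^ k : ℕ) : ℝ) / ((2 ^ (pre.length + 1) : ℕ) : ℝ))) := by
        convert e3 using 2
        · push_cast; rfl
        · push_cast
          rw [pow_succ]
          field_simp
          norm_num
      obtain ⟨f1, f2⟩ := scale_spec e1 e2 hE Nat.one_le_two_pow
        (fun t τ => hσ.2.1 (2 ^ (pre.length + 1)) t τ)
        (fun t τ => hσ.2.2 (2 ^ (pre.length + 1)) t τ) e4
      refine ⟨f1, fun M₂ hM₂ => ?_⟩
      obtain ⟨g1, g2, g3⟩ := f2 M₂ hM₂
      refine ⟨g1, g2, ?_⟩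
      rw [List.length_append, List.length_singleton]
      exact_mod_cast g3) (scales (2 ^ k)) [] (greedy σ.initial) rfl
    ⟨hg.1, hmax, fun N hN => by
      -- Before the first scale the required error is at least `5 * 2 ^ k`, so the factor two of a
      -- maximal matching is more than enough.
      have h1 : ((covered N).ncard : ℝ) ≤ 2 * (covered (greedy σ.initial)).ncard := by
        exact_mod_cast covered_ncard_le_of_maximal hN hmax
      refine h1.trans (mul_le_mul_of_nonneg_right ?_ (Nat.cast_nonneg _))
      have : (0 : ℝ) ≤ (2 ^ k : ℝ)⁻¹ := by positivity
      simp only [List.length_nil, pow_zero, div_one]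
      linarith⟩
  refine ⟨hex, fun M hM => ?_⟩
  obtain ⟨e1, -, e3⟩ := hI M hM
  refine ⟨e1, fun N hN => (e3 N hN).trans (mul_le_mul_of_nonneg_right ?_ (Nat.cast_nonneg _))⟩
  have h1 : (2 : ℝ) ^ (scales (2 ^ k)).length = 64 * (2 ^ k) ^ 2 := by
    rw [scales, List.length_map, List.length_range, hlog, pow_add, mul_comm 2 k, pow_mul]
    norm_num
  -- At the last scale `5 * E / H` is `5 / 64` of `ε`, which fits into the remaining half.
  have h2 : (2 ^ k : ℝ) / (64 * (2 ^ k) ^ 2) = (2 ^ k : ℝ)⁻¹ / 64 := by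
    field_simp
  have h3 : (0 : ℝ) ≤ (2 ^ k : ℝ)⁻¹ := by positivity
  rw [h1, h2]
  linarith

end ScaledMatching
-- The approximation guarantee for matchings as subgraphs
theorem mainTheorem2 {V : Type*} [Fintype V] (G : SimpleGraph V)
    (ε : ℝ) (k : ℕ) (hε : ε⁻¹ = 2 ^ k)
    (σ : ScaledMatching.Streams V) (hσ : σ.Valid G) :
    (∃ M, ScaledMatching.Outputs G (2 ^ k) σ M) ∧
      ∀ M, ScaledMatching.Outputs G (2 ^ k) σ M →
        ∃ S : G.Subgraph, S.IsMatching ∧ S.edgeSet = M ∧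
          ∀ N : G.Subgraph, N.IsMatching →
            (N.edgeSet.ncard : ℝ) ≤ (1 + ε) * (S.edgeSet.ncard : ℝ) := by
  obtain ⟨hex, hI⟩ := ScaledMatching.outputs_spec k hσ
  refine ⟨hex, fun M hM => ?_⟩
  obtain ⟨h1, h2⟩ := hI M hM
  refine ⟨h1.toSubgraph, h1.isMatching, h1.edgeSet_toSubgraph, fun N hN => ?_⟩
  have hN' := ScaledMatching.isMatchingSet_edgeSet hN
  have h3 := h2 _ hN'
  -- Both covered sets have twice as many vertices as the matchings have edges, so the factor two
  -- cancels.
  rw [hN'.ncard_covered _ rfl, h1.ncard_covered _ rfl, ← hε, inv_inv] at h3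
  rw [h1.edgeSet_toSubgraph]
  push_cast at h3
  linarith
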